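/- Let $(M,g)$ be a compact connected Riemannian manifold of dimension $n\ge 3$ with Levi-Civita connection $\nabla$ and volume measure $dv_g$, let $(\bar M,\bar g)$ be a complete Riemannian manifold of dimension $m\ge 2$, and let $f:(M,g)\to(\bar M,\bar g)$ be a smooth harmonic map, that is, a critical point, for every relatively compact open $U\subset M$, of the energy $E_U(f)=\frac12\int_U e(f)\,dv_g$, $e(f)=\operatorname{trace}_g f^*\bar g$, under all smooth variations with compact support in $U$; write $E(f)=E_M(f)$. For a one-form $\theta$ put $\delta^*\theta=\frac12 L_{\theta^\#}g$ and $\delta\theta=-\operatorname{div}\theta^\#$, and for a symmetric two-form $\varphi$ put $(\delta\varphi)(Y)=-\sum_{i}(\nabla_{e_i}\varphi)(e_i,Y)$, where $(e_i)$ is a $g$-orthonormal basis. Let $f^*\bar g=\delta^*\theta+\varphi_0$ be the Berger–Ebin decomposition of the pullback metric, with $\theta$ a smooth one-form and $\varphi_0$ a smooth symmetric two-form with $\delta\varphi_0=0$. Suppose that $\theta^\#$ is an infinitesimal harmonic transformation, that is, $\Delta_S\theta=0$, where $\Delta_S=2\delta\delta^*-d\delta$ is the Sampson Laplacian. Then there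 is a constant $C\ge 0$ such that $$e(f)=-\delta\theta+C \quad\text{on } M, \qquad E(f)=\frac{C}{2}\operatorname{Vol}(M,g).$$ -/

import Mathlib

open Bundle Set MeasureTheory FiberBundle
open scoped Manifold ContDiff Topology ENNReal

noncomputable section

namespace RiemannianGeometry

section Pointwise

variable {E : Type*} [NormedAddCommGroup E] [NormedSpace ℝ E] [FiniteDimensional ℝ E]
  {H : Type*} [TopologicalSpace H] {I : ModelWithCorners ℝ E H}
  {M : Type*} [TopologicalSpace M] [ChartedSpace H M]

instance finiteDimensional_tangentSpace (x : M) : FiniteDimensional ℝ (TangentSpace I x) :=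
  inferInstanceAs (FiniteDimensional ℝ E)

variable [RiemannianBundle (fun x : M ↦ TangentSpace I x)]

variable (I) in
/-- A `g`-orthonormal basis of the tangent space at `x`. -/
def orthoBasis (x : M) :
    OrthonormalBasis (Fin (Module.finrank ℝ (TangentSpace I x))) ℝ (TangentSpace I x) :=
  stdOrthonormalBasis ℝ (TangentSpace I x)

/-- The trace, with respect to the metric `g`, of a bilinear form on the tangent space at `x`. -/
def metricTrace {x : M} (B : TangentSpace I x →L[ℝ] TangentSpace I x →L[ℝ] ℝ) : ℝ :=
  ∑ i, B (orthoBasis I x i) (orthoBasis I x i)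

/-- The vector field `θ^♯` dual by `g` to the one-form `θ`, i.e. `g(θ^♯, v) = θ(v)`. -/
def sharp (θ : Π x : M, TangentSpace I x →L[ℝ] ℝ) (x : M) : TangentSpace I x :=
  ∑ i, θ x (orthoBasis I x i) • orthoBasis I x i

theorem inner_sharp (θ : Π x : M, TangentSpace I x →L[ℝ] ℝ) (x : M) (v : TangentSpace I x) :
    inner ℝ (sharp θ x) v = θ x v := by
  conv_rhs => rw [← (orthoBasis I x).sum_repr' v]
  simp only [sharp, sum_inner, real_inner_smul_left, map_sum, map_smul, smul_eq_mul]
  exact Finset.sum_congr rfl fun i _ ↦ mul_comm _ _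

end Pointwise

section LeviCivita

variable {E : Type*} [NormedAddCommGroup E] [NormedSpace ℝ E]
  {H : Type*} [TopologicalSpace H] {I : ModelWithCorners ℝ E H}
  {M : Type*} [TopologicalSpace M] [ChartedSpace H M]
  [RiemannianBundle (fun x : M ↦ TangentSpace I x)]

/-- The right-hand side of the Koszul formula for `g(∇_X Y, Z)`, at the point `x`. -/
def koszul (X Y Z : Π x : M, TangentSpace I x) (x : M) : ℝ :=
  (1 / 2) * (mvfderiv I (fun y ↦ (inner ℝ (Y y) (Z y) : ℝ)) x (X x)
    + mvfderiv I (fun y ↦ (inner ℝ (X y) (Z y) : ℝ)) x (Y x)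
    - mvfderiv I (fun y ↦ (inner ℝ (X y) (Y y) : ℝ)) x (Z x)
    + inner ℝ (VectorField.mlieBracket I X Y x) (Z x)
    - inner ℝ (VectorField.mlieBracket I X Z x) (Y x)
    - inner ℝ (VectorField.mlieBracket I Y Z x) (X x))

variable [IsManifold I ∞ M]
  [IsContMDiffRiemannianBundle I ∞ E (fun x : M ↦ TangentSpace I x)]

theorem mdifferentiableAt_inner {X Y : Π x : M, TangentSpace I x} {x : M}
    (hX : MDiffAt (T% X) x) (hY : MDiffAt (T% Y) x) :
    MDiffAt (fun y ↦ (inner ℝ (X y) (Y y) : ℝ)) x :=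
  MDifferentiableAt.inner_bundle (IB := I) (F := E) (E := fun y : M ↦ TangentSpace I y)
    (b := fun y ↦ y) hX hY

variable [FiniteDimensional ℝ E]

theorem koszul_tensorial_left {Y Z : Π x : M, TangentSpace I x} {x : M}
    (hY : MDiffAt (T% Y) x) (hZ : MDiffAt (T% Z) x) :
    TensorialAt I E (fun X ↦ koszul X Y Z x) x where
  smul {f X} hf hX := by
    have := FiniteDimensional.complete ℝ E
    have h1 := mvfderiv_mul hf (mdifferentiableAt_inner hX hZ)
    have h2 := mvfderiv_mul hf (mdifferentiableAt_inner hX hY)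
    have e1 : (fun y ↦ (inner ℝ ((f • X) y) (Z y) : ℝ)) = f * fun y ↦ inner ℝ (X y) (Z y) := by
      ext y; simp [real_inner_smul_left]
    have e2 : (fun y ↦ (inner ℝ ((f • X) y) (Y y) : ℝ)) = f * fun y ↦ inner ℝ (X y) (Y y) := by
      ext y; simp [real_inner_smul_left]
    simp only [koszul, e1, e2, h1, h2, VectorField.mlieBracket_smul_left hf hX]
    simp [inner_add_left, real_inner_smul_left, real_inner_smul_right]
    ring
  add {X X'} hX hX' := by
    have := FiniteDimensional.complete ℝ E
    have h1 := mvfderiv_add (mdifferentiableAt_inner hX hZ) (mdifferentiableAt_inner hX' hZ)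
    have h2 := mvfderiv_add (mdifferentiableAt_inner hX hY) (mdifferentiableAt_inner hX' hY)
    have e1 : (fun y ↦ (inner ℝ ((X + X') y) (Z y) : ℝ)) =
        (fun y ↦ inner ℝ (X y) (Z y)) + fun y ↦ inner ℝ (X' y) (Z y) := by
      ext y; simp [inner_add_left]
    have e2 : (fun y ↦ (inner ℝ ((X + X') y) (Y y) : ℝ)) =
        (fun y ↦ inner ℝ (X y) (Y y)) + fun y ↦ inner ℝ (X' y) (Y y) := by
      ext y; simp [inner_add_left]
    simp only [koszul, e1, e2, h1, h2, VectorField.mlieBracket_add_left hX hX']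
    simp [inner_add_left, inner_add_right]
    ring

theorem koszul_tensorial_right {X Y : Π x : M, TangentSpace I x} {x : M}
    (hX : MDiffAt (T% X) x) (hY : MDiffAt (T% Y) x) :
    TensorialAt I E (fun Z ↦ koszul X Y Z x) x where
  smul {f Z} hf hZ := by
    have := FiniteDimensional.complete ℝ E
    have h1 := mvfderiv_mul hf (mdifferentiableAt_inner hX hZ)
    have h2 := mvfderiv_mul hf (mdifferentiableAt_inner hY hZ)
    have e1 : (fun y ↦ (inner ℝ (X y) ((f • Z) y) : ℝ)) = f * fun y ↦ inner ℝ (X y) (Z y) := by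
      ext y; simp [real_inner_smul_right]
    have e2 : (fun y ↦ (inner ℝ (Y y) ((f • Z) y) : ℝ)) = f * fun y ↦ inner ℝ (Y y) (Z y) := by
      ext y; simp [real_inner_smul_right]
    simp only [koszul, e1, e2, h1, h2, VectorField.mlieBracket_smul_right hf hZ]
    simp [inner_add_left, real_inner_smul_left, real_inner_smul_right,
      real_inner_comm (X x) (Z x), real_inner_comm (Y x) (Z x)]
    ring
  add {Z Z'} hZ hZ' := by
    have := FiniteDimensional.complete ℝ E
    have h1 := mvfderiv_add (mdifferentiableAt_inner hX hZ) (mdifferentiableAt_inner hX hZ')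
    have h2 := mvfderiv_add (mdifferentiableAt_inner hY hZ) (mdifferentiableAt_inner hY hZ')
    have e1 : (fun y ↦ (inner ℝ (X y) ((Z + Z') y) : ℝ)) =
        (fun y ↦ inner ℝ (X y) (Z y)) + fun y ↦ inner ℝ (X y) (Z' y) := by
      ext y; simp [inner_add_right]
    have e2 : (fun y ↦ (inner ℝ (Y y) ((Z + Z') y) : ℝ)) =
        (fun y ↦ inner ℝ (Y y) (Z y)) + fun y ↦ inner ℝ (Y y) (Z' y) := by
      ext y; simp [inner_add_right]
    simp only [koszul, e1, e2, h1, h2, VectorField.mlieBracket_add_right hZ hZ']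
    simp [inner_add_left, inner_add_right]
    ring

/-- For a vector field `Y` differentiable at `x`, the bilinear form `(v, w) ↦ g(∇_v Y, w)` on the
tangent space at `x`. -/
def koszulForm (Y : Π x : M, TangentSpace I x) (x : M) (hY : MDiffAt (T% Y) x) :
    TangentSpace I x →L[ℝ] TangentSpace I x →L[ℝ] ℝ :=
  TensorialAt.mkHom₂ (fun X Z ↦ koszul X Y Z x) x
    (fun _ hZ ↦ koszul_tensorial_left hY hZ) (fun _ hX ↦ koszul_tensorial_right hX hY)

theorem koszulForm_apply {X Y Z : Π x : M, TangentSpace I x} {x : M}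
    (hX : MDiffAt (T% X) x) (hY : MDiffAt (T% Y) x) (hZ : MDiffAt (T% Z) x) :
    koszulForm Y x hY (X x) (Z x) = koszul X Y Z x :=
  TensorialAt.mkHom₂_apply _ _ hX hZ

open scoped Classical in
/-- The covariant derivative `v ↦ ∇_v Y` at `x`, obtained from the Koszul formula (with the
conventional value `0` if `Y` is not differentiable at `x`). -/
def nabla (Y : Π x : M, TangentSpace I x) (x : M) : TangentSpace I x →L[ℝ] TangentSpace I x :=
  if hY : MDiffAt (T% Y) x then
    ∑ i, ((koszulForm Y x hY).flip (orthoBasis I x i)).smulRight (orthoBasis I x i)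
  else 0

theorem inner_nabla {Y : Π x : M, TangentSpace I x} {x : M} (hY : MDiffAt (T% Y) x)
    (v w : TangentSpace I x) : inner ℝ (nabla Y x v) w = koszulForm Y x hY v w := by
  conv_rhs => rw [← (orthoBasis I x).sum_repr' w]
  simp only [nabla, hY, dite_true, sum_apply,
    ContinuousLinearMap.smulRight_apply, ContinuousLinearMap.flip_apply, sum_inner,
    real_inner_smul_left, map_sum, map_smul, smul_eq_mul]
  exact Finset.sum_congr rfl fun i _ ↦ mul_comm _ _

theorem inner_nabla_apply {X Y Z : Π x : M, TangentSpace I x} {x : M}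
    (hX : MDiffAt (T% X) x) (hY : MDiffAt (T% Y) x) (hZ : MDiffAt (T% Z) x) :
    inner ℝ (nabla Y x (X x)) (Z x) = koszul X Y Z x := by
  rw [inner_nabla hY, koszulForm_apply hX hY hZ]

variable (I M) in
/-- The Levi-Civita connection of the metric `g`. -/
def leviCivita : CovariantDerivative I E (TangentSpace I : M → Type _) where
  toFun := nabla
  isCovariantDerivativeOnUniv :=
    { add := by
        intro Y Y' x hY hY' _
        have := FiniteDimensional.complete ℝ E
        ext v
        refine ext_inner_right ℝ fun w ↦ ?_
        have hs : MDiffAt (T% (Y + Y')) x := mdifferentiableAt_add_section hY hY'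
        have hv := mdifferentiableAt_extend I E v
        have hw := mdifferentiableAt_extend I E w
        rw [← extend_apply_self E v, ← extend_apply_self E w]
        have h1 := mvfderiv_add (mdifferentiableAt_inner hY hw) (mdifferentiableAt_inner hY' hw)
        have h2 := mvfderiv_add (mdifferentiableAt_inner hv hY) (mdifferentiableAt_inner hv hY')
        have e1 : (fun y ↦ (inner ℝ ((Y + Y') y) (extend E w y) : ℝ)) =
            (fun y ↦ inner ℝ (Y y) (extend E w y)) + fun y ↦ inner ℝ (Y' y) (extend E w y) := by
          ext y; simp [inner_add_left]
        have e2 : (fun y ↦ (inner ℝ (extend E v y) ((Y + Y') y) : ℝ)) =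
            (fun y ↦ inner ℝ (extend E v y) (Y y)) + fun y ↦ inner ℝ (extend E v y) (Y' y) := by
          ext y; simp [inner_add_right]
        rw [add_apply, inner_add_left, inner_nabla_apply hv hs hw,
          inner_nabla_apply hv hY hw, inner_nabla_apply hv hY' hw]
        simp only [koszul, e1, e2, h1, h2, VectorField.mlieBracket_add_left hY hY',
          VectorField.mlieBracket_add_right hY hY']
        simp [inner_add_left, inner_add_right]
        ring
      leibniz := by
        intro Y f x hY hf _
        have := FiniteDimensional.complete ℝ E
        ext v
        refine ext_inner_right ℝ fun w ↦ ?_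
        have hs : MDiffAt (T% (f • Y)) x := hf.smul_section hY
        have hv := mdifferentiableAt_extend I E v
        have hw := mdifferentiableAt_extend I E w
        have hvx := extend_apply_self E v
        have hwx := extend_apply_self E w
        rw [← hvx, ← hwx]
        have h1 := mvfderiv_mul hf (mdifferentiableAt_inner hY hw)
        have h2 := mvfderiv_mul hf (mdifferentiableAt_inner hv hY)
        have e1 : (fun y ↦ (inner ℝ ((f • Y) y) (extend E w y) : ℝ)) =
            f * fun y ↦ inner ℝ (Y y) (extend E w y) := by
          ext y; simp [real_inner_smul_left]
        have e2 : (fun y ↦ (inner ℝ (extend E v y) ((f • Y) y) : ℝ)) =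
            f * fun y ↦ inner ℝ (extend E v y) (Y y) := by
          ext y; simp [real_inner_smul_right]
        rw [add_apply, inner_add_left, inner_nabla_apply hv hs hw,
          smul_apply, real_inner_smul_left, inner_nabla_apply hv hY hw]
        simp only [koszul, e1, e2, h1, h2, VectorField.mlieBracket_smul_left hf hY,
          VectorField.mlieBracket_smul_right hf hY]
        simp [inner_add_left, real_inner_smul_left, real_inner_smul_right,
          real_inner_comm (Y x) v]
        ring }

theorem leviCivita_torsion [CompleteSpace E] : (leviCivita I M).torsion = 0 := by
  rw [CovariantDerivative.torsion_eq_zero_iff]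
  intro X Y x hX hY
  refine ext_inner_right ℝ fun w ↦ ?_
  have hw := mdifferentiableAt_extend I E w
  rw [← extend_apply_self E w, inner_sub_left]
  change inner ℝ (nabla Y x (X x)) _ - inner ℝ (nabla X x (Y x)) _ = _
  rw [inner_nabla_apply hX hY hw, inner_nabla_apply hY hX hw]
  simp only [koszul, VectorField.mlieBracket_swap_apply (V := Y) (W := X), inner_neg_left,
    real_inner_comm]
  ring

theorem leviCivita_metric {X Y Z : Π x : M, TangentSpace I x} {x : M}
    (hX : MDiffAt (T% X) x) (hY : MDiffAt (T% Y) x) (hZ : MDiffAt (T% Z) x) :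
    mvfderiv I (fun y ↦ (inner ℝ (Y y) (Z y) : ℝ)) x (X x) =
      inner ℝ (leviCivita I M Y x (X x)) (Z x) + inner ℝ (Y x) (leviCivita I M Z x (X x)) := by
  change _ = inner ℝ (nabla Y x (X x)) (Z x) + inner ℝ (Y x) (nabla Z x (X x))
  rw [real_inner_comm (nabla Z x (X x)), inner_nabla_apply hX hY hZ, inner_nabla_apply hX hZ hY]
  simp only [koszul, VectorField.mlieBracket_swap_apply (V := Z) (W := Y), inner_neg_left,
    real_inner_comm]
  ring

end LeviCivita

section Operators

variable {E : Type*} [NormedAddCommGroup E] [NormedSpace ℝ E] [FiniteDimensional ℝ E]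
  {H : Type*} [TopologicalSpace H] {I : ModelWithCorners ℝ E H}
  {M : Type*} [TopologicalSpace M] [ChartedSpace H M] [IsManifold I ∞ M]
  [RiemannianBundle (fun x : M ↦ TangentSpace I x)]
  [IsContMDiffRiemannianBundle I ∞ E (fun x : M ↦ TangentSpace I x)]

/-- `(L_ξ g)(X, Y) = ξ (g(X, Y)) - g([ξ, X], Y) - g(X, [ξ, Y])`, at the point `x`. -/
def lieDerivMetricAux (ξ X Y : Π x : M, TangentSpace I x) (x : M) : ℝ :=
  mvfderiv I (fun y ↦ (inner ℝ (X y) (Y y) : ℝ)) x (ξ x)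
    - inner ℝ (VectorField.mlieBracket I ξ X x) (Y x)
    - inner ℝ (X x) (VectorField.mlieBracket I ξ Y x)

theorem lieDerivMetricAux_comm (ξ X Y : Π x : M, TangentSpace I x) (x : M) :
    lieDerivMetricAux ξ X Y x = lieDerivMetricAux ξ Y X x := by
  simp only [lieDerivMetricAux, real_inner_comm]
  ring

theorem lieDerivMetricAux_tensorial (ξ : Π x : M, TangentSpace I x)
    {Y : Π x : M, TangentSpace I x} {x : M} (hY : MDiffAt (T% Y) x) :
    TensorialAt I E (fun X ↦ lieDerivMetricAux ξ X Y x) x where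
  smul {f X} hf hX := by
    have := FiniteDimensional.complete ℝ E
    have h1 := mvfderiv_mul hf (mdifferentiableAt_inner hX hY)
    have e1 : (fun y ↦ (inner ℝ ((f • X) y) (Y y) : ℝ)) = f * fun y ↦ inner ℝ (X y) (Y y) := by
      ext y; simp [real_inner_smul_left]
    simp only [lieDerivMetricAux, e1, h1, VectorField.mlieBracket_smul_right hf hX]
    simp [inner_add_left, real_inner_smul_left]
    ring
  add {X X'} hX hX' := by
    have := FiniteDimensional.complete ℝ E
    have h1 := mvfderiv_add (mdifferentiableAt_inner hX hY) (mdifferentiableAt_inner hX' hY)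
    have e1 : (fun y ↦ (inner ℝ ((X + X') y) (Y y) : ℝ)) =
        (fun y ↦ inner ℝ (X y) (Y y)) + fun y ↦ inner ℝ (X' y) (Y y) := by
      ext y; simp [inner_add_left]
    simp only [lieDerivMetricAux, e1, h1, VectorField.mlieBracket_add_right hX hX']
    simp [inner_add_left]
    ring

/-- The Lie derivative `L_ξ g` of the metric `g` along the vector field `ξ`. -/
def lieDerivMetric (ξ : Π x : M, TangentSpace I x) (x : M) :
    TangentSpace I x →L[ℝ] TangentSpace I x →L[ℝ] ℝ :=
  TensorialAt.mkHom₂ (fun X Y ↦ lieDerivMetricAux ξ X Y x) x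
    (fun _ hY ↦ lieDerivMetricAux_tensorial ξ hY)
    (fun X hX ↦ by
      simp only [lieDerivMetricAux_comm ξ X]
      exact lieDerivMetricAux_tensorial ξ hX)

/-- The operator `δ^*` from one-forms to symmetric two-forms, `δ^* θ = (1/2) L_ξ g`,
`ξ = θ^♯`. -/
def deltaStar (θ : Π x : M, TangentSpace I x →L[ℝ] ℝ) (x : M) :
    TangentSpace I x →L[ℝ] TangentSpace I x →L[ℝ] ℝ :=
  (1 / 2 : ℝ) • lieDerivMetric (sharp θ) x

/-- The covariant derivative `(∇_v φ)(a, b)` of a two-form `φ` which is differentiable at `x`. The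
vectors `a` and `b` are extended to differentiable vector fields; the result does not depend on the
extensions. -/
def nablaForm (φ : Π x : M, TangentSpace I x →L[ℝ] TangentSpace I x →L[ℝ] ℝ) (x : M)
    (v a b : TangentSpace I x) : ℝ :=
  mvfderiv I (fun y ↦ φ y (extend E a y) (extend E b y)) x v
    - φ x (leviCivita I M (extend E a) x v) b
    - φ x a (leviCivita I M (extend E b) x v)

/-- The divergence operator `δ` on two-forms, `(δφ)(w) = -∑ᵢ (∇_{eᵢ} φ)(eᵢ, w)`. -/
def deltaTwo (φ : Π x : M, TangentSpace I x →L[ℝ] TangentSpace I x →L[ℝ] ℝ) (x : M)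
    (w : TangentSpace I x) : ℝ :=
  -∑ i, nablaForm φ x (orthoBasis I x i) (orthoBasis I x i) w

/-- The codifferential `δ` on one-forms, the formal adjoint of `d`:
`δθ = -div θ^♯ = -∑ᵢ g(∇_{eᵢ} θ^♯, eᵢ)`. -/
def deltaOne (θ : Π x : M, TangentSpace I x →L[ℝ] ℝ) (x : M) : ℝ :=
  -∑ i, inner ℝ (leviCivita I M (sharp θ) x (orthoBasis I x i)) (orthoBasis I x i)

/-- The Sampson Laplacian `Δ_S θ = 2 δ δ^* θ - d δ θ` on one-forms. -/
def sampsonLaplacian (θ : Π x : M, TangentSpace I x →L[ℝ] ℝ) (x : M)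
    (w : TangentSpace I x) : ℝ :=
  2 * deltaTwo (deltaStar θ) x w - mvfderiv I (deltaOne θ) x w

/-- The vector field `ξ = θ^♯` is an infinitesimal harmonic transformation of `(M, g)`:
`Δ_S θ = 0`. -/
def IsInfinitesimalHarmonicTransformation (θ : Π x : M, TangentSpace I x →L[ℝ] ℝ) : Prop :=
  ∀ (x : M) (w : TangentSpace I x), sampsonLaplacian θ x w = 0

variable (I) in
/-- `θ` is a smooth section of the cotangent bundle. -/
def IsSmoothOneForm (θ : Π x : M, TangentSpace I x →L[ℝ] ℝ) : Prop :=
  ContMDiff I (I.prod 𝓘(ℝ, E →L[ℝ] ℝ)) ∞ (fun x ↦ TotalSpace.mk' (E →L[ℝ] ℝ) x (θ x))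

variable (I) in
/-- `φ` is a smooth field of symmetric bilinear forms, i.e. a smooth section of `S²M`. -/
def IsSmoothSymmTwoForm (φ : Π x : M, TangentSpace I x →L[ℝ] TangentSpace I x →L[ℝ] ℝ) : Prop :=
  ContMDiff I (I.prod 𝓘(ℝ, E →L[ℝ] E →L[ℝ] ℝ)) ∞
    (fun x ↦ TotalSpace.mk' (E →L[ℝ] E →L[ℝ] ℝ) x (φ x)) ∧
  ∀ (x : M) (v w : TangentSpace I x), φ x v w = φ x w v

end Operators

section Energy

variable {n : ℕ} {M : Type*} [TopologicalSpace M] [ChartedSpace (EuclideanSpace ℝ (Fin n)) M]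
  [RiemannianBundle (fun x : M ↦ TangentSpace (𝓡 n) x)]

/-- The coordinate vector field `∂ᵢ` of the chart at `c`, at the point with coordinates `y`. -/
def coordVector (c : M) (y : EuclideanSpace ℝ (Fin n)) (i : Fin n) :
    TangentSpace (𝓡 n) ((chartAt (EuclideanSpace ℝ (Fin n)) c).symm y) :=
  mfderiv (𝓡 n) (𝓡 n) (chartAt (EuclideanSpace ℝ (Fin n)) c).symm y
    (EuclideanSpace.single i (1 : ℝ) : EuclideanSpace ℝ (Fin n))

/-- The density `√(det gᵢⱼ)` in the chart at `c`, as a function of the coordinates. -/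
def volumeDensity (c : M) (y : EuclideanSpace ℝ (Fin n)) : ℝ :=
  Real.sqrt (Matrix.det (Matrix.of fun i j : Fin n ↦
    (inner ℝ (coordVector c y i) (coordVector c y j) : ℝ)))

variable [MeasurableSpace M]

/-- The measure `√(det gᵢⱼ) dx¹ … dxⁿ` on the domain of the chart at `c`, extended by zero to
`M`. -/
def chartVolume (c : M) : Measure M :=
  ((volume.restrict (chartAt (EuclideanSpace ℝ (Fin n)) c).target).withDensity
    (fun y ↦ ENNReal.ofReal (volumeDensity c y))).map (chartAt (EuclideanSpace ℝ (Fin n)) c).symm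

variable (n M) in
/-- The Riemannian volume measure `dv_g`. The measures `√(det gᵢⱼ) dx¹ … dxⁿ` of two charts agree on
the intersection of their domains; `dv_g` is the measure which restricts to them, i.e. the least
measure above all of them. -/
def riemannianVolume : Measure M := ⨆ c : M, chartVolume (n := n) c

variable {m : ℕ} {N : Type*} [TopologicalSpace N] [ChartedSpace (EuclideanSpace ℝ (Fin m)) N]
  [RiemannianBundle (fun x : N ↦ TangentSpace (𝓡 m) x)]

variable (n m) in
/-- The pullback metric `f^* ḡ`. -/
def pullbackMetric (f : M → N) (x : M) :
    TangentSpace (𝓡 n) x →L[ℝ] TangentSpace (𝓡 n) x →L[ℝ] ℝ :=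
  (innerSL ℝ (E := TangentSpace (𝓡 m) (f x))).bilinearComp
    (mfderiv (𝓡 n) (𝓡 m) f x) (mfderiv (𝓡 n) (𝓡 m) f x)

variable (n m) in
/-- The energy density `e(f) = trace_g (f^* ḡ)`. -/
def energyDensity (f : M → N) (x : M) : ℝ :=
  metricTrace (I := 𝓡 n) (pullbackMetric n m f x)

variable (n m) in
/-- The energy `E_U(f) = (1/2) ∫_U e(f) dv_g` of `f` on `U`. -/
def energyOn (U : Set M) (f : M → N) : ℝ :=
  (1 / 2) * ∫ x in U, energyDensity n m f x ∂(riemannianVolume n M)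

variable (n m) in
/-- The energy `E(f) = (1/2) ∫_M e(f) dv_g`. -/
def energy (f : M → N) : ℝ :=
  (1 / 2) * ∫ x, energyDensity n m f x ∂(riemannianVolume n M)

variable (n m) in
/-- A smooth map `f` is harmonic if it is a critical point of the energy `E_U`, for every relatively
compact open subset `U` of `M`, with respect to all smooth variations `F t` of `f = F 0` with
compact support in `U`. -/
def IsHarmonicMap (f : M → N) : Prop :=
  ContMDiff (𝓡 n) (𝓡 m) ∞ f ∧
  ∀ U : Set M, IsOpen U → IsCompact (closure U) →
    ∀ F : ℝ → M → N,
      ContMDiff (𝓘(ℝ, ℝ).prod (𝓡 n)) (𝓡 m) ∞ (fun p : ℝ × M ↦ F p.1 p.2) →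
      F 0 = f →
      (∃ K : Set M, IsCompact K ∧ K ⊆ U ∧ ∀ t : ℝ, ∀ x ∉ K, F t x = f x) →
      HasDerivAt (fun t ↦ energyOn n m U (F t)) 0 0

end Energy

end RiemannianGeometry

end

/-
Deform a harmonic map `f` by precomposing it with `y ↦ y + s • X y`, where `X` has compact support
in a chart. Criticality of the energy under these domain variations is a weak equation for the
components of `f^*ḡ`, and integrating by parts turns it into the conservation law of the
stress-energy tensor, `δ(f^*ḡ) = -½ d e(f)`. Since `δφ₀ = 0`, also `δ(f^*ḡ) = δδ^*θ`, and
`Δ_S θ = 0` says that `δδ^*θ = ½ dδθ`. Hence `e(f) + δθ` has zero differential, so it is a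
constant `C`. Integrating over `M` and using the divergence theorem gives `2 E(f) = C Vol(M, g)`,
and `C ≥ 0` because `E(f) ≥ 0`.
-/

noncomputable section

namespace RiemannianGeometry

section GramMatrix

variable {ι E : Type*} [NormedAddCommGroup E] [NormedSpace ℝ E]

/-- The Gram matrix of a family of vectors with respect to a bilinear form. -/
def gramMatrix (b : ι → E) (G : E →L[ℝ] E →L[ℝ] ℝ) : Matrix ι ι ℝ :=
  Matrix.of fun i j ↦ G (b i) (b j)

/-- `G` is an inner product: symmetric and positive definite. Inner products depending on a point
of a vector space are the local expressions of Riemannian metrics. -/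
structure IsInnerForm (G : E →L[ℝ] E →L[ℝ] ℝ) : Prop where
  symm : ∀ v w, G v w = G w v
  pos : ∀ v, v ≠ 0 → 0 < G v v

variable {G : E →L[ℝ] E →L[ℝ] ℝ} {b : ι → E}

theorem IsInnerForm.gramMatrix_isSymm (hG : IsInnerForm G) (b : ι → E) :
    (gramMatrix b G).IsSymm :=
  Matrix.ext fun i j ↦ hG.symm (b j) (b i)

variable [Fintype ι]

theorem dotProduct_gramMatrix_mulVec (b : ι → E) (G : E →L[ℝ] E →L[ℝ] ℝ) (x : ι → ℝ) :
    x ⬝ᵥ (gramMatrix b G).mulVec x = G (∑ i, x i • b i) (∑ i, x i • b i) := by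
  simp only [dotProduct, Matrix.mulVec, gramMatrix, Matrix.of_apply, map_sum, map_smul, sum_apply,
    smul_apply, smul_eq_mul, Finset.mul_sum]
  rw [Finset.sum_comm]
  exact Finset.sum_congr rfl fun i _ ↦ Finset.sum_congr rfl fun j _ ↦ by ring

variable [DecidableEq ι]

/-- The trace `∑ G^{ij} H(bᵢ, bⱼ)` of `H` relative to the inner product `G`, in the basis `b`. -/
def relTrace (b : ι → E) (G H : E →L[ℝ] E →L[ℝ] ℝ) : ℝ :=
  ∑ i, ∑ j, (gramMatrix b G)⁻¹ i j * H (b i) (b j)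

/-- The density `√(det G(bᵢ, bⱼ))` of the volume of the inner product `G` in the basis `b`. -/
def relDensity (b : ι → E) (G : E →L[ℝ] E →L[ℝ] ℝ) : ℝ :=
  √(gramMatrix b G).det

theorem IsInnerForm.det_pos (hG : IsInnerForm G) (hb : LinearIndependent ℝ b) :
    0 < (gramMatrix b G).det := by
  refine (Matrix.PosDef.of_dotProduct_mulVec_pos ?_ fun x hx ↦ ?_).det_pos
  · rw [Matrix.IsHermitian, Matrix.conjTranspose_eq_transpose_of_trivial]
    exact hG.gramMatrix_isSymm b
  · rw [star_trivial, dotProduct_gramMatrix_mulVec]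
    exact hG.pos _ fun h ↦ hx (funext fun i ↦ Fintype.linearIndependent_iff.1 hb x h i)

theorem IsInnerForm.relDensity_pos (hG : IsInnerForm G) (hb : LinearIndependent ℝ b) :
    0 < relDensity b G :=
  Real.sqrt_pos.2 (hG.det_pos hb)

theorem IsInnerForm.inv_symm (hG : IsInnerForm G) (b : ι → E) (i j : ι) :
    (gramMatrix b G)⁻¹ i j = (gramMatrix b G)⁻¹ j i := by
  rw [← Matrix.transpose_apply (gramMatrix b G)⁻¹, Matrix.transpose_nonsing_inv,
    hG.gramMatrix_isSymm b]

theorem sum_gramMatrix_inv_mul (h : (gramMatrix b G).det ≠ 0) (i j : ι) :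
    ∑ k, (gramMatrix b G)⁻¹ i k * G (b k) (b j) = (1 : Matrix ι ι ℝ) i j := by
  rw [← Matrix.nonsing_inv_mul _ h.isUnit, Matrix.mul_apply]
  rfl

theorem gramMatrix_linear (b : Module.Basis ι ℝ E) (L : E →ₗ[ℝ] E) (G : E →L[ℝ] E →L[ℝ] ℝ) :
    gramMatrix (fun i ↦ L (b i)) G =
      (LinearMap.toMatrix b b L).transpose * gramMatrix b G * LinearMap.toMatrix b b L := by
  ext i j
  have hL : ∀ i, L (b i) = ∑ k, LinearMap.toMatrix b b L k i • b k := fun i ↦ by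
    simp [LinearMap.toMatrix_apply, b.sum_repr]
  simp only [gramMatrix, Matrix.of_apply, hL i, hL j, Matrix.mul_apply, Matrix.transpose_apply,
    map_sum, map_smul, sum_apply, smul_apply, smul_eq_mul, Finset.sum_mul, Finset.mul_sum]
  exact Finset.sum_congr rfl fun k _ ↦ Finset.sum_congr rfl fun l _ ↦ by ring

theorem relDensity_linear (b : Module.Basis ι ℝ E) (L : E →ₗ[ℝ] E) (G : E →L[ℝ] E →L[ℝ] ℝ) :
    relDensity (fun i ↦ L (b i)) G = |LinearMap.det L| * relDensity b G := by
  rw [relDensity, gramMatrix_linear, Matrix.det_mul, Matrix.det_mul, Matrix.det_transpose,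
    LinearMap.det_toMatrix, mul_right_comm, ← sq, Real.sqrt_mul (sq_nonneg _), Real.sqrt_sq_eq_abs,
    relDensity]

theorem relDensity_bilinearComp (b : Module.Basis ι ℝ E) (L : E →L[ℝ] E)
    (G : E →L[ℝ] E →L[ℝ] ℝ) :
    relDensity b (G.bilinearComp L L) = |L.det| * relDensity b G :=
  relDensity_linear b L G

theorem exists_relDensity_eq_mul (b b' : Module.Basis ι ℝ E) :
    ∃ κ : ℝ, 0 < κ ∧ ∀ G : E →L[ℝ] E →L[ℝ] ℝ, relDensity b' G = κ * relDensity b G := by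
  refine ⟨|LinearMap.det (b.equiv b' (Equiv.refl ι) : E →ₗ[ℝ] E)|,
    abs_pos.2 (LinearEquiv.isUnit_det' _).ne_zero, fun G ↦ ?_⟩
  rw [← relDensity_linear]
  simp

theorem IsInnerForm.repr_eq_sum_inv (hG : IsInnerForm G) (b : Module.Basis ι ℝ E) (v : E)
    (i : ι) : b.repr v i = ∑ j, (gramMatrix b G)⁻¹ i j * G v (b j) := by
  have hv : ∀ j, G v (b j) = ∑ k, G (b j) (b k) * b.repr v k := fun j ↦ by
    conv_lhs => rw [hG.symm, ← b.sum_repr v]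
    simp only [map_sum, map_smul, smul_eq_mul, mul_comm]
  simp only [hv, Finset.mul_sum, ← mul_assoc]
  rw [Finset.sum_comm]
  simp only [← Finset.sum_mul, sum_gramMatrix_inv_mul (hG.det_pos b.linearIndependent).ne',
    Matrix.one_apply, ite_mul, one_mul, zero_mul, Finset.sum_ite_eq, Finset.mem_univ, if_true]

theorem IsInnerForm.eq_sum_inv (hG : IsInnerForm G) (b : Module.Basis ι ℝ E) (v : E) :
    v = ∑ i, (∑ j, (gramMatrix b G)⁻¹ i j * G v (b j)) • b i := by
  simp only [← hG.repr_eq_sum_inv b v, b.sum_repr]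

theorem IsInnerForm.sum_inv_mul_apply_apply (hG : IsInnerForm G) (b : Module.Basis ι ℝ E)
    (A : E →L[ℝ] E) :
    ∑ i, ∑ j, (gramMatrix b G)⁻¹ i j * G (A (b i)) (b j) = ∑ i, b.repr (A (b i)) i := by
  simp only [← hG.repr_eq_sum_inv b]

theorem sum_orthonormal_eq_relTrace {F : Type*} [NormedAddCommGroup F] [InnerProductSpace ℝ F]
    {κ : Type*} [Fintype κ] (e : OrthonormalBasis κ ℝ F) (b : Module.Basis ι ℝ E)
    (T : E ≃L[ℝ] F) (hG : ∀ v w, G v w = inner ℝ (T v) (T w)) (B : F →L[ℝ] F →L[ℝ] ℝ) :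
    ∑ k, B (e k) (e k) =
      relTrace b G (B.bilinearComp (T : E →L[ℝ] F) (T : E →L[ℝ] F)) := by
  have hGi : IsInnerForm G :=
    ⟨fun v w ↦ by rw [hG, hG, real_inner_comm], fun v hv ↦ by
      rw [hG]; exact real_inner_self_pos.2 (by simpa using hv)⟩
  have hexpand : ∀ u : F,
      u = ∑ i, (∑ j, (gramMatrix b G)⁻¹ i j * inner ℝ u (T (b j))) • T (b i) := fun u ↦ by
    simpa only [map_sum, map_smul, hG, T.apply_symm_apply] using
      congrArg T (hGi.eq_sum_inv b (T.symm u))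
  calc ∑ k, B (e k) (e k)
      = ∑ k, ∑ i, ∑ j, (gramMatrix b G)⁻¹ i j *
          (inner ℝ (e k) (T (b j)) * B (T (b i)) (e k)) := by
        refine Finset.sum_congr rfl fun k _ ↦ ?_
        conv_lhs => enter [1]; rw [hexpand (e k)]
        simp only [map_sum, map_smul, sum_apply, smul_apply, smul_eq_mul, Finset.sum_mul,
          mul_assoc]
    _ = ∑ i, ∑ j, (gramMatrix b G)⁻¹ i j *
          B (T (b i)) (∑ k, inner ℝ (e k) (T (b j)) • e k) := by
        rw [Finset.sum_comm]
        refine Finset.sum_congr rfl fun i _ ↦ ?_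
        rw [Finset.sum_comm]
        simp only [map_sum, map_smul, smul_eq_mul, Finset.mul_sum]
    _ = relTrace b G (B.bilinearComp (T : E →L[ℝ] F) (T : E →L[ℝ] F)) := by
        simp only [e.sum_repr', relTrace, ContinuousLinearMap.bilinearComp_apply,
          ContinuousLinearEquiv.coe_coe]

end GramMatrix

section GramCalculus

variable {ι : Type*} [Fintype ι] [DecidableEq ι]

/-- The determinant as a continuous multilinear map in the rows of a matrix, so that its derivative
is available. -/
def detRowMultilinear (ι : Type*) [Fintype ι] [DecidableEq ι] :
    ContinuousMultilinearMap ℝ (fun _ : ι ↦ ι → ℝ) ℝ where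
  toMultilinearMap := (Matrix.detRowAlternating : (ι → ℝ) [⋀^ι]→ₗ[ℝ] ℝ).toMultilinearMap
  cont := by
    change Continuous fun A : Matrix ι ι ℝ ↦ A.det
    fun_prop

theorem detRowMultilinear_linearDeriv (A B : ι → ι → ℝ) :
    (detRowMultilinear ι).linearDeriv A B =
      ∑ i, ∑ j, Matrix.adjugate (Matrix.of A) j i * B i j := by
  rw [ContinuousMultilinearMap.linearDeriv_apply]
  refine Finset.sum_congr rfl fun i _ ↦ ?_
  have hrow : detRowMultilinear ι (Function.update A i (B i)) =
      ((Matrix.of A).updateRow i (B i)).det := rfl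
  rw [hrow, ← Matrix.cramer_transpose_apply, Matrix.cramer_eq_adjugate_mulVec,
    ← Matrix.adjugate_transpose]
  simp [Matrix.mulVec, dotProduct]

theorem contDiff_det {k : WithTop ℕ∞} : ContDiff ℝ k fun A : ι → ι → ℝ ↦ (Matrix.of A).det :=
  (detRowMultilinear ι).contDiff

theorem contDiffAt_inv_entry {k : WithTop ℕ∞} {A : ι → ι → ℝ} (hA : (Matrix.of A).det ≠ 0)
    (i j : ι) : ContDiffAt ℝ k (fun A : ι → ι → ℝ ↦ (Matrix.of A)⁻¹ i j) A := by
  have hcramer : (fun A : ι → ι → ℝ ↦ (Matrix.of A)⁻¹ i j) = fun A ↦ ((Matrix.of A).det)⁻¹ *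
      (Matrix.of (Function.update A j (Pi.single i 1))).det := by
    ext A
    rw [Matrix.inv_def, Matrix.smul_apply, Ring.inverse_eq_inv', smul_eq_mul, Matrix.adjugate_apply]
    rfl
  rw [hcramer]
  refine (contDiff_det.contDiffAt.inv hA).mul
    (contDiff_det.contDiffAt.comp A (contDiffAt_pi.2 fun l ↦ ?_))
  by_cases hl : l = j
  · simpa only [hl, Function.update_self] using contDiffAt_const
  · simp only [Function.update_of_ne hl]
    exact (contDiff_apply ℝ (ι → ℝ) l).contDiffAt

variable {E : Type*} [NormedAddCommGroup E] [NormedSpace ℝ E]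
  {F : Type*} [NormedAddCommGroup F] [NormedSpace ℝ F]

section Smoothness

variable {k : WithTop ℕ∞} {s : Set F} {G H : F → E →L[ℝ] E →L[ℝ] ℝ} {b : ι → E}

omit [DecidableEq ι] in
theorem contDiffOn_gram (hG : ContDiffOn ℝ k G s) (b : ι → E) :
    ContDiffOn ℝ k (fun y i j ↦ G y (b i) (b j)) s :=
  contDiffOn_pi.2 fun _ ↦ contDiffOn_pi.2 fun _ ↦
    (hG.clm_apply contDiffOn_const).clm_apply contDiffOn_const

theorem contDiffOn_gramMatrix_inv (hG : ContDiffOn ℝ k G s)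
    (hdet : ∀ y ∈ s, (gramMatrix b (G y)).det ≠ 0) (i j : ι) :
    ContDiffOn ℝ k (fun y ↦ (gramMatrix b (G y))⁻¹ i j) s := fun y hy ↦
  ContDiffAt.comp_contDiffWithinAt (g := fun A : ι → ι → ℝ ↦ (Matrix.of A)⁻¹ i j) y
    (contDiffAt_inv_entry (A := fun i j ↦ G y (b i) (b j)) (hdet y hy) i j)
    (contDiffOn_gram hG b y hy)

theorem contDiffOn_relTrace (hG : ContDiffOn ℝ k G s)
    (hdet : ∀ y ∈ s, (gramMatrix b (G y)).det ≠ 0) (hH : ContDiffOn ℝ k H s) :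
    ContDiffOn ℝ k (fun y ↦ relTrace b (G y) (H y)) s :=
  ContDiffOn.sum fun i _ ↦ ContDiffOn.sum fun j _ ↦
    (contDiffOn_gramMatrix_inv hG hdet i j).mul
      ((hH.clm_apply contDiffOn_const).clm_apply contDiffOn_const)

theorem contDiffOn_relDensity (hG : ContDiffOn ℝ k G s)
    (hdet : ∀ y ∈ s, (gramMatrix b (G y)).det ≠ 0) :
    ContDiffOn ℝ k (fun y ↦ relDensity b (G y)) s :=
  ContDiffOn.sqrt (contDiff_det.comp_contDiffOn (contDiffOn_gram hG b)) hdet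

end Smoothness

variable {G : F → E →L[ℝ] E →L[ℝ] ℝ} {y : F} {b : ι → E}

theorem differentiableAt_clm_apply₂ (hG : DifferentiableAt ℝ G y) (a a' : E) :
    DifferentiableAt ℝ (fun z ↦ G z a a') y :=
  (hG.clm_apply (differentiableAt_const a)).clm_apply (differentiableAt_const a')

theorem fderiv_clm_apply₂ (hG : DifferentiableAt ℝ G y) (v : F) (a a' : E) :
    fderiv ℝ (fun z ↦ G z a a') y v = fderiv ℝ G y v a a' := by
  rw [fderiv_clm_apply (hG.clm_apply (differentiableAt_const a)) (differentiableAt_const a'),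
    fderiv_clm_apply hG (differentiableAt_const a)]
  simp

omit [Fintype ι] [DecidableEq ι] in
theorem hasFDerivAt_gram [Finite ι] (hG : DifferentiableAt ℝ G y) (b : ι → E) :
    HasFDerivAt (fun z i j ↦ G z (b i) (b j))
      (ContinuousLinearMap.pi fun i ↦ ContinuousLinearMap.pi fun j ↦
        fderiv ℝ (fun z ↦ G z (b i) (b j)) y) y := by
  cases nonempty_fintype ι
  exact hasFDerivAt_pi.2 fun i ↦ hasFDerivAt_pi.2 fun j ↦
    (differentiableAt_clm_apply₂ hG (b i) (b j)).hasFDerivAt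

theorem hasFDerivAt_det_gramMatrix (hG : DifferentiableAt ℝ G y) (b : ι → E) :
    HasFDerivAt (fun z ↦ (gramMatrix b (G z)).det)
      (((detRowMultilinear ι).linearDeriv fun i j ↦ G y (b i) (b j)).comp
        (ContinuousLinearMap.pi fun i ↦ ContinuousLinearMap.pi fun j ↦
          fderiv ℝ (fun z ↦ G z (b i) (b j)) y)) y :=
  ((detRowMultilinear ι).hasFDerivAt fun i j ↦ G y (b i) (b j)).comp y (hasFDerivAt_gram hG b)

-- Jacobi's formula: the adjugate of the Gram matrix is its determinant times its inverse.
theorem fderiv_det_gramMatrix (hG : DifferentiableAt ℝ G y) (hGi : IsInnerForm (G y))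
    (hb : LinearIndependent ℝ b) (v : F) :
    fderiv ℝ (fun z ↦ (gramMatrix b (G z)).det) y v =
      (gramMatrix b (G y)).det * relTrace b (G y) (fderiv ℝ G y v) := by
  have hadj : ∀ i j, (gramMatrix b (G y)).adjugate j i =
      (gramMatrix b (G y)).det * (gramMatrix b (G y))⁻¹ i j := fun i j ↦ by
    rw [hGi.inv_symm, Matrix.inv_def, Matrix.smul_apply, Ring.inverse_eq_inv', smul_eq_mul,
      mul_inv_cancel_left₀ (hGi.det_pos hb).ne']
  have hof : (Matrix.of fun i j ↦ G y (b i) (b j)) = gramMatrix b (G y) := rfl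
  rw [(hasFDerivAt_det_gramMatrix hG b).fderiv, ContinuousLinearMap.comp_apply,
    detRowMultilinear_linearDeriv]
  simp only [hof, hadj, ContinuousLinearMap.pi_apply, fderiv_clm_apply₂ hG, relTrace,
    Finset.mul_sum, mul_assoc]

theorem fderiv_relDensity (hG : DifferentiableAt ℝ G y) (hGi : IsInnerForm (G y))
    (hb : LinearIndependent ℝ b) (v : F) :
    fderiv ℝ (fun z ↦ relDensity b (G z)) y v =
      1 / 2 * relDensity b (G y) * relTrace b (G y) (fderiv ℝ G y v) := by
  have hpos := hGi.det_pos hb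
  have hsqrt : √(gramMatrix b (G y)).det ≠ 0 := (Real.sqrt_pos.2 hpos).ne'
  simp only [relDensity]
  rw [fderiv_sqrt (hasFDerivAt_det_gramMatrix hG b).differentiableAt hpos.ne', smul_apply,
    fderiv_det_gramMatrix hG hGi hb, smul_eq_mul]
  field_simp
  rw [Real.sq_sqrt hpos.le]

theorem differentiableAt_gramMatrix_inv (hG : DifferentiableAt ℝ G y)
    (hdet : (gramMatrix b (G y)).det ≠ 0) (i j : ι) :
    DifferentiableAt ℝ (fun z ↦ (gramMatrix b (G z))⁻¹ i j) y :=
  DifferentiableAt.comp (g := fun A : ι → ι → ℝ ↦ (Matrix.of A)⁻¹ i j) y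
    ((contDiffAt_inv_entry (k := 1) (A := fun i j ↦ G y (b i) (b j)) hdet i j).differentiableAt
      one_ne_zero) (hasFDerivAt_gram hG b).differentiableAt

-- Differentiate `∑ₖ G^{ik} G(bₖ, bⱼ) = δᵢⱼ`.
theorem fderiv_gramMatrix_inv (hG : DifferentiableAt ℝ G y) (hone : gramMatrix b (G y) = 1)
    (v : F) (i j : ι) :
    fderiv ℝ (fun z ↦ (gramMatrix b (G z))⁻¹ i j) y v = -fderiv ℝ G y v (b i) (b j) := by
  have hdet : (gramMatrix b (G y)).det ≠ 0 := by simp [hone]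
  have hprod : (fun z ↦ ∑ k, (gramMatrix b (G z))⁻¹ i k * G z (b k) (b j)) =ᶠ[𝓝 y]
      fun _ ↦ (1 : Matrix ι ι ℝ) i j := by
    filter_upwards [(hasFDerivAt_det_gramMatrix hG b).continuousAt.eventually_ne hdet] with z hz
      using sum_gramMatrix_inv_mul hz i j
  have hzero : fderiv ℝ (fun z ↦ ∑ k, (gramMatrix b (G z))⁻¹ i k * G z (b k) (b j)) y v = 0 := by
    rw [hprod.fderiv_eq, fderiv_fun_const, Pi.zero_apply, zero_apply]
  have hterm : ∀ k, fderiv ℝ (fun z ↦ (gramMatrix b (G z))⁻¹ i k * G z (b k) (b j)) y v =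
      (1 : Matrix ι ι ℝ) i k * fderiv ℝ G y v (b k) (b j) +
      fderiv ℝ (fun z ↦ (gramMatrix b (G z))⁻¹ i k) y v * (1 : Matrix ι ι ℝ) k j := fun k ↦ by
    have hkj : G y (b k) (b j) = (1 : Matrix ι ι ℝ) k j := congrFun (congrFun hone k) j
    rw [fderiv_fun_mul (differentiableAt_gramMatrix_inv hG hdet i k)
      (differentiableAt_clm_apply₂ hG _ _)]
    simp only [hone, inv_one, hkj, add_apply, smul_apply, smul_eq_mul, fderiv_clm_apply₂ hG]
    ring
  rw [fderiv_fun_sum fun k _ ↦ (differentiableAt_gramMatrix_inv hG hdet i k).fun_mul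
    (differentiableAt_clm_apply₂ hG _ _), sum_apply, Finset.sum_congr rfl fun k _ ↦ hterm k,
    Finset.sum_add_distrib] at hzero
  simp only [Matrix.one_apply, ite_mul, mul_ite, one_mul, mul_one, zero_mul, mul_zero,
    Finset.sum_ite_eq, Finset.sum_ite_eq', Finset.mem_univ, if_true] at hzero
  linarith

theorem fderiv_relTrace (hG : DifferentiableAt ℝ G y) {H : F → E →L[ℝ] E →L[ℝ] ℝ}
    (hH : DifferentiableAt ℝ H y) (hone : gramMatrix b (G y) = 1) (v : F) :
    fderiv ℝ (fun z ↦ relTrace b (G z) (H z)) y v =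
      ∑ i, fderiv ℝ H y v (b i) (b i)
      - ∑ i, ∑ j, fderiv ℝ G y v (b i) (b j) * H y (b i) (b j) := by
  have hdet : (gramMatrix b (G y)).det ≠ 0 := by simp [hone]
  have hsum := HasFDerivAt.fun_sum fun i (_ : i ∈ Finset.univ) ↦
    HasFDerivAt.fun_sum fun j (_ : j ∈ Finset.univ) ↦
      (differentiableAt_gramMatrix_inv hG hdet i j).hasFDerivAt.fun_mul
        (differentiableAt_clm_apply₂ hH (b i) (b j)).hasFDerivAt
  simp only [relTrace]
  rw [hsum.fderiv]
  simp only [sum_apply, add_apply, smul_apply, smul_eq_mul, Finset.sum_add_distrib,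
    fderiv_clm_apply₂ hH, fderiv_gramMatrix_inv hG hone, hone, inv_one, Matrix.one_apply,
    ite_mul, one_mul, zero_mul, Finset.sum_ite_eq, Finset.mem_univ, if_true, neg_mul,
    Finset.sum_neg_distrib, ← sub_eq_add_neg, mul_comm (H y _ _)]

end GramCalculus

section Christoffel

variable {E ι : Type*} [NormedAddCommGroup E] [NormedSpace ℝ E]

/-- The Christoffel symbols of the first kind on constant vector fields, for a metric whose
derivative is `D`: the value of `⟨∇ᵥ a, w⟩`. -/
def christoffel (D : E →L[ℝ] E →L[ℝ] E →L[ℝ] ℝ) (v a w : E) : ℝ :=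
  1 / 2 * (D v a w + D a v w - D w v a)

variable [Fintype ι]

theorem sum_christoffel_self (D : E →L[ℝ] E →L[ℝ] E →L[ℝ] ℝ) (b : ι → E) (h : ι → ℝ) :
    ∑ i, ∑ k, christoffel D (b i) (b i) (b k) * h k =
      ∑ i, ∑ k, D (b i) (b i) (b k) * h k - 1 / 2 * ∑ i, ∑ k, D (b i) (b k) (b k) * h i := by
  rw [Finset.sum_comm (f := fun i k ↦ D (b i) (b k) (b k) * h i)]
  simp only [christoffel, Finset.mul_sum, ← Finset.sum_sub_distrib]
  refine Finset.sum_congr rfl fun i _ ↦ Finset.sum_congr rfl fun k _ ↦ ?_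
  ring

theorem sum_christoffel_mul_symm {D : E →L[ℝ] E →L[ℝ] E →L[ℝ] ℝ}
    (hD : ∀ v a a', D v a a' = D v a' a) (b : ι → E) (w : E) {h : ι → ι → ℝ}
    (hh : ∀ i k, h i k = h k i) :
    ∑ i, ∑ k, christoffel D (b i) w (b k) * h i k =
      1 / 2 * ∑ i, ∑ k, D w (b i) (b k) * h i k := by
  have hswap : ∑ i, ∑ k, D (b k) (b i) w * h i k = ∑ i, ∑ k, D (b i) w (b k) * h i k := by
    rw [Finset.sum_comm]
    refine Finset.sum_congr rfl fun i _ ↦ Finset.sum_congr rfl fun k _ ↦ ?_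
    rw [hh k i, hD (b i) (b k) w]
  have hexpand : ∑ i, ∑ k, christoffel D (b i) w (b k) * h i k =
      1 / 2 * (∑ i, ∑ k, D (b i) w (b k) * h i k + ∑ i, ∑ k, D w (b i) (b k) * h i k
        - ∑ i, ∑ k, D (b k) (b i) w * h i k) := by
    simp only [christoffel, ← Finset.sum_sub_distrib, ← Finset.sum_add_distrib, Finset.mul_sum]
    refine Finset.sum_congr rfl fun i _ ↦ Finset.sum_congr rfl fun k _ ↦ ?_
    ring
  rw [hexpand, hswap]
  ring

end Christoffel

section CompactSupport

section Topology

variable {E : Type*} [TopologicalSpace E] {V K : Set E} {u w k : E → ℝ}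

theorem continuous_mul_of_tsupport_subset (hV : IsOpen V) (hu : Continuous u)
    (hs : tsupport u ⊆ V) (hk : ContinuousOn k V) : Continuous fun x ↦ u x * k x :=
  (hu.continuousOn.mul hk).continuous_of_tsupport_subset hV
    ((tsupport_mul_subset_left (f := u) (g := k)).trans hs)

theorem tsupport_indicator_subset (hK : IsClosed K) (hw : ∀ x ∈ V, x ∉ K → w x = 0) :
    tsupport (V.indicator w) ⊆ K := by
  refine closure_minimal (Function.support_subset_iff'.2 fun x hxK ↦ ?_) hK
  by_cases hxV : x ∈ V
  · rw [indicator_of_mem hxV, hw x hxV hxK]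
  · exact indicator_of_notMem hxV _

end Topology

variable {E : Type*} [NormedAddCommGroup E] [NormedSpace ℝ E] {V K : Set E} {u w k : E → ℝ}

theorem contDiff_indicator {r : WithTop ℕ∞} (hV : IsOpen V) (hw : ContDiffOn ℝ r w V)
    (hs : tsupport (V.indicator w) ⊆ V) : ContDiff ℝ r (V.indicator w) := by
  refine contDiff_iff_contDiffAt.2 fun x ↦ ?_
  by_cases hx : x ∈ V
  · exact (hw.contDiffAt (hV.mem_nhds hx)).congr_of_eventuallyEq
      ((eqOn_indicator (s := V) (f := w)).eventuallyEq_of_mem (hV.mem_nhds hx))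
  · exact contDiffAt_const.congr_of_eventuallyEq
      (notMem_tsupport_iff_eventuallyEq.1 fun h ↦ hx (hs h))

section Measurable

variable [MeasurableSpace E] [BorelSpace E] {μ : Measure E}

omit [NormedSpace ℝ E] in
theorem integrable_mul_of_tsupport_subset [IsFiniteMeasureOnCompacts μ] (hV : IsOpen V)
    (hu : Continuous u) (hc : HasCompactSupport u) (hs : tsupport u ⊆ V)
    (hk : ContinuousOn k V) : Integrable (fun x ↦ u x * k x) μ :=
  (continuous_mul_of_tsupport_subset hV hu hs hk).integrable_of_hasCompactSupport
    (hc.mul_right (f' := k))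

variable [FiniteDimensional ℝ E] [μ.IsAddHaarMeasure]

theorem integral_mul_fderiv_of_tsupport_subset (hV : IsOpen V) (hu : ContDiff ℝ 1 u)
    (hc : HasCompactSupport u) (hs : tsupport u ⊆ V) (hw : ContDiffOn ℝ 1 w V) (a : E) :
    ∫ x, u x * fderiv ℝ w x a ∂μ = -∫ x, fderiv ℝ u x a * w x ∂μ := by
  have hu' : Continuous fun x ↦ fderiv ℝ u x a :=
    (hu.continuous_fderiv one_ne_zero).clm_apply continuous_const
  have hw' : ContinuousOn (fun x ↦ fderiv ℝ w x a) V :=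
    (hw.continuousOn_fderiv_of_isOpen hV le_rfl).clm_apply continuousOn_const
  exact integral_mul_fderiv_eq_neg_fderiv_mul_of_integrable
    (integrable_mul_of_tsupport_subset hV hu' (hc.fderiv_apply ℝ a)
      ((tsupport_fderiv_apply_subset ℝ a).trans hs) hw.continuousOn)
    (integrable_mul_of_tsupport_subset hV hu.continuous hc hs hw')
    (integrable_mul_of_tsupport_subset hV hu.continuous hc hs hw.continuousOn)
    (fun x _ ↦ hu.differentiable one_ne_zero x)
    (fun x hx ↦ (hw.contDiffAt (hV.mem_nhds (hs hx))).differentiableAt one_ne_zero)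

theorem integral_fderiv_eq_zero (hw : ContDiff ℝ 1 w) (hc : HasCompactSupport w) (a : E) :
    ∫ x, fderiv ℝ w x a ∂μ = 0 := by
  simpa using (integral_mul_fderiv_of_tsupport_subset (μ := μ) isOpen_univ hw hc (subset_univ _)
    (contDiffOn_const (c := (1 : ℝ))) a).symm

theorem setIntegral_fderiv_eq_zero (hV : IsOpen V) (hK : IsCompact K) (hKV : K ⊆ V)
    (hw : ContDiffOn ℝ 1 w V) (h0 : ∀ x ∈ V, x ∉ K → w x = 0) (a : E) :
    ∫ x in K, fderiv ℝ w x a ∂μ = 0 := by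
  have hsub : tsupport (V.indicator w) ⊆ K := tsupport_indicator_subset hK.isClosed h0
  have hagree : ∀ x ∈ K, fderiv ℝ w x a = fderiv ℝ (V.indicator w) x a := fun x hx ↦ by
    rw [((eqOn_indicator (s := V) (f := w)).eventuallyEq_of_mem (hV.mem_nhds (hKV hx))).fderiv_eq]
  rw [setIntegral_congr_fun hK.measurableSet hagree,
    setIntegral_eq_integral_of_forall_compl_eq_zero fun x hx ↦
      image_eq_zero_of_notMem_tsupport fun hxt ↦ hx
        (hsub (tsupport_fderiv_apply_subset ℝ a hxt))]
  exact integral_fderiv_eq_zero (contDiff_indicator hV hw (hsub.trans hKV))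
    (hK.of_isClosed_subset (isClosed_tsupport _) hsub) a

theorem eq_zero_of_forall_integral_mul_eq_zero (hV : IsOpen V) (hk : ContinuousOn k V)
    (h : ∀ u : E → ℝ, ContDiff ℝ ∞ u → HasCompactSupport u → tsupport u ⊆ V →
      ∫ x, u x * k x ∂μ = 0) : ∀ x ∈ V, k x = 0 := by
  have hae := hV.ae_eq_zero_of_integral_contDiff_smul_eq_zero (μ := μ)
    (hk.locallyIntegrableOn hV.measurableSet) h
  have hae' : k =ᵐ[μ.restrict V] fun _ ↦ 0 := (ae_restrict_iff' hV.measurableSet).2 hae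
  exact Measure.eqOn_open_of_ae_eq hae' hV hk continuousOn_const

theorem eq_sum_fderiv_of_forall_integral_eq_zero {ι : Type*} [Fintype ι] (hV : IsOpen V)
    (hk : ContinuousOn k V) {S : ι → E → ℝ} (hS : ∀ i, ContDiffOn ℝ 1 (S i) V) (b : ι → E)
    (h : ∀ u : E → ℝ, ContDiff ℝ ∞ u → HasCompactSupport u → tsupport u ⊆ V →
      ∫ x, u x * k x + ∑ i, fderiv ℝ u x (b i) * S i x ∂μ = 0) :
    ∀ x ∈ V, k x = ∑ i, fderiv ℝ (S i) x (b i) := by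
  have hS' : ∀ i, ContinuousOn (fun x ↦ fderiv ℝ (S i) x (b i)) V := fun i ↦
    ((hS i).continuousOn_fderiv_of_isOpen hV le_rfl).clm_apply continuousOn_const
  refine fun x hx ↦ sub_eq_zero.1 (eq_zero_of_forall_integral_mul_eq_zero (μ := μ) hV
    (hk.sub (continuousOn_finsetSum _ fun i _ ↦ hS' i)) (fun u hu hc hs ↦ ?_) x hx)
  have hu₁ : ContDiff ℝ 1 u := hu.of_le (mod_cast le_top)
  have hk_int : Integrable (fun x ↦ u x * k x) μ :=
    integrable_mul_of_tsupport_subset hV hu.continuous hc hs hk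
  have hS'_int : ∀ i, Integrable (fun x ↦ u x * fderiv ℝ (S i) x (b i)) μ := fun i ↦
    integrable_mul_of_tsupport_subset hV hu.continuous hc hs (hS' i)
  have hS_int : ∀ i, Integrable (fun x ↦ fderiv ℝ u x (b i) * S i x) μ := fun i ↦
    integrable_mul_of_tsupport_subset hV
      ((hu₁.continuous_fderiv one_ne_zero).clm_apply continuous_const) (hc.fderiv_apply ℝ (b i))
      ((tsupport_fderiv_apply_subset ℝ (b i)).trans hs) (hS i).continuousOn
  have hparts : ∀ i, ∫ x, u x * fderiv ℝ (S i) x (b i) ∂μ = -∫ x, fderiv ℝ u x (b i) * S i x ∂μ :=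
    fun i ↦ integral_mul_fderiv_of_tsupport_subset hV hu₁ hc hs (hS i) (b i)
  simp only [Pi.sub_apply, mul_sub, Finset.mul_sum]
  rw [integral_sub hk_int (integrable_finsetSum _ fun i _ ↦ hS'_int i),
    integral_finsetSum _ fun i _ ↦ hS'_int i, Finset.sum_congr rfl fun i _ ↦ hparts i,
    Finset.sum_neg_distrib, sub_neg_eq_add, ← integral_finsetSum _ fun i _ ↦ hS_int i,
    ← integral_add hk_int (integrable_finsetSum _ fun i _ ↦ hS_int i)]
  exact h u hu hc hs

end Measurable

theorem hasDerivAt_setIntegral_of_contDiffOn [MeasurableSpace E] [BorelSpace E] {μ : Measure E}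
    [IsFiniteMeasureOnCompacts μ] (hV : IsOpen V) (hK : IsCompact K) (hKV : K ⊆ V)
    {Φ : ℝ × E → ℝ} (hΦ : ContDiffOn ℝ 1 Φ (univ ×ˢ V)) (t₀ : ℝ) :
    HasDerivAt (fun t ↦ ∫ y in K, Φ (t, y) ∂μ)
      (∫ y in K, fderiv ℝ Φ (t₀, y) (1, 0) ∂μ) t₀ := by
  have hO : IsOpen (univ ×ˢ V : Set (ℝ × E)) := isOpen_univ.prod hV
  have hΦ' : ContinuousOn (fun p ↦ fderiv ℝ Φ p (1, 0)) (univ ×ˢ V) :=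
    (hΦ.continuousOn_fderiv_of_isOpen hO le_rfl).clm_apply continuousOn_const
  have hcompact : IsCompact (Icc (t₀ - 1) (t₀ + 1) ×ˢ K) := isCompact_Icc.prod hK
  obtain ⟨C, hC⟩ := hcompact.exists_bound_of_continuousOn (hΦ'.mono (prod_mono (subset_univ _) hKV))
  have hslice : ∀ t : ℝ, ContinuousOn (fun y : E ↦ (t, y)) K := fun t ↦ by fun_prop
  have hmaps : ∀ t : ℝ, MapsTo (fun y : E ↦ (t, y)) K (univ ×ˢ V) := fun t y hy ↦
    ⟨mem_univ _, hKV hy⟩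
  have hderiv : ∀ y ∈ K, ∀ t, HasDerivAt (fun t ↦ Φ (t, y)) (fderiv ℝ Φ (t, y) (1, 0)) t :=
    fun y hy t ↦ HasFDerivAt.comp_hasDerivAt (l := Φ) t
      ((hΦ.contDiffAt (hO.mem_nhds (hmaps t hy))).differentiableAt one_ne_zero).hasFDerivAt
      ((hasDerivAt_id t).prodMk (hasDerivAt_const t y))
  refine (hasDerivAt_integral_of_dominated_loc_of_deriv_le (s := Icc (t₀ - 1) (t₀ + 1))
    (bound := fun _ ↦ C) (F := fun t y ↦ Φ (t, y))
    (F' := fun t y ↦ fderiv ℝ Φ (t, y) (1, 0)) (Icc_mem_nhds (by simp) (by simp))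
    (Filter.Eventually.of_forall fun t ↦
      (hΦ.continuousOn.comp (hslice t) (hmaps t)).aestronglyMeasurable_of_isCompact hK
        hK.measurableSet)
    ((hΦ.continuousOn.comp (hslice t₀) (hmaps t₀)).integrableOn_compact hK)
    ((hΦ'.comp (hslice t₀) (hmaps t₀)).aestronglyMeasurable_of_isCompact hK hK.measurableSet) ?_
    (integrableOn_const hK.measure_lt_top.ne) ?_).2
  · exact (ae_restrict_iff' hK.measurableSet).2
      (.of_forall fun y hy t ht ↦ hC (t, y) ⟨ht, hy⟩)
  · exact (ae_restrict_iff' hK.measurableSet).2 (.of_forall fun y hy t _ ↦ hderiv y hy t)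

end CompactSupport

section FirstVariation

variable {E : Type*} [NormedAddCommGroup E] [NormedSpace ℝ E]
  {H : E → E →L[ℝ] E →L[ℝ] ℝ} {X : E → E} {y : E}

-- Shortcuts: the instance search on spaces of bilinear forms otherwise exceeds its heartbeat limit.
local instance : NormedAddCommGroup (E →L[ℝ] E →L[ℝ] ℝ) :=
  ContinuousLinearMap.toNormedAddCommGroup

local instance : AddCommGroup (E →L[ℝ] E →L[ℝ] ℝ) := NormedAddCommGroup.toAddCommGroup

/-- The pullback of the field of bilinear forms `H` under `y ↦ y + s • X y`. -/
def pullbackShift (H : E → E →L[ℝ] E →L[ℝ] ℝ) (X : E → E) (s : ℝ) (y : E) :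
    E →L[ℝ] E →L[ℝ] ℝ :=
  (H (y + s • X y)).bilinearComp (ContinuousLinearMap.id ℝ E + s • fderiv ℝ X y)
    (ContinuousLinearMap.id ℝ E + s • fderiv ℝ X y)

theorem pullbackShift_apply (H : E → E →L[ℝ] E →L[ℝ] ℝ) (X : E → E) (s : ℝ) (y a a' : E) :
    pullbackShift H X s y a a' =
      H (y + s • X y) (a + s • fderiv ℝ X y a) (a' + s • fderiv ℝ X y a') := rfl

/-- The Lie derivative `L_X H` of a field of bilinear forms on a vector space. -/
def lieDerivForm (H : E → E →L[ℝ] E →L[ℝ] ℝ) (X : E → E) (y : E) : E →L[ℝ] E →L[ℝ] ℝ :=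
  fderiv ℝ H y (X y) + (H y).bilinearComp (fderiv ℝ X y) (.id ℝ E)
    + (H y).bilinearComp (.id ℝ E) (fderiv ℝ X y)

theorem lieDerivForm_apply (H : E → E →L[ℝ] E →L[ℝ] ℝ) (X : E → E) (y a a' : E) :
    lieDerivForm H X y a a' =
      fderiv ℝ H y (X y) a a' + H y (fderiv ℝ X y a) a' + H y a (fderiv ℝ X y a') := rfl

theorem contDiffOn_lieDerivForm_apply {k : WithTop ℕ∞} {V : Set E} (hV : IsOpen V)
    (hH : ContDiffOn ℝ (k + 1) H V) (hX : ContDiffOn ℝ (k + 1) X V) (a a' : E) :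
    ContDiffOn ℝ k (fun y ↦ lieDerivForm H X y a a') V := by
  have hH' := hH.fderiv_of_isOpen hV le_rfl
  have hX' := hX.fderiv_of_isOpen hV le_rfl
  have hH₀ := hH.of_le le_self_add
  exact (((hH'.clm_apply (hX.of_le le_self_add)).clm_apply contDiffOn_const).clm_apply
    contDiffOn_const).add ((hH₀.clm_apply (hX'.clm_apply contDiffOn_const)).clm_apply
    contDiffOn_const) |>.add ((hH₀.clm_apply contDiffOn_const).clm_apply
    (hX'.clm_apply contDiffOn_const))

theorem lieDerivForm_const_smul (H : E → E →L[ℝ] E →L[ℝ] ℝ) (hX : DifferentiableAt ℝ X y)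
    (c : ℝ) : lieDerivForm H (fun z ↦ c • X z) y = c • lieDerivForm H X y := by
  ext a a'
  simp only [lieDerivForm_apply, fderiv_fun_const_smul hX, ContinuousLinearMap.map_smul, smul_apply,
    smul_eq_mul]
  ring

theorem lieDerivForm_smul_const_apply (H : E → E →L[ℝ] E →L[ℝ] ℝ) {u : E → ℝ}
    (hu : DifferentiableAt ℝ u y) (v a a' : E) :
    lieDerivForm H (fun z ↦ u z • v) y a a' =
      u y * fderiv ℝ H y v a a' + fderiv ℝ u y a * H y v a' + fderiv ℝ u y a' * H y a v := by
  simp only [lieDerivForm_apply, fderiv_smul_const hu, ContinuousLinearMap.smulRight_apply,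
    ContinuousLinearMap.map_smul, smul_apply, smul_eq_mul]

theorem lieDerivForm_of_notMem_tsupport (H : E → E →L[ℝ] E →L[ℝ] ℝ) (hy : y ∉ tsupport X) :
    lieDerivForm H X y = 0 := by
  ext a a'
  simp only [lieDerivForm_apply, image_eq_zero_of_notMem_tsupport hy,
    fderiv_of_notMem_tsupport ℝ hy, ContinuousLinearMap.map_zero, zero_apply, add_zero]

theorem hasDerivAt_pullbackShift (hH : DifferentiableAt ℝ H y) (X : E → E) (a a' : E) :
    HasDerivAt (fun s ↦ pullbackShift H X s y a a') (lieDerivForm H X y a a') 0 := by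
  have hline : ∀ c w : E, HasDerivAt (fun s : ℝ ↦ c + s • w) w 0 := fun c w ↦ by
    simpa using ((hasDerivAt_id (0 : ℝ)).smul_const w).const_add c
  have hH' : HasFDerivAt H (fderiv ℝ H y) (y + (0 : ℝ) • X y) := by
    simpa only [zero_smul, add_zero] using hH.hasFDerivAt
  have hcomp : HasDerivAt (fun s : ℝ ↦ H (y + s • X y)) (fderiv ℝ H y (X y)) 0 :=
    HasFDerivAt.comp_hasDerivAt (l := H) (0 : ℝ) hH' (hline y (X y))
  simpa [pullbackShift_apply, lieDerivForm_apply] using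
    (hcomp.clm_apply (hline a (fderiv ℝ X y a))).clm_apply (hline a' (fderiv ℝ X y a'))

theorem contDiffOn_pullbackShift [FiniteDimensional ℝ E] {V : Set E} (hH : ContDiffOn ℝ 1 H V)
    (hX : ContDiff ℝ 2 X) (hmaps : ∀ s : ℝ, |s| ≤ 1 → ∀ y ∈ V, y + s • X y ∈ V) :
    ContDiffOn ℝ 1 (fun p : ℝ × E ↦ pullbackShift H X (Real.sin p.1) p.2) (univ ×ˢ V) := by
  refine contDiffOn_clm_apply.2 fun a ↦ contDiffOn_clm_apply.2 fun a' ↦ ?_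
  simp only [pullbackShift_apply]
  have hX' : ContDiff ℝ 1 (fderiv ℝ X) := hX.fderiv_right (by norm_num)
  have hsin : ContDiff ℝ 1 fun p : ℝ × E ↦ Real.sin p.1 := Real.contDiff_sin.comp contDiff_fst
  have hvector : ∀ c : E, ContDiff ℝ 1 fun p : ℝ × E ↦ c + Real.sin p.1 • fderiv ℝ X p.2 c :=
    fun c ↦ contDiff_const.add (hsin.smul ((hX'.comp contDiff_snd).clm_apply contDiff_const))
  have hpoint : ContDiff ℝ 1 fun p : ℝ × E ↦ p.2 + Real.sin p.1 • X p.2 :=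
    contDiff_snd.add (hsin.smul ((hX.of_le one_le_two).comp contDiff_snd))
  exact ((hH.comp hpoint.contDiffOn fun p hp ↦ hmaps _ (Real.abs_sin_le_one _) _ hp.2).clm_apply
    (hvector a).contDiffOn).clm_apply (hvector a').contDiffOn

theorem exists_smul_add_mem {V : Set E} (hV : IsOpen V) (hX : Continuous X)
    (hc : HasCompactSupport X) (hs : tsupport X ⊆ V) :
    ∃ ε : ℝ, 0 < ε ∧ ∀ s : ℝ, |s| ≤ 1 → ∀ y ∈ V, y + s • ε • X y ∈ V := by
  obtain ⟨δ, hδ, hδV⟩ := hc.isCompact.exists_cthickening_subset_open hV hs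
  obtain ⟨C, hC⟩ := hc.exists_bound_of_continuous hX
  have hC0 : 0 ≤ C := (norm_nonneg _).trans (hC 0)
  have hε : 0 < δ / (C + 1) := by positivity
  refine ⟨δ / (C + 1), hε, fun s hs1 y hy ↦ ?_⟩
  by_cases hyX : y ∈ tsupport X
  · refine hδV (Metric.mem_cthickening_of_dist_le _ y δ _ hyX ?_)
    calc dist (y + s • (δ / (C + 1)) • X y) y
        = |s| * (δ / (C + 1) * ‖X y‖) := by
          rw [dist_eq_norm, add_sub_cancel_left, norm_smul, norm_smul, Real.norm_eq_abs,
            Real.norm_of_nonneg hε.le]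
      _ ≤ 1 * (δ / (C + 1) * (C + 1)) := by
          gcongr
          linarith [hC y]
      _ = δ := by rw [one_mul, div_mul_cancel₀ _ (by positivity)]
  · simpa [image_eq_zero_of_notMem_tsupport hyX] using hy

variable {ι : Type*} [Fintype ι] [DecidableEq ι]

theorem relTrace_smul (b : ι → E) (G B : E →L[ℝ] E →L[ℝ] ℝ) (c : ℝ) :
    relTrace b G (c • B) = c * relTrace b G B := by
  simp only [relTrace, smul_apply, smul_eq_mul, Finset.mul_sum, mul_left_comm]

theorem hasDerivAt_relTrace_pullbackShift (hH : DifferentiableAt ℝ H y) (X : E → E) (b : ι → E)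
    (G : E →L[ℝ] E →L[ℝ] ℝ) :
    HasDerivAt (fun s ↦ relTrace b G (pullbackShift H X s y))
      (relTrace b G (lieDerivForm H X y)) 0 :=
  HasDerivAt.fun_sum fun i _ ↦ HasDerivAt.fun_sum fun j _ ↦
    (hasDerivAt_pullbackShift hH X (b i) (b j)).const_mul _

/-- The components `√(det G) G^{ij}` of the inverse of the inner product `G`, weighted by its
volume density. -/
def cometricDensity (b : ι → E) (G : E →L[ℝ] E →L[ℝ] ℝ) (i j : ι) : ℝ :=
  relDensity b G * (gramMatrix b G)⁻¹ i j

section Density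

variable {G : E → E →L[ℝ] E →L[ℝ] ℝ} {b : ι → E}

theorem contDiffOn_cometricDensity {k : WithTop ℕ∞} {V : Set E} (hG : ContDiffOn ℝ k G V)
    (hdet : ∀ y ∈ V, (gramMatrix b (G y)).det ≠ 0) (i j : ι) :
    ContDiffOn ℝ k (fun y ↦ cometricDensity b (G y) i j) V :=
  (contDiffOn_relDensity hG hdet).mul (contDiffOn_gramMatrix_inv hG hdet i j)

theorem fderiv_cometricDensity (hG : DifferentiableAt ℝ G y) (hGi : IsInnerForm (G y))
    (hb : LinearIndependent ℝ b) (hone : gramMatrix b (G y) = 1) (v : E) (i j : ι) :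
    fderiv ℝ (fun z ↦ cometricDensity b (G z) i j) y v =
      1 / 2 * (∑ k, fderiv ℝ G y v (b k) (b k)) * (1 : Matrix ι ι ℝ) i j
        - fderiv ℝ G y v (b i) (b j) := by
  have hdet : (gramMatrix b (G y)).det ≠ 0 := (hGi.det_pos hb).ne'
  have hdensity : relDensity b (G y) = 1 := by rw [relDensity, hone, Matrix.det_one, Real.sqrt_one]
  have htrace : relTrace b (G y) (fderiv ℝ G y v) = ∑ k, fderiv ℝ G y v (b k) (b k) := by
    simp [relTrace, hone, Matrix.one_apply]
  have hdiff : DifferentiableAt ℝ (fun z ↦ relDensity b (G z)) y :=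
    (hasFDerivAt_det_gramMatrix hG b).differentiableAt.sqrt hdet
  simp only [cometricDensity]
  rw [fderiv_fun_mul hdiff (differentiableAt_gramMatrix_inv hG hdet i j)]
  simp only [add_apply, smul_apply, smul_eq_mul, fderiv_relDensity hG hGi hb,
    fderiv_gramMatrix_inv hG hone, hdensity, htrace, hone, inv_one]
  ring

end Density

variable {V : Set E} {G : E → E →L[ℝ] E →L[ℝ] ℝ} {b : Module.Basis ι ℝ E}

theorem relDensity_mul_relTrace_lieDerivForm (hG : IsInnerForm (G y))
    (hH : ∀ a a', H y a a' = H y a' a) {u : E → ℝ} (hu : DifferentiableAt ℝ u y) (v : E) :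
    relDensity b (G y) * relTrace b (G y) (lieDerivForm H (fun z ↦ u z • v) y) =
      u y * (relDensity b (G y) * relTrace b (G y) (fderiv ℝ H y v)) +
        ∑ i, fderiv ℝ u y (b i) * (2 * ∑ j, cometricDensity b (G y) i j * H y v (b j)) := by
  have hswap : ∑ i, ∑ j, (gramMatrix b (G y))⁻¹ i j * (fderiv ℝ u y (b j) * H y (b i) v) =
      ∑ i, ∑ j, (gramMatrix b (G y))⁻¹ i j * (fderiv ℝ u y (b i) * H y v (b j)) := by
    rw [Finset.sum_comm]
    exact Finset.sum_congr rfl fun i _ ↦ Finset.sum_congr rfl fun j _ ↦ by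
      rw [hG.inv_symm, hH]
  simp only [relTrace, lieDerivForm_smul_const_apply H hu, mul_add, Finset.sum_add_distrib, hswap,
    cometricDensity, Finset.mul_sum]
  rw [add_assoc, ← Finset.sum_add_distrib]
  refine congrArg₂ _ (Finset.sum_congr rfl fun i _ ↦ Finset.sum_congr rfl fun j _ ↦ by ring)
    (Finset.sum_congr rfl fun i _ ↦ ?_)
  rw [← Finset.sum_add_distrib]
  exact Finset.sum_congr rfl fun j _ ↦ by ring

section Critical

variable [FiniteDimensional ℝ E] [MeasurableSpace E] [BorelSpace E] {μ : Measure E}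

/-- The energy `∫ tr_G H dv_G` in `V` is critical under the domain variations
`y ↦ y + sin t • X y` supported in `V`. The sine keeps the variation inside `V` for all times `t`,
as is required of the variations of a harmonic map. -/
def IsCriticalForDomainVariations (μ : Measure E) (V : Set E) (b : Module.Basis ι ℝ E)
    (G H : E → E →L[ℝ] E →L[ℝ] ℝ) : Prop :=
  ∀ X : E → E, ContDiff ℝ ∞ X → HasCompactSupport X → tsupport X ⊆ V →
    (∀ s : ℝ, |s| ≤ 1 → ∀ y ∈ V, y + s • X y ∈ V) →
    HasDerivAt (fun t ↦ ∫ y in tsupport X, relDensity b (G y) *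
      relTrace b (G y) (pullbackShift H X (Real.sin t) y) ∂μ) 0 0

theorem hasDerivAt_integral_pullbackShift [IsFiniteMeasureOnCompacts μ] (hV : IsOpen V)
    (hG : ContDiffOn ℝ 1 G V) (hGi : ∀ y ∈ V, IsInnerForm (G y)) (hH : ContDiffOn ℝ 1 H V)
    (b : Module.Basis ι ℝ E) (hX : ContDiff ℝ 2 X) (hc : HasCompactSupport X)
    (hs : tsupport X ⊆ V) (hmaps : ∀ s : ℝ, |s| ≤ 1 → ∀ y ∈ V, y + s • X y ∈ V) :
    HasDerivAt (fun t ↦ ∫ y in tsupport X, relDensity b (G y) *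
        relTrace b (G y) (pullbackShift H X (Real.sin t) y) ∂μ)
      (∫ y, relDensity b (G y) * relTrace b (G y) (lieDerivForm H X y) ∂μ) 0 := by
  have hdet : ∀ y ∈ V, (gramMatrix b (G y)).det ≠ 0 := fun y hy ↦
    ((hGi y hy).det_pos b.linearIndependent).ne'
  have hG' : ContDiffOn ℝ 1 (fun p : ℝ × E ↦ G p.2) (univ ×ˢ V) :=
    hG.comp contDiffOn_snd fun p hp ↦ hp.2
  have hΦ : ContDiffOn ℝ 1 (fun p : ℝ × E ↦ relDensity b (G p.2) *
      relTrace b (G p.2) (pullbackShift H X (Real.sin p.1) p.2)) (univ ×ˢ V) :=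
    (contDiffOn_relDensity hG' fun p hp ↦ hdet _ hp.2).mul
      (contDiffOn_relTrace hG' (fun p hp ↦ hdet _ hp.2) (contDiffOn_pullbackShift hH hX hmaps))
  have hpoint : ∀ y ∈ tsupport X, fderiv ℝ (fun p : ℝ × E ↦ relDensity b (G p.2) *
      relTrace b (G p.2) (pullbackShift H X (Real.sin p.1) p.2)) (0, y) (1, 0) =
      relDensity b (G y) * relTrace b (G y) (lieDerivForm H X y) := fun y hy ↦ by
    have hHy : DifferentiableAt ℝ H y :=
      (hH.contDiffAt (hV.mem_nhds (hs hy))).differentiableAt one_ne_zero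
    have hΦy := HasFDerivAt.comp_hasDerivAt (0 : ℝ) ((hΦ.contDiffAt
      ((isOpen_univ.prod hV).mem_nhds ⟨mem_univ (0 : ℝ), hs hy⟩)).differentiableAt
      one_ne_zero).hasFDerivAt ((hasDerivAt_id (0 : ℝ)).prodMk (hasDerivAt_const (0 : ℝ) y))
    have hsin : HasDerivAt (fun t ↦ relTrace b (G y) (pullbackShift H X (Real.sin t) y))
        (relTrace b (G y) (lieDerivForm H X y)) 0 := by
      simpa [Function.comp_def] using HasDerivAt.comp (0 : ℝ) (Real.sin_zero.symm ▸
        hasDerivAt_relTrace_pullbackShift hHy X b (G y)) (Real.hasDerivAt_sin 0)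
    exact hΦy.unique (hsin.const_mul (relDensity b (G y)))
  have hderiv := hasDerivAt_setIntegral_of_contDiffOn (μ := μ) hV hc.isCompact hs hΦ 0
  rwa [setIntegral_congr_fun (isClosed_tsupport X).measurableSet hpoint,
    setIntegral_eq_integral_of_forall_compl_eq_zero fun y hy ↦ by
      simp [lieDerivForm_of_notMem_tsupport H hy, relTrace]] at hderiv

theorem IsCriticalForDomainVariations.integral_lieDerivForm_eq_zero [IsFiniteMeasureOnCompacts μ]
    (hcrit : IsCriticalForDomainVariations μ V b G H) (hV : IsOpen V)
    (hG : ContDiffOn ℝ 1 G V) (hGi : ∀ y ∈ V, IsInnerForm (G y)) (hH : ContDiffOn ℝ 1 H V)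
    (hX : ContDiff ℝ ∞ X) (hc : HasCompactSupport X) (hs : tsupport X ⊆ V) :
    ∫ y, relDensity b (G y) * relTrace b (G y) (lieDerivForm H X y) ∂μ = 0 := by
  obtain ⟨ε, hε, hmaps⟩ := exists_smul_add_mem hV hX.continuous hc hs
  have hεX : ContDiff ℝ ∞ fun y ↦ ε • X y := contDiff_const.smul hX
  have hsub : tsupport (fun y ↦ ε • X y) ⊆ tsupport X :=
    tsupport_smul_subset_right (fun _ ↦ ε) X
  have hεc : HasCompactSupport fun y ↦ ε • X y := hc.of_isClosed_subset (isClosed_tsupport _) hsub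
  have hzero := (hasDerivAt_integral_pullbackShift (μ := μ) hV hG hGi hH b
    (contDiff_infty.1 hεX 2) hεc (hsub.trans hs) hmaps).unique
    (hcrit _ hεX hεc (hsub.trans hs) hmaps)
  have hlie : ∀ y, lieDerivForm H (fun y ↦ ε • X y) y = ε • lieDerivForm H X y := fun y ↦
    lieDerivForm_const_smul H (hX.differentiable (by simp) y) ε
  simp only [hlie, relTrace_smul, mul_left_comm _ ε, integral_const_mul] at hzero
  exact (mul_eq_zero.1 hzero).resolve_left hε.ne'

theorem IsCriticalForDomainVariations.relDensity_mul_relTrace_fderiv [μ.IsAddHaarMeasure]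
    (hcrit : IsCriticalForDomainVariations μ V b G H) (hV : IsOpen V)
    (hG : ContDiffOn ℝ 1 G V) (hGi : ∀ y ∈ V, IsInnerForm (G y)) (hH : ContDiffOn ℝ 1 H V)
    (hsymm : ∀ y ∈ V, ∀ a a', H y a a' = H y a' a) (v : E) (hy : y ∈ V) :
    relDensity b (G y) * relTrace b (G y) (fderiv ℝ H y v) =
      ∑ i, fderiv ℝ (fun z ↦ 2 * ∑ j, cometricDensity b (G z) i j * H z v (b j)) y (b i) := by
  have hdet : ∀ y ∈ V, (gramMatrix b (G y)).det ≠ 0 := fun y hy ↦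
    ((hGi y hy).det_pos b.linearIndependent).ne'
  have hH' : ContinuousOn (fun y ↦ fderiv ℝ H y v) V :=
    (hH.continuousOn_fderiv_of_isOpen hV le_rfl).clm_apply continuousOn_const
  refine eq_sum_fderiv_of_forall_integral_eq_zero (μ := μ) hV
    ((contDiffOn_relDensity hG hdet).continuousOn.mul (contDiffOn_zero.1 (contDiffOn_relTrace
      (contDiffOn_zero.2 hG.continuousOn) hdet (contDiffOn_zero.2 hH'))))
    (fun i ↦ contDiffOn_const.mul (ContDiffOn.sum fun j _ ↦ (contDiffOn_cometricDensity hG hdet i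
      j).mul ((hH.clm_apply contDiffOn_const).clm_apply contDiffOn_const))) b
    (fun u hu hc hs ↦ ?_) y hy
  have hsub : tsupport (fun z ↦ u z • v) ⊆ tsupport u := tsupport_smul_subset_left u fun _ ↦ v
  rw [← hcrit.integral_lieDerivForm_eq_zero hV hG hGi hH (hu.smul contDiff_const)
    (hc.of_isClosed_subset (isClosed_tsupport _) hsub) (hsub.trans hs)]
  refine integral_congr_ae (.of_forall fun z ↦ ?_)
  by_cases hz : z ∈ V
  · exact (relDensity_mul_relTrace_lieDerivForm (hGi z hz) (hsymm z hz)
      (hu.differentiable (by simp) z) v).symm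
  · have hzu : z ∉ tsupport u := fun h ↦ hz (hs h)
    have hzX : lieDerivForm H (u • fun _ ↦ v) z = 0 :=
      lieDerivForm_of_notMem_tsupport H fun h ↦ hzu (hsub h)
    simp [hzX, relTrace, image_eq_zero_of_notMem_tsupport hzu, fderiv_of_notMem_tsupport ℝ hzu]

theorem IsCriticalForDomainVariations.sum_fderiv_of_orthonormal [μ.IsAddHaarMeasure]
    (hcrit : IsCriticalForDomainVariations μ V b G H) (hV : IsOpen V)
    (hG : ContDiffOn ℝ 1 G V) (hGi : ∀ y ∈ V, IsInnerForm (G y)) (hH : ContDiffOn ℝ 1 H V)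
    (hsymm : ∀ y ∈ V, ∀ a a', H y a a' = H y a' a) (v : E) (hy : y ∈ V)
    (hone : gramMatrix b (G y) = 1) :
    ∑ i, fderiv ℝ H y v (b i) (b i) =
      ∑ i, ∑ j, fderiv ℝ G y (b i) (b j) (b j) * H y v (b i)
      - 2 * ∑ i, ∑ j, fderiv ℝ G y (b i) (b i) (b j) * H y v (b j)
      + 2 * ∑ i, fderiv ℝ H y (b i) v (b i) := by
  have hGy : DifferentiableAt ℝ G y :=
    (hG.contDiffAt (hV.mem_nhds hy)).differentiableAt one_ne_zero
  have hHy : DifferentiableAt ℝ H y :=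
    (hH.contDiffAt (hV.mem_nhds hy)).differentiableAt one_ne_zero
  have hcometric : ∀ i j, DifferentiableAt ℝ (fun z ↦ cometricDensity b (G z) i j) y := fun i j ↦
    ((contDiffOn_cometricDensity hG (fun z hz ↦ ((hGi z hz).det_pos b.linearIndependent).ne') i
      j).contDiffAt (hV.mem_nhds hy)).differentiableAt one_ne_zero
  have hdensity : relDensity b (G y) = 1 := by rw [relDensity, hone, Matrix.det_one, Real.sqrt_one]
  have hterm : ∀ i j, DifferentiableAt ℝ (fun z ↦ cometricDensity b (G z) i j * H z v (b j)) y :=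
    fun i j ↦ (hcometric i j).fun_mul (differentiableAt_clm_apply₂ hHy _ _)
  have heuler := hcrit.relDensity_mul_relTrace_fderiv hV hG hGi hH hsymm v hy
  simp only [fderiv_const_mul (DifferentiableAt.fun_sum fun j _ ↦ hterm _ j),
    fderiv_fun_sum fun j _ ↦ hterm _ j,
    fderiv_fun_mul (hcometric _ _) (differentiableAt_clm_apply₂ hHy _ _), smul_apply, sum_apply,
    add_apply, smul_eq_mul, fderiv_clm_apply₂ hHy,
    fderiv_cometricDensity hGy (hGi y hy) b.linearIndependent hone] at heuler
  simp only [relTrace, cometricDensity, hdensity, hone, inv_one, Matrix.one_apply, one_mul,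
    ite_mul, mul_ite, mul_one, mul_zero, zero_mul, mul_sub, Finset.sum_ite_eq,
    Finset.mem_univ, if_true, Finset.sum_add_distrib, Finset.sum_sub_distrib, ← Finset.mul_sum,
    mul_add] at heuler
  rw [heuler]
  simp only [← Finset.sum_mul, mul_comm (H y v _), mul_assoc (1 / 2 : ℝ), ← Finset.mul_sum]
  ring

end Critical

end FirstVariation

local notation "ℝ^" k:max => EuclideanSpace ℝ (Fin k)

section Frame

variable {n : ℕ} {M : Type*} [TopologicalSpace M] [ChartedSpace (ℝ^n) M]
  [IsManifold (𝓡 n) ∞ M]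

variable (n) in
/-- The frame of the tangent bundle given by the chart at `c`. -/
def frame (c x : M) : ℝ^n →L[ℝ] TangentSpace (𝓡 n) x :=
  (trivializationAt (ℝ^n) (TangentSpace (𝓡 n)) c).symmL ℝ x

variable (n) in
/-- The components of a tangent vector in the chart at `c`. -/
def coframe (c x : M) : TangentSpace (𝓡 n) x →L[ℝ] ℝ^n :=
  (trivializationAt (ℝ^n) (TangentSpace (𝓡 n)) c).continuousLinearMapAt ℝ x

theorem coframe_frame {c x : M} (hx : x ∈ (chartAt (ℝ^n) c).source)
    (a : ℝ^n) : coframe n c x (frame n c x a) = a :=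
  (trivializationAt (ℝ^n)
    (TangentSpace (𝓡 n)) c).continuousLinearMapAt_symmL (R := ℝ) (by simpa using hx) a

theorem frame_coframe {c x : M} (hx : x ∈ (chartAt (ℝ^n) c).source)
    (v : TangentSpace (𝓡 n) x) : frame n c x (coframe n c x v) = v :=
  (trivializationAt (ℝ^n)
    (TangentSpace (𝓡 n)) c).symmL_continuousLinearMapAt (R := ℝ) (by simpa using hx) v

/-- The chart frame as a linear equivalence. -/
def frameEquiv {c x : M} (hx : x ∈ (chartAt (ℝ^n) c).source) :
    ℝ^n ≃L[ℝ] TangentSpace (𝓡 n) x :=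
  ContinuousLinearEquiv.equivOfInverse (frame n c x) (coframe n c x) (coframe_frame hx)
    (frame_coframe hx)

theorem contMDiffOn_frame_apply {c : M} {A : M → ℝ^n}
    (hA : ContMDiffOn (𝓡 n) 𝓘(ℝ, ℝ^n) ∞ A (chartAt (ℝ^n) c).source) :
    ContMDiffOn (𝓡 n) (𝓡 n).tangent ∞ (T% fun x ↦ frame n c x (A x))
      (chartAt (ℝ^n) c).source := by
  have hsymmL := (trivializationAt (ℝ^n) (TangentSpace (𝓡 n) : M → Type _) c).contMDiffOn_symmL
    (n := ∞) (IB := 𝓡 n) (𝕜 := ℝ)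
  rw [TangentBundle.trivializationAt_baseSet] at hsymmL
  have hsection : ContMDiffOn (𝓡 n) ((𝓡 n).prod 𝓘(ℝ, ℝ^n)) ∞
      (fun x : M ↦ TotalSpace.mk' (ℝ^n) (E := Bundle.Trivial M (ℝ^n)) x (A x))
      (chartAt (ℝ^n) c).source := fun x hx ↦
    Bundle.contMDiffWithinAt_totalSpace.2 ⟨contMDiffWithinAt_id, hA x hx⟩
  exact hsymmL.clm_bundle_apply hsection

theorem contMDiffOn_frame (c : M) (a : ℝ^n) :
    ContMDiffOn (𝓡 n) (𝓡 n).tangent ∞ (T% fun x ↦ frame n c x a) (chartAt (ℝ^n) c).source :=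
  contMDiffOn_frame_apply contMDiffOn_const

theorem mdifferentiableAt_frame {c x : M} (hx : x ∈ (chartAt (ℝ^n) c).source) (a : ℝ^n) :
    MDifferentiableAt (𝓡 n) (𝓡 n).tangent (T% fun x ↦ frame n c x a) x :=
  ((contMDiffOn_frame c a).contMDiffAt
    ((chartAt _ c).open_source.mem_nhds hx)).mdifferentiableAt (by simp)

theorem mfderiv_chart_symm {c : M} {y : ℝ^n} (hy : y ∈ (chartAt (ℝ^n) c).target) :
    mfderiv (𝓡 n) (𝓡 n) (chartAt (ℝ^n) c).symm y = frame n c ((chartAt (ℝ^n) c).symm y) := by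
  have hright : extChartAt (𝓡 n) c ((chartAt (ℝ^n) c).symm y) = y := by
    simp [mfld_simps, (chartAt (ℝ^n) c).right_inv hy]
  rw [frame, TangentBundle.symmL_trivializationAt (I := 𝓡 n) (𝕜 := ℝ)
    ((chartAt (ℝ^n) c).map_target hy), hright]
  simp only [mfld_simps, mfderivWithin_univ]

theorem contDiffOn_comp_chart_symm {F : Type*} [NormedAddCommGroup F] [NormedSpace ℝ F] {c : M}
    {k : M → F}
    (hk : ContMDiffOn (𝓡 n) 𝓘(ℝ, F) ∞ k (chartAt (ℝ^n) c).source) :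
    ContDiffOn ℝ ∞ (k ∘ (chartAt (ℝ^n) c).symm)
      (chartAt (ℝ^n) c).target := by
  rw [← contMDiffOn_iff_contDiffOn]
  exact hk.comp contMDiffOn_chart_symm fun y hy ↦ (chartAt _ c).map_target hy

theorem mvfderiv_frame {c : M} {y : ℝ^n} (hy : y ∈ (chartAt (ℝ^n) c).target) {k : M → ℝ}
    (hk : MDifferentiableAt (𝓡 n) 𝓘(ℝ, ℝ) k ((chartAt (ℝ^n) c).symm y)) (a : ℝ^n) :
    mvfderiv (𝓡 n) k ((chartAt (ℝ^n) c).symm y) (frame n c ((chartAt (ℝ^n) c).symm y) a) =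
      fderiv ℝ (k ∘ (chartAt (ℝ^n) c).symm) y a := by
  have hcomp := mvfderiv_comp_apply (I := 𝓡 n) (I' := 𝓡 n) y hk
    (mdifferentiableAt_atlas_symm (chart_mem_atlas _ c) hy) a
  rw [mfderiv_chart_symm hy] at hcomp
  refine hcomp.symm.trans ?_
  rw [← mfderiv_eq_fderiv]
  rfl

theorem coordVector_eq_frame {c : M} {y : ℝ^n}
    (hy : y ∈ (chartAt (ℝ^n) c).target) (i : Fin n) :
    coordVector c y i = frame n c ((chartAt (ℝ^n) c).symm y)
      (EuclideanSpace.single i (1 : ℝ)) := by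
  rw [coordVector, mfderiv_chart_symm hy]
  rfl

variable [RiemannianBundle (fun x : M ↦ TangentSpace (𝓡 n) x)]

/-- The expression of a two-form in the chart at `c`. -/
def chartForm (c : M)
    (φ : Π x : M, TangentSpace (𝓡 n) x →L[ℝ] TangentSpace (𝓡 n) x →L[ℝ] ℝ)
    (y : ℝ^n) :
    ℝ^n →L[ℝ] ℝ^n →L[ℝ] ℝ :=
  (φ ((chartAt (ℝ^n) c).symm y)).bilinearComp
    (frame n c ((chartAt (ℝ^n) c).symm y))
    (frame n c ((chartAt (ℝ^n) c).symm y))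

theorem chartForm_apply (c : M)
    (φ : Π x : M, TangentSpace (𝓡 n) x →L[ℝ] TangentSpace (𝓡 n) x →L[ℝ] ℝ)
    (y a a' : ℝ^n) :
    chartForm c φ y a a' = φ ((chartAt (ℝ^n) c).symm y)
      (frame n c ((chartAt (ℝ^n) c).symm y) a)
      (frame n c ((chartAt (ℝ^n) c).symm y) a') := rfl

/-- Smoothness of a two-form, in terms of its components in the charts. -/
def HasSmoothComponents (φ : Π x : M, TangentSpace (𝓡 n) x →L[ℝ] TangentSpace (𝓡 n) x →L[ℝ] ℝ) :
    Prop :=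
  ∀ (c : M) (a a' : ℝ^n), ContMDiffOn (𝓡 n) 𝓘(ℝ, ℝ) ∞
    (fun x ↦ φ x (frame n c x a) (frame n c x a')) (chartAt (ℝ^n) c).source

theorem HasSmoothComponents.contDiffOn
    {φ : Π x : M, TangentSpace (𝓡 n) x →L[ℝ] TangentSpace (𝓡 n) x →L[ℝ] ℝ}
    (hφ : HasSmoothComponents φ) (c : M) :
    ContDiffOn ℝ ∞ (chartForm c φ) (chartAt (ℝ^n) c).target :=
  contDiffOn_clm_apply.2 fun a ↦ contDiffOn_clm_apply.2 fun a' ↦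
    contDiffOn_comp_chart_symm (hφ c a a')

variable (n) in
/-- The standard basis of Euclidean space. -/
def stdBasis : Module.Basis (Fin n) ℝ (ℝ^n) :=
  (EuclideanSpace.basisFun (Fin n) ℝ).toBasis

section Metric

variable (n M) in
/-- The metric as a two-form. -/
def metricForm (x : M) : TangentSpace (𝓡 n) x →L[ℝ] TangentSpace (𝓡 n) x →L[ℝ] ℝ :=
  innerSL ℝ (E := TangentSpace (𝓡 n) x)

omit [IsManifold (𝓡 n) ∞ M] in
theorem metricForm_apply (x : M) (v w : TangentSpace (𝓡 n) x) :
    metricForm n M x v w = inner ℝ v w := rfl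

theorem isInnerForm_chartForm_metricForm {c : M} {y : ℝ^n}
    (hy : y ∈ (chartAt (ℝ^n) c).target) :
    IsInnerForm (chartForm c (metricForm n M) y) := by
  refine ⟨fun v w ↦ ?_, fun v hv ↦ ?_⟩
  · simpa only [chartForm_apply, metricForm_apply] using real_inner_comm _ _
  · refine (real_inner_self_pos (x := frame n c _ v)).2 fun hzero ↦ hv ?_
    rw [← coframe_frame ((chartAt (ℝ^n) c).map_target hy) v, hzero, map_zero]

theorem det_gramMatrix_chartForm_metricForm_ne_zero {c : M} {y : ℝ^n}
    (hy : y ∈ (chartAt (ℝ^n) c).target) :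
    (gramMatrix (stdBasis n) (chartForm c (metricForm n M) y)).det ≠ 0 :=
  ((isInnerForm_chartForm_metricForm hy).det_pos (stdBasis n).linearIndependent).ne'

theorem metricTrace_eq_relTrace {c : M} {y : ℝ^n}
    (hy : y ∈ (chartAt (ℝ^n) c).target)
    (φ : Π x : M, TangentSpace (𝓡 n) x →L[ℝ] TangentSpace (𝓡 n) x →L[ℝ] ℝ)
    (b : Module.Basis (Fin n) ℝ (ℝ^n)) :
    metricTrace (φ ((chartAt (ℝ^n) c).symm y)) =
      relTrace b (chartForm c (metricForm n M) y) (chartForm c φ y) :=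
  sum_orthonormal_eq_relTrace (orthoBasis (𝓡 n) _) b
    (frameEquiv ((chartAt (ℝ^n) c).map_target hy))
    (fun _ _ ↦ rfl) _

variable [IsContMDiffRiemannianBundle (𝓡 n) ∞ (ℝ^n) (fun x : M ↦ TangentSpace (𝓡 n) x)]

theorem hasSmoothComponents_metricForm : HasSmoothComponents (metricForm n M) := fun c a a' ↦
  ContMDiffOn.inner_bundle (IB := 𝓡 n) (F := ℝ^n)
    (E := fun y : M ↦ TangentSpace (𝓡 n) y) (b := fun y ↦ y)
    (contMDiffOn_frame c a) (contMDiffOn_frame c a')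

theorem contMDiff_metricTrace
    {φ : Π x : M, TangentSpace (𝓡 n) x →L[ℝ] TangentSpace (𝓡 n) x →L[ℝ] ℝ}
    (hφ : HasSmoothComponents φ) :
    ContMDiff (𝓡 n) 𝓘(ℝ, ℝ) ∞ fun x ↦ metricTrace (φ x) := by
  intro c
  have hc := (chartAt (ℝ^n) c).open_source.mem_nhds (mem_chart_source _ c)
  have hchart : ContMDiffOn (𝓡 n) 𝓘(ℝ, ℝ) ∞
      (fun y ↦ relTrace (stdBasis n) (chartForm c (metricForm n M) y) (chartForm c φ y))
      (chartAt (ℝ^n) c).target :=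
    (contDiffOn_relTrace (hasSmoothComponents_metricForm.contDiffOn c)
      (fun y hy ↦ det_gramMatrix_chartForm_metricForm_ne_zero hy)
      (hφ.contDiffOn c)).contMDiffOn
  refine ((hchart.comp (contMDiffOn_chart (I := 𝓡 n) (n := ∞) (x := c))
    fun x hx ↦ (chartAt _ c).map_source hx).contMDiffAt hc).congr_of_eventuallyEq ?_
  filter_upwards [hc] with x hx
  have htrace := metricTrace_eq_relTrace ((chartAt (ℝ^n) c).map_source hx) φ (stdBasis n)
  rw [(chartAt (ℝ^n) c).left_inv hx] at htrace
  exact htrace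

end Metric

section Pullback

variable {m : ℕ} {N : Type*} [TopologicalSpace N] [ChartedSpace (ℝ^m) N]
  [RiemannianBundle (fun x : N ↦ TangentSpace (𝓡 m) x)]

omit [IsManifold (𝓡 n) ∞ M] in
theorem pullbackMetric_apply (f : M → N) (x : M) (v w : TangentSpace (𝓡 n) x) :
    pullbackMetric n m f x v w = metricForm m N (f x) (mfderiv (𝓡 n) (𝓡 m) f x v)
      (mfderiv (𝓡 n) (𝓡 m) f x w) := rfl

variable [IsManifold (𝓡 m) ∞ N]
  [IsContMDiffRiemannianBundle (𝓡 m) ∞ (ℝ^m) (fun x : N ↦ TangentSpace (𝓡 m) x)]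

theorem hasSmoothComponents_pullbackMetric {f : M → N} (hf : ContMDiff (𝓡 n) (𝓡 m) ∞ f) :
    HasSmoothComponents (pullbackMetric n m f) := fun c a a' ↦ by
  have hpush : ∀ a, ContMDiffOn (𝓡 n) ((𝓡 m).prod 𝓘(ℝ, ℝ^m)) ∞
      (fun x ↦ TotalSpace.mk' (ℝ^m) (E := fun y : N ↦ TangentSpace (𝓡 m) y)
        (f x) (mfderiv (𝓡 n) (𝓡 m) f x (frame n c x a))) (chartAt (ℝ^n) c).source := fun a ↦
    (hf.contMDiff_tangentMap (by simp)).comp_contMDiffOn (contMDiffOn_frame c a)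
  exact ContMDiffOn.inner_bundle (IB := 𝓡 m) (F := ℝ^m)
    (E := fun y : N ↦ TangentSpace (𝓡 m) y) (b := f) (hpush a) (hpush a')

theorem contMDiff_energyDensity
    [IsContMDiffRiemannianBundle (𝓡 n) ∞ (ℝ^n) (fun x : M ↦ TangentSpace (𝓡 n) x)] {f : M → N}
    (hf : ContMDiff (𝓡 n) (𝓡 m) ∞ f) :
    ContMDiff (𝓡 n) 𝓘(ℝ, ℝ) ∞ (energyDensity n m f) :=
  contMDiff_metricTrace (hasSmoothComponents_pullbackMetric hf)

end Pullback

end Frame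

section Volume

variable {n : ℕ} {M : Type*} [TopologicalSpace M] [ChartedSpace (ℝ^n) M]
  [IsManifold (𝓡 n) ∞ M] [RiemannianBundle (fun x : M ↦ TangentSpace (𝓡 n) x)]

theorem volumeDensity_eq_relDensity {c : M} {y : ℝ^n}
    (hy : y ∈ (chartAt (ℝ^n) c).target) :
    volumeDensity c y = relDensity (stdBasis n) (chartForm c (metricForm n M) y) := by
  rw [volumeDensity, relDensity]
  congr 2
  ext i j
  simp only [Matrix.of_apply, gramMatrix, coordVector_eq_frame hy, chartForm_apply,
    metricForm_apply, stdBasis, OrthonormalBasis.coe_toBasis, EuclideanSpace.basisFun_apply]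

omit [RiemannianBundle (fun x : M ↦ TangentSpace (𝓡 n) x)] in
theorem hasFDerivAt_chart_transition {c c' : M} {y : ℝ^n} (hy : y ∈ (chartAt (ℝ^n) c).target)
    (hy' : (chartAt (ℝ^n) c).symm y ∈ (chartAt (ℝ^n) c').source) :
    HasFDerivAt (chartAt (ℝ^n) c' ∘ (chartAt (ℝ^n) c).symm)
      ((coframe n c' ((chartAt (ℝ^n) c).symm y)).comp
        (frame n c ((chartAt (ℝ^n) c).symm y))) y := by
  have hsymm : MDifferentiableAt (𝓡 n) (𝓡 n) (chartAt (ℝ^n) c).symm y :=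
    mdifferentiableAt_atlas_symm (chart_mem_atlas _ c) hy
  have hchart : MDifferentiableAt (𝓡 n) (𝓡 n) (chartAt (ℝ^n) c') ((chartAt (ℝ^n) c).symm y) :=
    mdifferentiableAt_atlas (chart_mem_atlas _ c') hy'
  have hcoframe : mfderiv (𝓡 n) (𝓡 n) (chartAt (ℝ^n) c') ((chartAt (ℝ^n) c).symm y) =
      coframe n c' ((chartAt (ℝ^n) c).symm y) := by
    rw [coframe, TangentBundle.continuousLinearMapAt_trivializationAt hy']
    simp only [mfld_simps]
  have hcomp := mfderiv_comp y hchart hsymm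
  rw [hcoframe, mfderiv_chart_symm hy, mfderiv_eq_fderiv] at hcomp
  exact hcomp ▸ (mdifferentiableAt_iff_differentiableAt.1 (hchart.comp y hsymm)).hasFDerivAt

theorem chartForm_transition
    (φ : Π x : M, TangentSpace (𝓡 n) x →L[ℝ] TangentSpace (𝓡 n) x →L[ℝ] ℝ)
    {c c' : M} {y : ℝ^n}
    (hy' : (chartAt (ℝ^n) c).symm y ∈
      (chartAt (ℝ^n) c').source) :
    chartForm c φ y = (chartForm c' φ (chartAt (ℝ^n) c'
      ((chartAt (ℝ^n) c).symm y))).bilinearComp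
      ((coframe n c' ((chartAt (ℝ^n) c).symm y)).comp
        (frame n c ((chartAt (ℝ^n) c).symm y)))
      ((coframe n c' ((chartAt (ℝ^n) c).symm y)).comp
        (frame n c ((chartAt (ℝ^n) c).symm y))) := by
  ext a a'
  simp only [ContinuousLinearMap.bilinearComp_apply, chartForm_apply,
    ContinuousLinearMap.comp_apply]
  rw [(chartAt (ℝ^n) c').left_inv hy']
  rw [frame_coframe hy', frame_coframe hy']

theorem volumeDensity_transition {c c' : M} {y : ℝ^n} (hy : y ∈ (chartAt (ℝ^n) c).target)
    (hy' : (chartAt (ℝ^n) c).symm y ∈ (chartAt (ℝ^n) c').source) :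
    volumeDensity c y = |((coframe n c' ((chartAt (ℝ^n) c).symm y)).comp
        (frame n c ((chartAt (ℝ^n) c).symm y))).det| *
      volumeDensity c' (chartAt (ℝ^n) c' ((chartAt (ℝ^n) c).symm y)) := by
  rw [volumeDensity_eq_relDensity hy, volumeDensity_eq_relDensity
    ((chartAt (ℝ^n) c').map_source hy'), chartForm_transition _ hy', relDensity_bilinearComp]

theorem volumeDensity_pos {c : M} {y : ℝ^n} (hy : y ∈ (chartAt (ℝ^n) c).target) :
    0 < volumeDensity c y := by
  rw [volumeDensity_eq_relDensity hy]
  exact (isInnerForm_chartForm_metricForm hy).relDensity_pos (stdBasis n).linearIndependent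

theorem continuousOn_volumeDensity
    [IsContMDiffRiemannianBundle (𝓡 n) ∞ (ℝ^n) (fun x : M ↦ TangentSpace (𝓡 n) x)] (c : M) :
    ContinuousOn (fun y ↦ volumeDensity (n := n) c y) (chartAt (ℝ^n) c).target :=
  (contDiffOn_relDensity (hasSmoothComponents_metricForm.contDiffOn c) fun _ hy ↦
    det_gramMatrix_chartForm_metricForm_ne_zero hy).continuousOn.congr fun _ hy ↦
    volumeDensity_eq_relDensity hy

theorem measurableSet_symm_preimage_inter_target {X Y : Type*} [TopologicalSpace X]
    [MeasurableSpace X] [BorelSpace X] [TopologicalSpace Y] [MeasurableSpace Y]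
    [OpensMeasurableSpace Y] (e : OpenPartialHomeomorph X Y) {S : Set X} (hS : MeasurableSet S) :
    MeasurableSet (e.symm ⁻¹' S ∩ e.target) := by
  have himage := MeasurableSet.subtype_image e.open_target.measurableSet
    (e.continuousOn_symm.domRestrict.measurable hS)
  convert himage using 1
  ext y
  simp [and_comm]

theorem measurableSet_symm_image {X Y : Type*} [TopologicalSpace X]
    [MeasurableSpace X] [OpensMeasurableSpace X] [TopologicalSpace Y] [MeasurableSpace Y]
    [BorelSpace Y] {e : OpenPartialHomeomorph X Y} {K : Set Y} (hK : MeasurableSet K)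
    (hKt : K ⊆ e.target) : MeasurableSet (e.symm '' K) := by
  rw [e.symm.image_eq_target_inter_inv_preimage hKt, inter_comm]
  exact measurableSet_symm_preimage_inter_target e.symm hK

theorem symm_preimage_image_inter_target {X Y : Type*} [TopologicalSpace X] [TopologicalSpace Y]
    {e : OpenPartialHomeomorph X Y} {K : Set Y} (hKt : K ⊆ e.target) :
    e.symm ⁻¹' (e.symm '' K) ∩ e.target = K :=
  e.symm.injOn.preimage_image_inter hKt

theorem restrict_iSup_eq_of_compatible {α ι : Type*} [MeasurableSpace α] {μ : ι → Measure α}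
    {U : ι → Set α} (hU : ∀ i, MeasurableSet (U i)) (hμU : ∀ i, μ i (U i)ᶜ = 0)
    (hμ : ∀ i j S, MeasurableSet S → S ⊆ U i → S ⊆ U j → μ i S = μ j S) {d : ℕ → ι}
    (hd : ⋃ k, U (d k) = univ) (i : ι) : (⨆ j, μ j).restrict (U i) = μ i := by
  let A : ℕ → Set α := disjointed fun k ↦ U (d k)
  have hA : ∀ k, MeasurableSet (A k) := MeasurableSet.disjointed fun k ↦ hU (d k)
  let ν : Measure α := Measure.sum fun k ↦ (μ (d k)).restrict (A k)
  have hν : ∀ i, ν.restrict (U i) = μ i := fun i ↦ by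
    ext S hS
    have hSi : MeasurableSet (S ∩ U i) := hS.inter (hU i)
    calc ν.restrict (U i) S = ∑' k, μ (d k) (S ∩ U i ∩ A k) := by
          simp only [ν, Measure.restrict_apply hS, Measure.sum_apply _ hSi,
            Measure.restrict_apply hSi]
      _ = ∑' k, μ i (S ∩ U i ∩ A k) := tsum_congr fun k ↦ hμ _ _ _ (hSi.inter (hA k))
          (fun x hx ↦ disjointed_subset _ k hx.2) fun x hx ↦ hx.1.2
      _ = μ i (S ∩ U i) := by
          rw [← measure_iUnion (fun k l hkl ↦ (disjoint_disjointed _ hkl).mono inter_subset_right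
            inter_subset_right) fun k ↦ hSi.inter (hA k), ← inter_iUnion, iUnion_disjointed, hd,
            inter_univ]
      _ = μ i S := measure_inter_conull (hμU i)
  refine le_antisymm ?_ ?_
  · rw [← hν i]
    exact Measure.restrict_mono_measure (iSup_le fun j ↦ hν j ▸ Measure.restrict_le_self) _
  · conv_lhs => rw [← Measure.restrict_eq_self_of_ae_mem (s := U i) (μ := μ i) (hμU i)]
    exact Measure.restrict_mono_measure (le_iSup μ i) _

variable [MeasurableSpace M] [BorelSpace M]

section ChartVolume

omit [IsManifold (𝓡 n) ∞ M]

theorem aemeasurable_chart_symm (c : M) :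
    AEMeasurable (chartAt (ℝ^n) c).symm
      ((volume.restrict (chartAt (ℝ^n) c).target).withDensity
        (fun y ↦ ENNReal.ofReal (volumeDensity c y))) :=
  ((chartAt (ℝ^n) c).continuousOn_symm.aemeasurable
    (chartAt (ℝ^n) c).open_target.measurableSet).mono_ac
    (withDensity_absolutelyContinuous _ _)

theorem chartVolume_apply (c : M) {S : Set M} (hS : MeasurableSet S) :
    chartVolume (n := n) c S = ∫⁻ y in (chartAt (ℝ^n) c).symm ⁻¹' S ∩ (chartAt (ℝ^n) c).target,
      ENNReal.ofReal (volumeDensity c y) := by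
  rw [chartVolume, Measure.map_apply_of_aemeasurable (aemeasurable_chart_symm c) hS,
    withDensity_apply', Measure.restrict_restrict' (chartAt (ℝ^n) c).open_target.measurableSet]

theorem chartVolume_compl_source (c : M) :
    chartVolume (n := n) c (chartAt (ℝ^n) c).sourceᶜ = 0 := by
  have hempty : (chartAt (ℝ^n) c).symm ⁻¹' (chartAt (ℝ^n) c).sourceᶜ ∩ (chartAt (ℝ^n) c).target
      = ∅ := eq_empty_of_forall_notMem fun y hy ↦ hy.1 ((chartAt (ℝ^n) c).map_target hy.2)
  rw [chartVolume_apply c (chartAt (ℝ^n) c).open_source.measurableSet.compl, hempty,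
    setLIntegral_empty]

end ChartVolume

theorem chartVolume_eq_of_subset {c c' : M} {S : Set M} (hS : MeasurableSet S)
    (hc : S ⊆ (chartAt (ℝ^n) c).source) (hc' : S ⊆ (chartAt (ℝ^n) c').source) :
    chartVolume (n := n) c S = chartVolume (n := n) c' S := by
  set e := chartAt (ℝ^n) c
  set e' := chartAt (ℝ^n) c'
  have himage : ∀ e : OpenPartialHomeomorph M (ℝ^n), S ⊆ e.source →
      e.symm ⁻¹' S ∩ e.target = e '' S := fun e hS ↦ by
    rw [e.image_eq_target_inter_inv_preimage hS, inter_comm]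
  have htransition : e' '' S = (e' ∘ e.symm) '' (e '' S) := by
    rw [image_comp, e.leftInvOn.image_image' hc]
  have hmeas : MeasurableSet (e '' S) :=
    himage e hc ▸ measurableSet_symm_preimage_inter_target e hS
  have hinj : InjOn (e' ∘ e.symm) (e '' S) := by
    rintro _ ⟨x, hx, rfl⟩ _ ⟨z, hz, rfl⟩ hxz
    simp only [Function.comp_apply, e.left_inv (hc hx), e.left_inv (hc hz)] at hxz
    rw [e'.injOn (hc' hx) (hc' hz) hxz]
  have hderiv : ∀ y ∈ e '' S, y ∈ e.target ∧ e.symm y ∈ e'.source := by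
    rintro _ ⟨x, hx, rfl⟩
    exact ⟨e.map_source (hc hx), (e.left_inv (hc hx)).symm ▸ hc' hx⟩
  rw [chartVolume_apply c hS, chartVolume_apply c' hS, himage e hc, himage e' hc', htransition,
    lintegral_image_eq_lintegral_abs_det_fderiv_mul volume hmeas (fun y hy ↦
      (hasFDerivAt_chart_transition (hderiv y hy).1 (hderiv y hy).2).hasFDerivWithinAt) hinj]
  refine setLIntegral_congr_fun hmeas fun y hy ↦ ?_
  simp only [volumeDensity_transition (hderiv y hy).1 (hderiv y hy).2,
    ENNReal.ofReal_mul (abs_nonneg _)]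
  rfl

variable [LindelofSpace M]

theorem riemannianVolume_restrict_source (c : M) :
    (riemannianVolume n M).restrict (chartAt (ℝ^n) c).source = chartVolume (n := n) c := by
  obtain ⟨t, ht, htU⟩ := countable_cover_nhds fun x : M ↦ chart_source_mem_nhds (ℝ^n) x
  have htne : t.Nonempty := by
    obtain ⟨x, hx, -⟩ := mem_iUnion₂.1 (htU ▸ mem_univ c)
    exact ⟨x, hx⟩
  obtain ⟨d, rfl⟩ := ht.exists_eq_range htne
  exact restrict_iSup_eq_of_compatible (fun c ↦ (chartAt (ℝ^n) c).open_source.measurableSet)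
    chartVolume_compl_source (fun _ _ _ ↦ chartVolume_eq_of_subset) (by simpa using htU) c

section Image

variable {c : M} {K : Set (ℝ^n)}

theorem riemannianVolume_restrict_image (hK : MeasurableSet K)
    (hKt : K ⊆ (chartAt (ℝ^n) c).target) :
    (riemannianVolume n M).restrict ((chartAt (ℝ^n) c).symm '' K) =
      (chartVolume (n := n) c).restrict ((chartAt (ℝ^n) c).symm '' K) := by
  rw [← riemannianVolume_restrict_source c, Measure.restrict_restrict
    (measurableSet_symm_image hK hKt), inter_eq_self_of_subset_left]
  rintro _ ⟨y, hy, rfl⟩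
  exact (chartAt (ℝ^n) c).map_target (hKt hy)

theorem riemannianVolume_image (hK : MeasurableSet K) (hKt : K ⊆ (chartAt (ℝ^n) c).target) :
    riemannianVolume n M ((chartAt (ℝ^n) c).symm '' K) =
      ∫⁻ y in K, ENNReal.ofReal (volumeDensity c y) := by
  rw [← Measure.restrict_apply_self, riemannianVolume_restrict_image hK hKt,
    Measure.restrict_apply_self, chartVolume_apply c (measurableSet_symm_image hK hKt),
    symm_preimage_image_inter_target hKt]

variable [IsContMDiffRiemannianBundle (𝓡 n) ∞ (ℝ^n) (fun x : M ↦ TangentSpace (𝓡 n) x)]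

theorem setIntegral_image (hK : MeasurableSet K) (hKt : K ⊆ (chartAt (ℝ^n) c).target) {k : M → ℝ}
    (hk : Measurable k) :
    ∫ x in (chartAt (ℝ^n) c).symm '' K, k x ∂(riemannianVolume n M) =
      ∫ y in K, volumeDensity c y * k ((chartAt (ℝ^n) c).symm y) := by
  have hdensity : AEMeasurable (fun y ↦ ENNReal.ofReal (volumeDensity c y)) (volume.restrict K) :=
    (((continuousOn_volumeDensity c).mono hKt).aemeasurable hK).ennreal_ofReal
  rw [riemannianVolume_restrict_image hK hKt, chartVolume,
    setIntegral_map (measurableSet_symm_image hK hKt) hk.aestronglyMeasurable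
      (aemeasurable_chart_symm c),
    restrict_withDensity', Measure.restrict_restrict' (chartAt (ℝ^n) c).open_target.measurableSet,
    symm_preimage_image_inter_target hKt,
    integral_withDensity_eq_integral_toReal_smul₀ hdensity (.of_forall fun _ ↦
      ENNReal.ofReal_lt_top)]
  refine setIntegral_congr_fun hK fun y hy ↦ ?_
  simp only [ENNReal.toReal_ofReal (volumeDensity_pos (hKt hy)).le, smul_eq_mul]

end Image

variable [IsContMDiffRiemannianBundle (𝓡 n) ∞ (ℝ^n) (fun x : M ↦ TangentSpace (𝓡 n) x)]

theorem isLocallyFiniteMeasure_riemannianVolume :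
    IsLocallyFiniteMeasure (riemannianVolume n M) := by
  refine ⟨fun x ↦ ?_⟩
  obtain ⟨K, hKx, hKt, hK⟩ :=
    local_compact_nhds (chart_target_mem_nhds (ℝ^n) x)
  refine ⟨(chartAt (ℝ^n) x).symm '' K, ?_, ?_⟩
  · simpa only [(chartAt (ℝ^n) x).left_inv (mem_chart_source _ x)] using
      (chartAt (ℝ^n) x).symm.image_mem_nhds (mem_chart_target _ x) hKx
  · obtain ⟨C, hC⟩ := hK.exists_bound_of_continuousOn ((continuousOn_volumeDensity x).mono hKt)
    rw [riemannianVolume_image hK.measurableSet hKt]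
    refine (setLIntegral_mono measurable_const fun y hy ↦ ENNReal.ofReal_le_ofReal
      ((le_abs_self _).trans (hC y hy))).trans_lt ?_
    rw [setLIntegral_const]
    exact ENNReal.mul_lt_top ENNReal.ofReal_lt_top hK.measure_lt_top

theorem riemannianVolume_univ_pos [Nonempty M] : 0 < riemannianVolume n M univ := by
  obtain ⟨x⟩ := ‹Nonempty M›
  have htarget : MeasurableSet (chartAt (ℝ^n) x).target :=
    (chartAt (ℝ^n) x).open_target.measurableSet
  refine lt_of_lt_of_le ?_ (measure_mono (subset_univ ((chartAt (ℝ^n) x).symm ''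
    (chartAt (ℝ^n) x).target)))
  rw [riemannianVolume_image htarget subset_rfl, pos_iff_ne_zero, Ne, lintegral_eq_zero_iff'
    ((continuousOn_volumeDensity x).aemeasurable htarget).ennreal_ofReal,
    Filter.EventuallyEq, ae_restrict_iff' htarget]
  intro hzero
  refine ((chartAt (ℝ^n) x).open_target.measure_pos volume ⟨_, mem_chart_target _ x⟩).ne'
    (measure_mono_null (fun y hy ↦ ?_) hzero)
  simpa [hy] using volumeDensity_pos hy

end Volume

section ChartFields

variable {n : ℕ} {M : Type*} [TopologicalSpace M] [ChartedSpace (ℝ^n) M]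
  [IsManifold (𝓡 n) ∞ M]

/-- The components, in the chart at `c`, of the vector field `X`. -/
def chartField (c : M) (X : Π x : M, TangentSpace (𝓡 n) x) (y : ℝ^n) : ℝ^n :=
  coframe n c ((chartAt (ℝ^n) c).symm y)
    (X ((chartAt (ℝ^n) c).symm y))

theorem frame_chartField {c : M} {y : ℝ^n}
    (hy : y ∈ (chartAt (ℝ^n) c).target)
    (X : Π x : M, TangentSpace (𝓡 n) x) :
    frame n c ((chartAt (ℝ^n) c).symm y) (chartField c X y) =
      X ((chartAt (ℝ^n) c).symm y) :=
  frame_coframe ((chartAt _ c).map_target hy) _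

theorem chartField_frame {c : M} {y : ℝ^n}
    (hy : y ∈ (chartAt (ℝ^n) c).target) (a : ℝ^n) :
    chartField c (fun x ↦ frame n c x a) y = a :=
  coframe_frame ((chartAt _ c).map_target hy) _

theorem chartField_frame_eventuallyEq {c : M} {y : ℝ^n} (hy : y ∈ (chartAt (ℝ^n) c).target)
    (a : ℝ^n) : chartField c (fun x ↦ frame n c x a) =ᶠ[𝓝 y] fun _ ↦ a := by
  filter_upwards [(chartAt _ c).open_target.mem_nhds hy] with z hz using chartField_frame hz a

theorem mpullback_chart_symm {c : M} {y : ℝ^n} (hy : y ∈ (chartAt (ℝ^n) c).target)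
    (X : Π x : M, TangentSpace (𝓡 n) x) :
    VectorField.mpullback (𝓡 n) (𝓡 n) (chartAt (ℝ^n) c).symm X y = chartField c X y := by
  have hinverse : ContinuousLinearMap.inverse (frame n c ((chartAt (ℝ^n) c).symm y)) =
      coframe n c ((chartAt (ℝ^n) c).symm y) :=
    ContinuousLinearMap.inverse_eq
      (ContinuousLinearMap.ext fun v ↦ frame_coframe ((chartAt _ c).map_target hy) v)
      (ContinuousLinearMap.ext fun v ↦ coframe_frame ((chartAt _ c).map_target hy) v)
  rw [VectorField.mpullback_apply, mfderiv_chart_symm hy]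
  exact DFunLike.congr_fun hinverse _

theorem mlieBracket_eq_frame_lieBracket {c : M} {y : ℝ^n}
    (hy : y ∈ (chartAt (ℝ^n) c).target) {X Y : Π x : M, TangentSpace (𝓡 n) x}
    (hX : MDifferentiableAt (𝓡 n) (𝓡 n).tangent (T% X) ((chartAt (ℝ^n) c).symm y))
    (hY : MDifferentiableAt (𝓡 n) (𝓡 n).tangent (T% Y) ((chartAt (ℝ^n) c).symm y)) :
    VectorField.mlieBracket (𝓡 n) X Y ((chartAt (ℝ^n) c).symm y) =
      frame n c ((chartAt (ℝ^n) c).symm y)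
        (VectorField.lieBracket ℝ (chartField c X) (chartField c Y) y) := by
  have hsymm : ContMDiffAt (𝓡 n) (𝓡 n) ∞ (chartAt (ℝ^n) c).symm y :=
    contMDiffOn_chart_symm.contMDiffAt ((chartAt _ c).open_target.mem_nhds hy)
  have htwo : minSmoothness ℝ 2 ≤ (∞ : ℕ∞ω) := by
    rw [minSmoothness_of_isRCLikeNormedField]
    exact ENat.LEInfty.out
  have : IsManifold (𝓡 n) (minSmoothness ℝ 2) M := IsManifold.of_le htwo
  have hpull : ∀ V : Π x : M, TangentSpace (𝓡 n) x,
      VectorField.mpullback (𝓡 n) (𝓡 n) (chartAt (ℝ^n) c).symm V =ᶠ[𝓝 y] chartField c V :=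
    fun V ↦ by
      filter_upwards [(chartAt _ c).open_target.mem_nhds hy] with z hz
      exact mpullback_chart_symm hz V
  have hbracket : chartField c (VectorField.mlieBracket (𝓡 n) X Y) y =
      VectorField.mlieBracket (𝓡 n) (chartField c X) (chartField c Y) y := by
    rw [← mpullback_chart_symm hy, VectorField.mpullback_mlieBracket hX hY hsymm htwo]
    exact (hpull X).mlieBracket_vectorField_eq (hpull Y)
  have hflat : VectorField.mlieBracket (𝓡 n) (chartField c X) (chartField c Y) y =
      VectorField.lieBracket ℝ (chartField c X) (chartField c Y) y := by
    have hwithin := VectorField.mlieBracketWithin_eq_lieBracketWithin (𝕜 := ℝ)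
      (V := chartField c X) (W := chartField c Y) (s := univ)
    rw [VectorField.lieBracketWithin_univ] at hwithin
    exact (congrFun VectorField.mlieBracketWithin_univ.symm y).trans (congrFun hwithin y)
  rw [← frame_chartField hy (VectorField.mlieBracket (𝓡 n) X Y), hbracket, hflat]

theorem mlieBracket_frame {c : M} {y : ℝ^n} (hy : y ∈ (chartAt (ℝ^n) c).target)
    {X : Π x : M, TangentSpace (𝓡 n) x}
    (hX : MDifferentiableAt (𝓡 n) (𝓡 n).tangent (T% X) ((chartAt (ℝ^n) c).symm y)) (a : ℝ^n) :
    VectorField.mlieBracket (𝓡 n) X (fun x ↦ frame n c x a) ((chartAt (ℝ^n) c).symm y) =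
      -frame n c ((chartAt (ℝ^n) c).symm y) (fderiv ℝ (chartField c X) y a) := by
  rw [mlieBracket_eq_frame_lieBracket hy hX
    (mdifferentiableAt_frame ((chartAt _ c).map_target hy) a), VectorField.lieBracket_eq]
  beta_reduce
  rw [(chartField_frame_eventuallyEq hy a).fderiv_eq, chartField_frame hy, fderiv_const_apply,
    zero_apply, zero_sub, map_neg]

theorem mlieBracket_frame_frame {c : M} {y : ℝ^n} (hy : y ∈ (chartAt (ℝ^n) c).target)
    (a a' : ℝ^n) :
    VectorField.mlieBracket (𝓡 n) (fun x ↦ frame n c x a) (fun x ↦ frame n c x a')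
      ((chartAt (ℝ^n) c).symm y) = 0 := by
  rw [mlieBracket_frame hy (mdifferentiableAt_frame ((chartAt _ c).map_target hy) a),
    (chartField_frame_eventuallyEq hy a).fderiv_eq, fderiv_const_apply, zero_apply, map_zero,
    neg_zero]

theorem mdifferentiableAt_of_hasSmoothComponents
    {φ : Π x : M, TangentSpace (𝓡 n) x →L[ℝ] TangentSpace (𝓡 n) x →L[ℝ] ℝ}
    (hφ : HasSmoothComponents φ) {c x : M}
    (hx : x ∈ (chartAt (ℝ^n) c).source) (a a' : ℝ^n) :
    MDifferentiableAt (𝓡 n) 𝓘(ℝ, ℝ) (fun x ↦ φ x (frame n c x a) (frame n c x a')) x :=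
  ((hφ c a a').contMDiffAt ((chartAt _ c).open_source.mem_nhds hx)).mdifferentiableAt (by simp)

variable {θ : Π x : M, TangentSpace (𝓡 n) x →L[ℝ] ℝ}

theorem contDiffOn_oneForm_frame (hθ : IsSmoothOneForm (𝓡 n) θ) (c : M) (a : ℝ^n) :
    ContDiffOn ℝ ∞ (fun y ↦ θ ((chartAt (ℝ^n) c).symm y)
      (frame n c ((chartAt (ℝ^n) c).symm y) a)) (chartAt (ℝ^n) c).target :=
  contDiffOn_comp_chart_symm (k := fun x ↦ θ x (frame n c x a)) fun x hx ↦
    (Bundle.contMDiffWithinAt_totalSpace.1 (ContMDiffOn.clm_bundle_apply (F₂ := ℝ)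
      (E₂ := Bundle.Trivial M ℝ) (ContMDiff.contMDiffOn hθ) (contMDiffOn_frame c a) x hx)).2

variable [RiemannianBundle (fun x : M ↦ TangentSpace (𝓡 n) x)]

theorem mvfderiv_form_frame
    {φ : Π x : M, TangentSpace (𝓡 n) x →L[ℝ] TangentSpace (𝓡 n) x →L[ℝ] ℝ}
    (hφ : HasSmoothComponents φ) {c : M} {y : ℝ^n}
    (hy : y ∈ (chartAt (ℝ^n) c).target) (a a' v : ℝ^n) :
    mvfderiv (𝓡 n) (fun x ↦ φ x (frame n c x a) (frame n c x a'))
      ((chartAt (ℝ^n) c).symm y)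
      (frame n c ((chartAt (ℝ^n) c).symm y) v) =
      fderiv ℝ (chartForm c φ) y v a a' := by
  rw [mvfderiv_frame hy (mdifferentiableAt_of_hasSmoothComponents hφ
    ((chartAt _ c).map_target hy) a a')]
  exact fderiv_clm_apply₂ (((hφ.contDiffOn c).contDiffAt
    ((chartAt _ c).open_target.mem_nhds hy)).differentiableAt (by simp)) v a a'

theorem chartField_sharp {c : M} {y : ℝ^n} (hy : y ∈ (chartAt (ℝ^n) c).target) :
    chartField c (sharp θ) y = ∑ i, (∑ j,
      (gramMatrix (stdBasis n) (chartForm c (metricForm n M) y))⁻¹ i j *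
      θ ((chartAt (ℝ^n) c).symm y) (frame n c ((chartAt (ℝ^n) c).symm y) (stdBasis n j))) •
        stdBasis n i := by
  rw [(isInnerForm_chartForm_metricForm hy).eq_sum_inv (stdBasis n) (chartField c (sharp θ) y)]
  simp only [chartForm_apply, frame_chartField hy, metricForm_apply, inner_sharp]

variable [IsContMDiffRiemannianBundle (𝓡 n) ∞ (ℝ^n)
    (fun x : M ↦ TangentSpace (𝓡 n) x)]

theorem mvfderiv_inner_frame {c : M} {y : ℝ^n}
    (hy : y ∈ (chartAt (ℝ^n) c).target) (a a' v : ℝ^n) :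
    mvfderiv (𝓡 n) (fun x ↦ (inner ℝ (frame n c x a) (frame n c x a') : ℝ))
      ((chartAt (ℝ^n) c).symm y)
      (frame n c ((chartAt (ℝ^n) c).symm y) v) =
      fderiv ℝ (chartForm c (metricForm n M)) y v a a' :=
  mvfderiv_form_frame hasSmoothComponents_metricForm hy a a' v

theorem inner_leviCivita_frame {c : M} {y : ℝ^n}
    (hy : y ∈ (chartAt (ℝ^n) c).target) (v a w : ℝ^n) :
    (inner ℝ (leviCivita (𝓡 n) M (fun x ↦ frame n c x a)
        ((chartAt (ℝ^n) c).symm y)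
        (frame n c ((chartAt (ℝ^n) c).symm y) v))
      (frame n c ((chartAt (ℝ^n) c).symm y) w) : ℝ) =
      christoffel (fderiv ℝ (chartForm c (metricForm n M)) y) v a w := by
  have hd := fun a ↦ mdifferentiableAt_frame (c := c) ((chartAt _ c).map_target hy) a
  have h := inner_nabla_apply (X := fun x ↦ frame n c x v) (Y := fun x ↦ frame n c x a)
    (Z := fun x ↦ frame n c x w) (hd v) (hd a) (hd w)
  change inner ℝ (nabla _ _ _) _ = _
  rw [h, koszul, mvfderiv_inner_frame hy, mvfderiv_inner_frame hy, mvfderiv_inner_frame hy,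
    mlieBracket_frame_frame hy, mlieBracket_frame_frame hy, mlieBracket_frame_frame hy]
  simp [christoffel]

theorem chartForm_lieDerivMetric {c : M} {y : ℝ^n}
    (hy : y ∈ (chartAt (ℝ^n) c).target)
    {X : Π x : M, TangentSpace (𝓡 n) x}
    (hX : MDifferentiableAt (𝓡 n) (𝓡 n).tangent (T% X) ((chartAt (ℝ^n) c).symm y)) :
    chartForm c (lieDerivMetric X) y =
      lieDerivForm (chartForm c (metricForm n M)) (chartField c X) y := by
  ext a a'
  have hd := fun a ↦ mdifferentiableAt_frame (c := c) ((chartAt _ c).map_target hy) a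
  have hlie : lieDerivMetric X ((chartAt (ℝ^n) c).symm y) (frame n c _ a)
      (frame n c _ a') = _ := TensorialAt.mkHom₂_apply _ _ (hd a) (hd a')
  rw [chartForm_apply, hlie, lieDerivMetricAux, mlieBracket_frame hy hX, mlieBracket_frame hy hX,
    ← frame_chartField hy X, mvfderiv_inner_frame hy, lieDerivForm_apply, chartForm_apply,
    chartForm_apply, metricForm_apply, metricForm_apply, inner_neg_left, inner_neg_right]
  ring

theorem deltaOne_eq_neg_metricTrace {x : M}
    (hθ : MDifferentiableAt (𝓡 n) (𝓡 n).tangent (T% (sharp θ)) x) :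
    deltaOne θ x = -metricTrace (deltaStar θ x) := by
  rw [deltaOne, metricTrace]
  congr 1
  refine Finset.sum_congr rfl fun i _ ↦ ?_
  set v := orthoBasis (𝓡 n) x i
  have hv := mdifferentiableAt_extend (𝓡 n) (ℝ^n) v
  have hvx := extend_apply_self (ℝ^n) v
  have hnabla : inner ℝ (leviCivita (𝓡 n) M (sharp θ) x v) v =
      koszul (extend (ℝ^n) v) (sharp θ) (extend (ℝ^n) v) x := by
    rw [← inner_nabla_apply hv hθ hv, hvx]
    rfl
  have hlie : lieDerivMetric (sharp θ) x v v =
      lieDerivMetricAux (sharp θ) (extend (ℝ^n) v) (extend (ℝ^n) v) x :=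
    TensorialAt.mkHom₂_apply_eq_extend _ _ _ _
  rw [hnabla, deltaStar, FunLike.coe_smul, Pi.smul_apply, FunLike.coe_smul, Pi.smul_apply, hlie,
    koszul, lieDerivMetricAux, VectorField.mlieBracket_swap_apply (V := sharp θ)]
  simp only [VectorField.mlieBracket_self, hvx, inner_neg_left, inner_neg_right, smul_eq_mul,
    Pi.zero_apply, inner_zero_left, real_inner_comm]
  ring

theorem contDiffOn_chartField_sharp (hθ : IsSmoothOneForm (𝓡 n) θ) (c : M) :
    ContDiffOn ℝ ∞ (chartField c (sharp θ)) (chartAt (ℝ^n) c).target :=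
  (ContDiffOn.sum fun i _ ↦ (ContDiffOn.sum fun j _ ↦
    (contDiffOn_gramMatrix_inv (hasSmoothComponents_metricForm.contDiffOn c)
      (fun _ hy ↦ det_gramMatrix_chartForm_metricForm_ne_zero hy) i j).mul
      (contDiffOn_oneForm_frame hθ c _)).smul contDiffOn_const).congr fun _ hy ↦
    chartField_sharp hy

theorem mdifferentiableAt_sharp (hθ : IsSmoothOneForm (𝓡 n) θ) (x : M) :
    MDifferentiableAt (𝓡 n) (𝓡 n).tangent (T% (sharp θ)) x := by
  have hcomponents : ContMDiffOn (𝓡 n) 𝓘(ℝ, ℝ^n) ∞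
      (fun z ↦ chartField x (sharp θ) (chartAt (ℝ^n) x z)) (chartAt (ℝ^n) x).source :=
    (contDiffOn_chartField_sharp hθ x).contMDiffOn.comp
      (contMDiffOn_chart (I := 𝓡 n) (n := ∞) (x := x)) fun z hz ↦ (chartAt _ x).map_source hz
  refine (((contMDiffOn_frame_apply hcomponents).contMDiffAt
    ((chartAt _ x).open_source.mem_nhds (mem_chart_source _ x))).mdifferentiableAt
    (by simp)).congr_of_eventuallyEq ?_
  filter_upwards [(chartAt (ℝ^n) x).open_source.mem_nhds (mem_chart_source _ x)] with z hz
  have hframe := frame_chartField ((chartAt (ℝ^n) x).map_source hz) (sharp θ)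
  rw [(chartAt (ℝ^n) x).left_inv hz] at hframe
  rw [hframe]

end ChartFields

section FluxDensity

variable {ι E : Type*} [Fintype ι] [DecidableEq ι] [NormedAddCommGroup E] [NormedSpace ℝ E]
  {b : Module.Basis ι ℝ E} {G : E → E →L[ℝ] E →L[ℝ] ℝ} {X : E → E}

/-- The components `√(det G) Xⁱ` of the vector density of `X` with respect to the metric `G`. Their
Euclidean divergence is the density of the divergence of `X`. -/
def fluxDensity (b : Module.Basis ι ℝ E) (G : E → E →L[ℝ] E →L[ℝ] ℝ) (X : E → E) (i : ι) (y : E) :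
    ℝ :=
  relDensity b (G y) * b.repr (X y) i

theorem contDiffOn_fluxDensity [FiniteDimensional ℝ E] {k : WithTop ℕ∞} {s : Set E}
    (hG : ContDiffOn ℝ k G s) (hdet : ∀ y ∈ s, (gramMatrix b (G y)).det ≠ 0)
    (hX : ContDiffOn ℝ k X s) (i : ι) : ContDiffOn ℝ k (fluxDensity b G X i) s :=
  (contDiffOn_relDensity hG hdet).mul
    ((LinearMap.toContinuousLinearMap (b.coord i)).contDiff.comp_contDiffOn hX)

variable {y : E}

theorem fderiv_fluxDensity [FiniteDimensional ℝ E] (hG : DifferentiableAt ℝ G y)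
    (hdet : (gramMatrix b (G y)).det ≠ 0) (hX : DifferentiableAt ℝ X y) (i : ι) (v : E) :
    fderiv ℝ (fluxDensity b G X i) y v = relDensity b (G y) * b.repr (fderiv ℝ X y v) i +
      b.repr (X y) i * fderiv ℝ (fun z ↦ relDensity b (G z)) y v := by
  have hdensity : DifferentiableAt ℝ (fun z ↦ relDensity b (G z)) y :=
    (hasFDerivAt_det_gramMatrix hG b).differentiableAt.sqrt hdet
  have hcoord : HasFDerivAt (fun z ↦ b.repr (X z) i)
      ((LinearMap.toContinuousLinearMap (b.coord i)).comp (fderiv ℝ X y)) y :=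
    (LinearMap.toContinuousLinearMap (b.coord i)).hasFDerivAt.comp y hX.hasFDerivAt
  exact DFunLike.congr_fun (hdensity.hasFDerivAt.mul hcoord).fderiv v

theorem relTrace_lieDerivForm (hG : IsInnerForm (G y)) :
    relTrace b (G y) (lieDerivForm G X y) =
      relTrace b (G y) (fderiv ℝ G y (X y)) + 2 * ∑ i, b.repr (fderiv ℝ X y (b i)) i := by
  have hswap : ∑ i, ∑ j, (gramMatrix b (G y))⁻¹ i j * G y (b i) (fderiv ℝ X y (b j)) =
      ∑ i, ∑ j, (gramMatrix b (G y))⁻¹ i j * G y (fderiv ℝ X y (b i)) (b j) := by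
    rw [Finset.sum_comm]
    refine Finset.sum_congr rfl fun i _ ↦ Finset.sum_congr rfl fun j _ ↦ ?_
    rw [hG.inv_symm, hG.symm]
  simp only [relTrace, lieDerivForm_apply, mul_add, Finset.sum_add_distrib]
  rw [hswap, hG.sum_inv_mul_apply_apply]
  ring

theorem sum_fderiv_fluxDensity [FiniteDimensional ℝ E] (hG : DifferentiableAt ℝ G y)
    (hGi : IsInnerForm (G y)) (hX : DifferentiableAt ℝ X y) :
    ∑ i, fderiv ℝ (fluxDensity b G X i) y (b i) =
      1 / 2 * relDensity b (G y) * relTrace b (G y) (lieDerivForm G X y) := by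
  have hdensity : ∑ i, b.repr (X y) i * fderiv ℝ (fun z ↦ relDensity b (G z)) y (b i) =
      1 / 2 * relDensity b (G y) * relTrace b (G y) (fderiv ℝ G y (X y)) := by
    rw [← fderiv_relDensity hG hGi b.linearIndependent]
    conv_rhs => rw [← b.sum_repr (X y)]
    simp only [map_sum, map_smul, smul_eq_mul]
  simp only [fderiv_fluxDensity hG (hGi.det_pos b.linearIndependent).ne' hX,
    Finset.sum_add_distrib]
  rw [hdensity, ← Finset.mul_sum, relTrace_lieDerivForm hGi]
  ring

end FluxDensity

section Divergence

variable {n : ℕ} {M : Type*} [TopologicalSpace M] [ChartedSpace (ℝ^n) M] [IsManifold (𝓡 n) ∞ M]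
  [RiemannianBundle (fun x : M ↦ TangentSpace (𝓡 n) x)]

theorem hasSmoothComponents_of_chartForm
    {φ : Π x : M, TangentSpace (𝓡 n) x →L[ℝ] TangentSpace (𝓡 n) x →L[ℝ] ℝ}
    (h : ∀ (c : M) (a a' : ℝ^n),
      ContDiffOn ℝ ∞ (fun y ↦ chartForm c φ y a a') (chartAt (ℝ^n) c).target) :
    HasSmoothComponents φ := fun c a a' ↦ by
  refine ((h c a a').contMDiffOn.comp (contMDiffOn_chart (I := 𝓡 n) (n := ∞) (x := c))
    fun x hx ↦ (chartAt _ c).map_source hx).congr fun x hx ↦ ?_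
  simp only [Function.comp_apply, chartForm_apply]
  rw [(chartAt (ℝ^n) c).left_inv hx]

omit [IsManifold (𝓡 n) ∞ M] in
theorem sharp_eq_zero {θ : Π x : M, TangentSpace (𝓡 n) x →L[ℝ] ℝ} {x : M} (h : θ x = 0) :
    sharp θ x = 0 := by
  simp only [sharp, h, zero_apply, zero_smul, Finset.sum_const_zero]

omit [IsManifold (𝓡 n) ∞ M] in
theorem sharp_sum {ι : Type*} (s : Finset ι) (η : ι → Π x : M, TangentSpace (𝓡 n) x →L[ℝ] ℝ)
    (x : M) : sharp (fun x ↦ ∑ i ∈ s, η i x) x = ∑ i ∈ s, sharp (η i) x := by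
  refine ext_inner_right ℝ fun v ↦ ?_
  simp only [inner_sharp, sum_inner, FunLike.coe_sum, Finset.sum_apply]

variable [IsContMDiffRiemannianBundle (𝓡 n) ∞ (ℝ^n) (fun x : M ↦ TangentSpace (𝓡 n) x)]

theorem leviCivita_sum {ι : Type*} (s : Finset ι) {X : ι → Π x : M, TangentSpace (𝓡 n) x} {x : M}
    (hX : ∀ i ∈ s, MDifferentiableAt (𝓡 n) (𝓡 n).tangent (T% (X i)) x) :
    leviCivita (𝓡 n) M (fun x ↦ ∑ i ∈ s, X i x) x = ∑ i ∈ s, leviCivita (𝓡 n) M (X i) x := by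
  classical
  induction s using Finset.induction_on with
  | empty => exact congrFun (leviCivita (𝓡 n) M).zero x
  | insert i s hi ih =>
    rw [Finset.forall_mem_insert] at hX
    simp only [Finset.sum_insert hi]
    rw [← ih hX.2]
    exact (leviCivita (𝓡 n) M).isCovariantDerivativeOnUniv.add hX.1
      (MDifferentiableAt.sum_section hX.2)

theorem deltaOne_sum {ι : Type*} (s : Finset ι)
    {η : ι → Π x : M, TangentSpace (𝓡 n) x →L[ℝ] ℝ} {x : M}
    (hη : ∀ i ∈ s, MDifferentiableAt (𝓡 n) (𝓡 n).tangent (T% (sharp (η i))) x) :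
    deltaOne (fun x ↦ ∑ i ∈ s, η i x) x = ∑ i ∈ s, deltaOne (η i) x := by
  have hsharp : sharp (fun x ↦ ∑ i ∈ s, η i x) = fun x ↦ ∑ i ∈ s, sharp (η i) x :=
    funext (sharp_sum s η)
  simp only [deltaOne, hsharp, leviCivita_sum s hη, FunLike.coe_sum, Finset.sum_apply, sum_inner,
    Finset.sum_neg_distrib]
  rw [Finset.sum_comm]

variable {θ : Π x : M, TangentSpace (𝓡 n) x →L[ℝ] ℝ}

theorem deltaOne_eq_zero_of_eventually {x : M}
    (hθ : MDifferentiableAt (𝓡 n) (𝓡 n).tangent (T% (sharp θ)) x) (h : ∀ᶠ z in 𝓝 x, θ z = 0) :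
    deltaOne θ x = 0 := by
  have hcov : leviCivita (𝓡 n) M (sharp θ) x = leviCivita (𝓡 n) M 0 x :=
    (leviCivita (𝓡 n) M).isCovariantDerivativeOnUniv.congr_of_eventuallyEq hθ
      (mdifferentiableAt_zeroSection ..) Filter.univ_mem (h.mono fun _ ↦ sharp_eq_zero)
  simp only [deltaOne, hcov, CovariantDerivative.zero, Pi.zero_apply, zero_apply, inner_zero_left,
    Finset.sum_const_zero, neg_zero]

theorem chartForm_deltaStar (hθ : IsSmoothOneForm (𝓡 n) θ) {c : M} {y : ℝ^n}
    (hy : y ∈ (chartAt (ℝ^n) c).target) :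
    chartForm c (deltaStar θ) y =
      (1 / 2 : ℝ) • lieDerivForm (chartForm c (metricForm n M)) (chartField c (sharp θ)) y := by
  rw [← chartForm_lieDerivMetric hy (mdifferentiableAt_sharp hθ _)]
  rfl

theorem hasSmoothComponents_deltaStar (hθ : IsSmoothOneForm (𝓡 n) θ) :
    HasSmoothComponents (deltaStar θ) := by
  refine hasSmoothComponents_of_chartForm fun c a a' ↦ ?_
  refine (contDiffOn_const (c := (1 / 2 : ℝ)).mul (contDiffOn_lieDerivForm_apply
    (chartAt (ℝ^n) c).open_target (hasSmoothComponents_metricForm.contDiffOn c)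
    (contDiffOn_chartField_sharp hθ c) a a')).congr fun y hy ↦ ?_
  rw [chartForm_deltaStar hθ hy]
  rfl

theorem contMDiff_deltaOne (hθ : IsSmoothOneForm (𝓡 n) θ) :
    ContMDiff (𝓡 n) 𝓘(ℝ, ℝ) ∞ (deltaOne θ) :=
  (contMDiff_metricTrace (hasSmoothComponents_deltaStar hθ)).neg.congr fun _ ↦
    deltaOne_eq_neg_metricTrace (mdifferentiableAt_sharp hθ _)

theorem volumeDensity_mul_deltaOne (hθ : IsSmoothOneForm (𝓡 n) θ) {c : M} {y : ℝ^n}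
    (hy : y ∈ (chartAt (ℝ^n) c).target) :
    volumeDensity c y * deltaOne θ ((chartAt (ℝ^n) c).symm y) =
      -∑ i, fderiv ℝ (fluxDensity (stdBasis n) (chartForm c (metricForm n M))
        (chartField c (sharp θ)) i) y (stdBasis n i) := by
  have hnhds := (chartAt (ℝ^n) c).open_target.mem_nhds hy
  have htrace : relTrace (stdBasis n) (chartForm c (metricForm n M) y)
      (chartForm c (deltaStar θ) y) = 1 / 2 * relTrace (stdBasis n)
        (chartForm c (metricForm n M) y)
        (lieDerivForm (chartForm c (metricForm n M)) (chartField c (sharp θ)) y) := by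
    rw [chartForm_deltaStar hθ hy]
    simp only [relTrace, Finset.mul_sum, FunLike.coe_smul, Pi.smul_apply, smul_eq_mul,
      mul_left_comm]
  rw [sum_fderiv_fluxDensity
      (((hasSmoothComponents_metricForm.contDiffOn c).contDiffAt hnhds).differentiableAt (by simp))
      (isInnerForm_chartForm_metricForm hy)
      (((contDiffOn_chartField_sharp hθ c).contDiffAt hnhds).differentiableAt (by simp)),
    deltaOne_eq_neg_metricTrace (mdifferentiableAt_sharp hθ _),
    metricTrace_eq_relTrace hy _ (stdBasis n), volumeDensity_eq_relDensity hy, htrace]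
  ring

variable [MeasurableSpace M] [BorelSpace M] [T2Space M]

theorem integral_deltaOne_of_forall_notMem [LindelofSpace M] (hθ : IsSmoothOneForm (𝓡 n) θ) (c : M)
    {K : Set (ℝ^n)} (hK : IsCompact K) (hKt : K ⊆ (chartAt (ℝ^n) c).target)
    (h0 : ∀ x ∉ (chartAt (ℝ^n) c).symm '' K, θ x = 0) :
    ∫ x, deltaOne θ x ∂(riemannianVolume n M) = 0 := by
  set e := chartAt (ℝ^n) c
  have hclosed : IsClosed (e.symm '' K) :=
    (hK.image_of_continuousOn (e.continuousOn_symm.mono hKt)).isClosed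
  have hvanish : ∀ x ∉ e.symm '' K, deltaOne θ x = 0 := fun x hx ↦
    deltaOne_eq_zero_of_eventually (mdifferentiableAt_sharp hθ x)
      (Filter.mem_of_superset (hclosed.isOpen_compl.mem_nhds hx) h0)
  have hflux0 : ∀ i, ∀ y ∈ e.target, y ∉ K → fluxDensity (stdBasis n)
      (chartForm c (metricForm n M)) (chartField c (sharp θ)) i y = 0 := fun i y hy hyK ↦ by
    have hx : e.symm y ∉ e.symm '' K := by
      rintro ⟨z, hz, hzy⟩
      exact hyK (e.symm.injOn (hKt hz) hy hzy ▸ hz)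
    rw [fluxDensity, chartField, sharp_eq_zero (h0 _ hx), map_zero, map_zero, Finsupp.zero_apply,
      mul_zero]
  have hflux := contDiffOn_fluxDensity ((hasSmoothComponents_metricForm (M := M)).contDiffOn c)
    (fun _ hy ↦ det_gramMatrix_chartForm_metricForm_ne_zero hy) (contDiffOn_chartField_sharp hθ c)
  have hintegrable : ∀ i, IntegrableOn (fun y ↦ fderiv ℝ (fluxDensity (stdBasis n)
      (chartForm c (metricForm n M)) (chartField c (sharp θ)) i) y (stdBasis n i)) K := fun i ↦
    ((((hflux i).continuousOn_fderiv_of_isOpen e.open_target (by simp)).clm_apply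
      continuousOn_const).mono hKt).integrableOn_compact hK
  rw [← setIntegral_eq_integral_of_forall_compl_eq_zero hvanish,
    setIntegral_image hK.measurableSet hKt (contMDiff_deltaOne hθ).continuous.measurable,
    setIntegral_congr_fun hK.measurableSet fun y hy ↦ volumeDensity_mul_deltaOne hθ (hKt hy),
    integral_neg, integral_finsetSum _ fun i _ ↦ hintegrable i, neg_eq_zero]
  exact Finset.sum_eq_zero fun i _ ↦ setIntegral_fderiv_eq_zero e.open_target hK hKt
    ((hflux i).of_le (by simp)) (hflux0 i) _

theorem integral_deltaOne_of_tsupport_subset [CompactSpace M] (hθ : IsSmoothOneForm (𝓡 n) θ)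
    {ρ : M → ℝ} (hρ : ContMDiff (𝓡 n) 𝓘(ℝ, ℝ) ∞ ρ) (c : M)
    (hsub : tsupport ρ ⊆ (chartAt (ℝ^n) c).source) :
    ∫ x, deltaOne (fun x ↦ ρ x • θ x) x ∂(riemannianVolume n M) = 0 := by
  refine integral_deltaOne_of_forall_notMem (ContMDiff.smul_section hρ hθ) c
    (K := chartAt (ℝ^n) c '' tsupport ρ) ?_ ?_ fun x hx ↦ ?_
  · exact (isClosed_tsupport _).isCompact.image_of_continuousOn
      ((chartAt _ c).continuousOn.mono hsub)
  · exact ((chartAt _ c).mapsTo.mono_left hsub).image_subset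
  · have hρx : ρ x = 0 := image_eq_zero_of_notMem_tsupport fun hxt ↦
      hx ⟨_, ⟨x, hxt, rfl⟩, (chartAt _ c).left_inv (hsub hxt)⟩
    rw [hρx, zero_smul]

theorem integral_deltaOne [CompactSpace M] (hθ : IsSmoothOneForm (𝓡 n) θ) :
    ∫ x, deltaOne θ x ∂(riemannianVolume n M) = 0 := by
  obtain ⟨t, ht⟩ := isCompact_univ.elim_nhds_subcover
    (fun x : M ↦ (chartAt (ℝ^n) x).source) fun x _ ↦ chart_source_mem_nhds _ x
  obtain ⟨ρ, hρ⟩ := SmoothPartitionOfUnity.exists_isSubordinate (𝓡 n) (isClosed_univ (X := M))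
    (fun i : t ↦ (chartAt (ℝ^n) (i : M)).source) (fun i ↦ (chartAt _ (i : M)).open_source)
    (ht.2.trans (iUnion₂_subset fun x hx ↦ subset_iUnion_of_subset ⟨x, hx⟩ Subset.rfl))
  have hη : ∀ i, IsSmoothOneForm (𝓡 n) (fun x ↦ ρ i x • θ x) := fun i ↦
    ContMDiff.smul_section (ρ i).contMDiff hθ
  have hpartition : (fun x ↦ ∑ i, ρ i x • θ x) = θ := by
    funext x
    have hone := ρ.sum_eq_one (mem_univ x)
    rw [finsum_eq_sum_of_fintype] at hone
    rw [← Finset.sum_smul, hone, one_smul]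
  have hsum : ∀ x, deltaOne θ x = ∑ i, deltaOne (fun x ↦ ρ i x • θ x) x := fun x ↦ by
    rw [← deltaOne_sum Finset.univ fun i _ ↦ mdifferentiableAt_sharp (hη i) x, hpartition]
  have := isLocallyFiniteMeasure_riemannianVolume (n := n) (M := M)
  simp only [hsum]
  rw [integral_finsetSum _ fun i _ ↦
    (contMDiff_deltaOne (hη i)).continuous.integrable_of_hasCompactSupport
      (HasCompactSupport.of_compactSpace _)]
  exact Finset.sum_eq_zero fun i _ ↦
    integral_deltaOne_of_tsupport_subset hθ (ρ i).contMDiff (i : M) (hρ i)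

end Divergence

section DomainVariations

section Pullback

variable {n : ℕ} {M : Type*} [TopologicalSpace M] [ChartedSpace (ℝ^n) M]
  {m : ℕ} {N : Type*} [TopologicalSpace N] [ChartedSpace (ℝ^m) N]
  [RiemannianBundle (fun x : N ↦ TangentSpace (𝓡 m) x)]

theorem pullbackMetric_congr [RiemannianBundle (fun x : M ↦ TangentSpace (𝓡 n) x)] {f g : M → N}
    {x : M} (h : f =ᶠ[𝓝 x] g) : pullbackMetric n m f x = pullbackMetric n m g x := by
  have hform : ∀ (p q : N) (A B : ℝ^n →L[ℝ] ℝ^m), p = q → A = B → ∀ v w : ℝ^n,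
      metricForm m N p (A v) (A w) = metricForm m N q (B v) (B w) := by
    rintro p q A B rfl rfl v w
    rfl
  ext v w
  exact hform (f x) (g x) (mfderiv (𝓡 n) (𝓡 m) f x) (mfderiv (𝓡 n) (𝓡 m) g x) h.eq_of_nhds
    h.mfderiv_eq v w

theorem pullbackMetric_comp [RiemannianBundle (fun x : M ↦ TangentSpace (𝓡 n) x)]
    {l : ℕ} {L : Type*} [TopologicalSpace L] [ChartedSpace (ℝ^l) L]
    [RiemannianBundle (fun x : L ↦ TangentSpace (𝓡 l) x)] {f : M → N} {h : L → M} {x : L}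
    (hf : MDifferentiableAt (𝓡 n) (𝓡 m) f (h x)) (hh : MDifferentiableAt (𝓡 l) (𝓡 n) h x)
    (v w : TangentSpace (𝓡 l) x) :
    pullbackMetric l m (f ∘ h) x v w =
      pullbackMetric n m f (h x) (mfderiv (𝓡 l) (𝓡 n) h x v) (mfderiv (𝓡 l) (𝓡 n) h x w) := by
  rw [pullbackMetric_apply, mfderiv_comp x hf hh]
  rfl

theorem chartForm_pullbackMetric [IsManifold (𝓡 n) ∞ M]
    [RiemannianBundle (fun x : M ↦ TangentSpace (𝓡 n) x)] {g : M → N} {c : M} {y : ℝ^n}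
    (hy : y ∈ (chartAt (ℝ^n) c).target)
    (hg : MDifferentiableAt (𝓡 n) (𝓡 m) g ((chartAt (ℝ^n) c).symm y)) (a a' : ℝ^n) :
    chartForm c (pullbackMetric n m g) y a a' =
      pullbackMetric n m (g ∘ (chartAt (ℝ^n) c).symm) y a a' := by
  have hcomp := pullbackMetric_comp hg (mdifferentiableAt_atlas_symm (chart_mem_atlas _ c) hy) a a'
  rw [mfderiv_chart_symm hy] at hcomp
  exact hcomp.symm

end Pullback

variable {n : ℕ} {M : Type*} [TopologicalSpace M] [ChartedSpace (ℝ^n) M]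

open scoped Classical in
/-- The deformation of the identity of `M` which is `y ↦ y + s • X y` in the chart at `c` and the
identity outside the domain of this chart. -/
def chartShift (c : M) (X : ℝ^n → ℝ^n) (s : ℝ) (x : M) : M :=
  if x ∈ (chartAt (ℝ^n) c).source then
    (chartAt (ℝ^n) c).symm (chartAt (ℝ^n) c x + s • X (chartAt (ℝ^n) c x))
  else x

variable {c : M} {X : ℝ^n → ℝ^n}

theorem chartShift_of_notMem (s : ℝ) {x : M} (hx : x ∉ (chartAt (ℝ^n) c).symm '' tsupport X) :
    chartShift c X s x = x := by
  rw [chartShift]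
  split_ifs with h
  · have hX : X (chartAt (ℝ^n) c x) = 0 :=
      image_eq_zero_of_notMem_tsupport fun ht ↦ hx ⟨_, ht, (chartAt _ c).left_inv h⟩
    rw [hX, smul_zero, add_zero, (chartAt _ c).left_inv h]
  · rfl

theorem chartShift_zero : chartShift c X 0 = id := by
  ext x
  rw [chartShift]
  split_ifs with h
  · rw [zero_smul, add_zero, (chartAt _ c).left_inv h, id]
  · rfl

theorem chartShift_symm (s : ℝ) {y : ℝ^n} (hy : y ∈ (chartAt (ℝ^n) c).target) :
    chartShift c X s ((chartAt (ℝ^n) c).symm y) = (chartAt (ℝ^n) c).symm (y + s • X y) := by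
  rw [chartShift, if_pos ((chartAt _ c).map_target hy), (chartAt _ c).right_inv hy]

theorem isCompact_symm_image_tsupport (hXc : HasCompactSupport X)
    (hXs : tsupport X ⊆ (chartAt (ℝ^n) c).target) :
    IsCompact ((chartAt (ℝ^n) c).symm '' tsupport X) :=
  hXc.isCompact.image_of_continuousOn ((chartAt _ c).continuousOn_symm.mono hXs)

variable [IsManifold (𝓡 n) ∞ M]

theorem contMDiffAt_chartShift_of_mem_source (hX : ContDiff ℝ ∞ X)
    (hmaps : ∀ s : ℝ, |s| ≤ 1 → ∀ y ∈ (chartAt (ℝ^n) c).target,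
      y + s • X y ∈ (chartAt (ℝ^n) c).target) {p : ℝ × M} (hp : p.2 ∈ (chartAt (ℝ^n) c).source) :
    ContMDiffAt (𝓘(ℝ, ℝ).prod (𝓡 n)) (𝓡 n) ∞
      (fun p : ℝ × M ↦ chartShift c X (Real.sin p.1) p.2) p := by
  set e := chartAt (ℝ^n) c
  have hchart : ContMDiffAt (𝓘(ℝ, ℝ).prod (𝓡 n)) 𝓘(ℝ, ℝ^n) ∞ (fun p : ℝ × M ↦ e p.2) p :=
    ((contMDiffOn_chart (I := 𝓡 n) (n := ∞) (x := c)).contMDiffAt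
      (e.open_source.mem_nhds hp)).comp p contMDiffAt_snd
  have hfield : ContMDiffAt (𝓘(ℝ, ℝ).prod (𝓡 n)) 𝓘(ℝ, ℝ^n) ∞ (fun p : ℝ × M ↦ X (e p.2)) p :=
    hX.contMDiff.contMDiffAt.comp p hchart
  have hsin : ContMDiffAt (𝓘(ℝ, ℝ).prod (𝓡 n)) 𝓘(ℝ, ℝ) ∞ (fun p : ℝ × M ↦ Real.sin p.1) p :=
    Real.contDiff_sin.contMDiff.contMDiffAt.comp p contMDiffAt_fst
  have hmem : e p.2 + Real.sin p.1 • X (e p.2) ∈ e.target :=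
    hmaps _ (Real.abs_sin_le_one _) _ (e.map_source hp)
  refine (((contMDiffOn_chart_symm (I := 𝓡 n) (n := ∞) (x := c)).contMDiffAt
    (e.open_target.mem_nhds hmem)).comp p
      (hchart.add (hsin.smul hfield))).congr_of_eventuallyEq ?_
  filter_upwards [(e.open_source.preimage continuous_snd).mem_nhds hp] with q hq
  exact if_pos hq

theorem contMDiff_chartShift [T2Space M] (hX : ContDiff ℝ ∞ X) (hXc : HasCompactSupport X)
    (hXs : tsupport X ⊆ (chartAt (ℝ^n) c).target)
    (hmaps : ∀ s : ℝ, |s| ≤ 1 → ∀ y ∈ (chartAt (ℝ^n) c).target,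
      y + s • X y ∈ (chartAt (ℝ^n) c).target) :
    ContMDiff (𝓘(ℝ, ℝ).prod (𝓡 n)) (𝓡 n) ∞
      (fun p : ℝ × M ↦ chartShift c X (Real.sin p.1) p.2) := by
  intro p
  by_cases hp : p.2 ∈ (chartAt (ℝ^n) c).source
  · exact contMDiffAt_chartShift_of_mem_source hX hmaps hp
  · have hclosed := (isCompact_symm_image_tsupport (c := c) hXc hXs).isClosed
    have hnot : p.2 ∉ (chartAt (ℝ^n) c).symm '' tsupport X := by
      rintro ⟨y, hy, hyp⟩
      exact hp (hyp ▸ (chartAt (ℝ^n) c).map_target (hXs hy))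
    refine contMDiffAt_snd.congr_of_eventuallyEq ?_
    filter_upwards [(hclosed.isOpen_compl.preimage continuous_snd).mem_nhds hnot] with q hq
    exact chartShift_of_notMem _ hq

variable [RiemannianBundle (fun x : M ↦ TangentSpace (𝓡 n) x)]
  {m : ℕ} {N : Type*} [TopologicalSpace N] [ChartedSpace (ℝ^m) N]
  [RiemannianBundle (fun x : N ↦ TangentSpace (𝓡 m) x)]

theorem chartForm_pullbackMetric_comp_chartShift {f : M → N} (hf : MDifferentiable (𝓡 n) (𝓡 m) f)
    {s : ℝ} {y : ℝ^n} (hy : y ∈ (chartAt (ℝ^n) c).target)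
    (hys : y + s • X y ∈ (chartAt (ℝ^n) c).target) (hX : DifferentiableAt ℝ X y)
    (hs : MDifferentiableAt (𝓡 n) (𝓡 n) (chartShift c X s) ((chartAt (ℝ^n) c).symm y)) :
    chartForm c (pullbackMetric n m (f ∘ chartShift c X s)) y =
      pullbackShift (chartForm c (pullbackMetric n m f)) X s y := by
  set e := chartAt (ℝ^n) c
  have hshift : HasFDerivAt (fun z ↦ z + s • X z)
      (ContinuousLinearMap.id ℝ _ + s • fderiv ℝ X y) y :=
    (hasFDerivAt_id y).add (hX.hasFDerivAt.const_smul s)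
  have hconj : (f ∘ chartShift c X s) ∘ e.symm =ᶠ[𝓝 y] (f ∘ e.symm) ∘ fun z ↦ z + s • X z := by
    filter_upwards [e.open_target.mem_nhds hy] with z hz
    simp only [Function.comp_apply, e, chartShift_symm s hz]
  have hfe : MDifferentiableAt (𝓡 n) (𝓡 m) (f ∘ e.symm) (y + s • X y) :=
    (hf _).comp _ (mdifferentiableAt_atlas_symm (chart_mem_atlas _ c) hys)
  ext a a'
  rw [chartForm_pullbackMetric hy ((hf _).comp _ hs), pullbackShift_apply,
    chartForm_pullbackMetric hys (hf _), pullbackMetric_congr hconj]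
  have hcomp := pullbackMetric_comp (h := fun z ↦ z + s • X z) hfe
    hshift.differentiableAt.mdifferentiableAt a a'
  rw [mfderiv_eq_fderiv, hshift.fderiv] at hcomp
  exact hcomp

variable [IsContMDiffRiemannianBundle (𝓡 n) ∞ (ℝ^n) (fun x : M ↦ TangentSpace (𝓡 n) x)]
  [IsManifold (𝓡 m) ∞ N]
  [IsContMDiffRiemannianBundle (𝓡 m) ∞ (ℝ^m) (fun x : N ↦ TangentSpace (𝓡 m) x)]
  [MeasurableSpace M] [BorelSpace M]

theorem setIntegral_energyDensity_comp_chartShift [LindelofSpace M] {f : M → N}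
    (hf : ContMDiff (𝓡 n) (𝓡 m) ∞ f)
    (hX : ContDiff ℝ ∞ X) (hXs : tsupport X ⊆ (chartAt (ℝ^n) c).target) {s : ℝ}
    (hs : ContMDiff (𝓡 n) (𝓡 n) ∞ (chartShift c X s))
    (hmaps : ∀ y ∈ (chartAt (ℝ^n) c).target, y + s • X y ∈ (chartAt (ℝ^n) c).target)
    (b : Module.Basis (Fin n) ℝ (ℝ^n)) :
    ∫ x in (chartAt (ℝ^n) c).symm '' tsupport X, energyDensity n m (f ∘ chartShift c X s) x
        ∂(riemannianVolume n M) =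
      ∫ y in tsupport X, volumeDensity c y * relTrace b (chartForm c (metricForm n M) y)
        (pullbackShift (chartForm c (pullbackMetric n m f)) X s y) := by
  have hmeas : MeasurableSet (tsupport X) := (isClosed_tsupport X).measurableSet
  rw [setIntegral_image hmeas hXs (contMDiff_energyDensity (hf.comp hs)).continuous.measurable]
  refine setIntegral_congr_fun hmeas fun y hy ↦ ?_
  simp only [energyDensity]
  rw [metricTrace_eq_relTrace (hXs hy) _ b,
    chartForm_pullbackMetric_comp_chartShift (hf.mdifferentiable (by simp)) (hXs hy)
      (hmaps y (hXs hy)) (hX.contDiffAt.differentiableAt (by simp))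
      (hs.mdifferentiable (by simp) _)]

variable [CompactSpace M] [T2Space M]

theorem energyOn_univ_comp_chartShift {f : M → N} (hf : ContMDiff (𝓡 n) (𝓡 m) ∞ f)
    (hX : ContDiff ℝ ∞ X) (hXc : HasCompactSupport X) (hXs : tsupport X ⊆ (chartAt (ℝ^n) c).target)
    {s : ℝ} (hs : ContMDiff (𝓡 n) (𝓡 n) ∞ (chartShift c X s))
    (hmaps : ∀ y ∈ (chartAt (ℝ^n) c).target, y + s • X y ∈ (chartAt (ℝ^n) c).target)
    (b : Module.Basis (Fin n) ℝ (ℝ^n)) :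
    energyOn n m univ (f ∘ chartShift c X s) = 1 / 2 * ((∫ y in tsupport X, volumeDensity c y *
        relTrace b (chartForm c (metricForm n M) y)
          (pullbackShift (chartForm c (pullbackMetric n m f)) X s y)) +
      ∫ x in ((chartAt (ℝ^n) c).symm '' tsupport X)ᶜ, energyDensity n m f x
        ∂(riemannianVolume n M)) := by
  have hclosed := (isCompact_symm_image_tsupport (c := c) hXc hXs).isClosed
  have := isLocallyFiniteMeasure_riemannianVolume (n := n) (M := M)
  rw [energyOn, setIntegral_univ, ← integral_add_compl hclosed.measurableSet
    ((contMDiff_energyDensity (hf.comp hs)).continuous.integrable_of_hasCompactSupport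
      (HasCompactSupport.of_compactSpace _)),
    setIntegral_energyDensity_comp_chartShift hf hX hXs hs hmaps b]
  congr 2
  refine setIntegral_congr_fun hclosed.isOpen_compl.measurableSet fun x hx ↦ ?_
  simp only [energyDensity]
  rw [pullbackMetric_congr (g := f)]
  filter_upwards [hclosed.isOpen_compl.mem_nhds hx] with z hz
  rw [Function.comp_apply, chartShift_of_notMem _ hz]

theorem IsHarmonicMap.isCriticalForDomainVariations {f : M → N} (hf : IsHarmonicMap n m f) (c : M)
    (b : Module.Basis (Fin n) ℝ (ℝ^n)) :
    IsCriticalForDomainVariations volume (chartAt (ℝ^n) c).target b (chartForm c (metricForm n M))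
      (chartForm c (pullbackMetric n m f)) := by
  intro X hX hXc hXs hmaps
  have hsmooth := contMDiff_chartShift hX hXc hXs hmaps
  have hcrit := hf.2 univ isOpen_univ isClosed_closure.isCompact
    (fun t ↦ f ∘ chartShift c X (Real.sin t)) (hf.1.comp hsmooth)
    (by rw [Real.sin_zero, chartShift_zero, Function.comp_id])
    ⟨_, isCompact_symm_image_tsupport hXc hXs, subset_univ _, fun t x hx ↦ by
      rw [Function.comp_apply, chartShift_of_notMem _ hx]⟩
  have hsmooth_at : ∀ t, ContMDiff (𝓡 n) (𝓡 n) ∞ (chartShift c X (Real.sin t)) := fun t ↦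
    hsmooth.comp (contMDiff_const.prodMk contMDiff_id)
  simp only [fun t : ℝ ↦ energyOn_univ_comp_chartShift hf.1 hX hXc hXs (hsmooth_at t)
    (hmaps _ (Real.abs_sin_le_one t)) b] at hcrit
  obtain ⟨κ, -, hκb⟩ := exists_relDensity_eq_mul (stdBasis n) b
  have h := ((hcrit.const_mul 2).sub_const (∫ x in ((chartAt (ℝ^n) c).symm '' tsupport X)ᶜ,
    energyDensity n m f x ∂(riemannianVolume n M))).const_mul κ
  rw [mul_zero, mul_zero] at h
  refine h.congr_of_eventuallyEq (.of_forall fun t ↦ ?_)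
  have hdensity : ∫ y in tsupport X, relDensity b (chartForm c (metricForm n M) y) *
      relTrace b (chartForm c (metricForm n M) y)
        (pullbackShift (chartForm c (pullbackMetric n m f)) X (Real.sin t) y) =
      κ * ∫ y in tsupport X, volumeDensity c y * relTrace b (chartForm c (metricForm n M) y)
        (pullbackShift (chartForm c (pullbackMetric n m f)) X (Real.sin t) y) := by
    rw [← integral_const_mul]
    refine setIntegral_congr_fun (isClosed_tsupport X).measurableSet fun y hy ↦ ?_
    simp only [hκb, volumeDensity_eq_relDensity (hXs hy), mul_assoc]
  simp only [hdensity]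
  ring

end DomainVariations

section TwoForms

variable {n : ℕ} {M : Type*} [TopologicalSpace M] [ChartedSpace (ℝ^n) M] {c : M}

theorem chart_symm_self (c : M) : (chartAt (ℝ^n) c).symm (chartAt (ℝ^n) c c) = c :=
  (chartAt _ c).left_inv (mem_chart_source _ c)

variable [IsManifold (𝓡 n) ∞ M]

theorem extend_eventuallyEq_frame (v : TangentSpace (𝓡 n) c) :
    ∀ᶠ x in 𝓝 c, extend (ℝ^n) v x = frame n c x (coframe n c c v) := by
  filter_upwards [(trivializationAt (ℝ^n) (TangentSpace (𝓡 n) : M → Type _) c).open_baseSet.mem_nhds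
    (mem_baseSet_trivializationAt _ _ c)] with x hx
  rw [coframe, frame, Bundle.Trivialization.continuousLinearMapAt_apply,
    Bundle.Trivialization.coe_linearMapAt_of_mem _ (mem_baseSet_trivializationAt _ _ c),
    FiberBundle.extend, Bundle.Trivialization.symmL_apply _ hx]

variable {φ ψ : Π x : M, TangentSpace (𝓡 n) x →L[ℝ] TangentSpace (𝓡 n) x →L[ℝ] ℝ}

theorem form_extend_eventuallyEq (a a' : TangentSpace (𝓡 n) c) :
    (fun x ↦ φ x (extend (ℝ^n) a x) (extend (ℝ^n) a' x)) =ᶠ[𝓝 c]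
      fun x ↦ φ x (frame n c x (coframe n c c a)) (frame n c x (coframe n c c a')) := by
  filter_upwards [extend_eventuallyEq_frame a, extend_eventuallyEq_frame a'] with x h h'
  rw [h, h']

theorem mdifferentiableAt_form_extend (hφ : HasSmoothComponents φ) (a a' : TangentSpace (𝓡 n) c) :
    MDifferentiableAt (𝓡 n) 𝓘(ℝ, ℝ) (fun x ↦ φ x (extend (ℝ^n) a x) (extend (ℝ^n) a' x)) c :=
  (mdifferentiableAt_of_hasSmoothComponents hφ (mem_chart_source _ c) _ _).congr_of_eventuallyEq
    (form_extend_eventuallyEq a a')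

variable [RiemannianBundle (fun x : M ↦ TangentSpace (𝓡 n) x)]

theorem chartForm_center (c : M) (a a' : ℝ^n) :
    chartForm c φ (chartAt (ℝ^n) c c) a a' = φ c (frame n c c a) (frame n c c a') := by
  rw [chartForm_apply, chart_symm_self]

theorem differentiableAt_chartForm_center (hφ : HasSmoothComponents φ) (c : M) :
    DifferentiableAt ℝ (chartForm c φ) (chartAt (ℝ^n) c c) :=
  ((hφ.contDiffOn c).contDiffAt ((chartAt (ℝ^n) c).open_target.mem_nhds
    (mem_chart_target _ c))).differentiableAt (by simp)

theorem fderiv_chartForm_center_symm (hφ : HasSmoothComponents φ)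
    (hsymm : ∀ x v w, φ x v w = φ x w v) (c : M) (v a a' : ℝ^n) :
    fderiv ℝ (chartForm c φ) (chartAt (ℝ^n) c c) v a a' =
      fderiv ℝ (chartForm c φ) (chartAt (ℝ^n) c c) v a' a := by
  have hd := differentiableAt_chartForm_center hφ c
  rw [← fderiv_clm_apply₂ hd, ← fderiv_clm_apply₂ hd]
  simp only [chartForm_apply, hsymm _ (frame n c _ a)]

variable [IsContMDiffRiemannianBundle (𝓡 n) ∞ (ℝ^n) (fun x : M ↦ TangentSpace (𝓡 n) x)]

theorem leviCivita_extend (a : TangentSpace (𝓡 n) c) :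
    leviCivita (𝓡 n) M (extend (ℝ^n) a) c =
      leviCivita (𝓡 n) M (fun x ↦ frame n c x (coframe n c c a)) c :=
  (leviCivita (𝓡 n) M).isCovariantDerivativeOnUniv.congr_of_eventuallyEq
    (mdifferentiableAt_extend (𝓡 n) _ a) (mdifferentiableAt_frame (mem_chart_source _ c) _)
    Filter.univ_mem (extend_eventuallyEq_frame a)

theorem nablaForm_add (hφ : HasSmoothComponents φ) (hψ : HasSmoothComponents ψ)
    (v a a' : TangentSpace (𝓡 n) c) :
    nablaForm (fun x ↦ φ x + ψ x) c v a a' = nablaForm φ c v a a' + nablaForm ψ c v a a' := by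
  have hadd : mvfderiv (𝓡 n) (fun x ↦ (φ x + ψ x) (extend (ℝ^n) a x) (extend (ℝ^n) a' x)) c =
      mvfderiv (𝓡 n) (fun x ↦ φ x (extend (ℝ^n) a x) (extend (ℝ^n) a' x)) c +
      mvfderiv (𝓡 n) (fun x ↦ ψ x (extend (ℝ^n) a x) (extend (ℝ^n) a' x)) c :=
    mvfderiv_add (mdifferentiableAt_form_extend hφ a a') (mdifferentiableAt_form_extend hψ a a')
  rw [nablaForm, hadd]
  simp only [nablaForm, add_apply]
  ring

theorem deltaTwo_add (hφ : HasSmoothComponents φ) (hψ : HasSmoothComponents ψ)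
    (w : TangentSpace (𝓡 n) c) :
    deltaTwo (fun x ↦ φ x + ψ x) c w = deltaTwo φ c w + deltaTwo ψ c w := by
  simp only [deltaTwo, nablaForm_add hφ hψ, Finset.sum_add_distrib, neg_add]

theorem inner_leviCivita_frame_center (c : M) (v a w : ℝ^n) :
    inner ℝ (leviCivita (𝓡 n) M (fun x ↦ frame n c x a) c (frame n c c v)) (frame n c c w) =
      christoffel (fderiv ℝ (chartForm c (metricForm n M)) (chartAt (ℝ^n) c c)) v a w := by
  have h := inner_leviCivita_frame (mem_chart_target (ℝ^n) c) v a w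
  rw [chart_symm_self] at h
  exact h

theorem nablaForm_frame (hφ : HasSmoothComponents φ) (c : M) (v a a' : ℝ^n) :
    nablaForm φ c (frame n c c v) (frame n c c a) (frame n c c a') =
      fderiv ℝ (chartForm c φ) (chartAt (ℝ^n) c c) v a a'
      - φ c (leviCivita (𝓡 n) M (fun x ↦ frame n c x a) c (frame n c c v)) (frame n c c a')
      - φ c (frame n c c a)
        (leviCivita (𝓡 n) M (fun x ↦ frame n c x a') c (frame n c c v)) := by
  have hext : mvfderiv (𝓡 n) (fun x ↦ φ x (extend (ℝ^n) (frame n c c a) x)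
      (extend (ℝ^n) (frame n c c a') x)) c (frame n c c v) = _ :=
    DFunLike.congr_fun
      ((form_extend_eventuallyEq (φ := φ) (frame n c c a) (frame n c c a')).mfderiv_eq
        (I := 𝓡 n) (I' := 𝓘(ℝ, ℝ))) _
  have h := mvfderiv_form_frame hφ (mem_chart_target (ℝ^n) c) a a' v
  rw [chart_symm_self] at h
  rw [nablaForm, leviCivita_extend, leviCivita_extend, hext,
    coframe_frame (mem_chart_source _ c), coframe_frame (mem_chart_source _ c), ← h]
  rfl

end TwoForms

section OrthoChartBasis

variable {n : ℕ} {M : Type*} [TopologicalSpace M] [ChartedSpace (ℝ^n) M]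

theorem finrank_tangentSpace (c : M) : Module.finrank ℝ (TangentSpace (𝓡 n) c) = n :=
  finrank_euclideanSpace_fin (𝕜 := ℝ) (n := n)

variable [IsManifold (𝓡 n) ∞ M] [RiemannianBundle (fun x : M ↦ TangentSpace (𝓡 n) x)]
  {φ : Π x : M, TangentSpace (𝓡 n) x →L[ℝ] TangentSpace (𝓡 n) x →L[ℝ] ℝ}

variable (n) in
/-- The basis of `ℝ^n` formed by the components, in the chart at `c`, of the orthonormal basis
`orthoBasis` of the tangent space at `c`. -/
def orthoChartBasis (c : M) : Module.Basis (Fin n) ℝ (ℝ^n) :=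
  ((orthoBasis (𝓡 n) c).toBasis.reindex (finCongr (finrank_tangentSpace c))).map
    (frameEquiv (mem_chart_source _ c)).symm.toLinearEquiv

theorem frame_orthoChartBasis (c : M) (i : Fin (Module.finrank ℝ (TangentSpace (𝓡 n) c))) :
    frame n c c (orthoChartBasis n c (finCongr (finrank_tangentSpace c) i)) =
      orthoBasis (𝓡 n) c i := by
  rw [orthoChartBasis, Module.Basis.map_apply, Module.Basis.reindex_apply,
    Equiv.symm_apply_apply, OrthonormalBasis.coe_toBasis]
  exact frame_coframe (mem_chart_source _ c) _

theorem sum_frame_orthoChartBasis (c : M) (F : TangentSpace (𝓡 n) c → ℝ) :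
    ∑ i, F (frame n c c (orthoChartBasis n c i)) = ∑ i, F (orthoBasis (𝓡 n) c i) := by
  rw [← (finCongr (finrank_tangentSpace c)).sum_comp]
  exact Finset.sum_congr rfl fun i _ ↦ congrArg F (frame_orthoChartBasis c i)

theorem gramMatrix_orthoChartBasis (c : M) :
    gramMatrix (orthoChartBasis n c) (chartForm c (metricForm n M) (chartAt (ℝ^n) c c)) = 1 := by
  ext i j
  obtain ⟨i, rfl⟩ := (finCongr (finrank_tangentSpace c)).surjective i
  obtain ⟨j, rfl⟩ := (finCongr (finrank_tangentSpace c)).surjective j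
  rw [gramMatrix, Matrix.of_apply, chartForm_center, frame_orthoChartBasis,
    frame_orthoChartBasis, metricForm_apply, OrthonormalBasis.inner_eq_ite, Matrix.one_apply]
  simp only [EmbeddingLike.apply_eq_iff_eq]

theorem sum_inner_mul_orthoChartBasis {c : M} (ℓ : TangentSpace (𝓡 n) c →L[ℝ] ℝ)
    (z : TangentSpace (𝓡 n) c) :
    ∑ k, inner ℝ z (frame n c c (orthoChartBasis n c k)) *
      ℓ (frame n c c (orthoChartBasis n c k)) = ℓ z := by
  rw [sum_frame_orthoChartBasis c fun v ↦ inner ℝ z v * ℓ v]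
  conv_rhs => rw [← (orthoBasis (𝓡 n) c).sum_repr' z, map_sum]
  exact Finset.sum_congr rfl fun k _ ↦ by rw [map_smul, smul_eq_mul, real_inner_comm]

variable [IsContMDiffRiemannianBundle (𝓡 n) ∞ (ℝ^n) (fun x : M ↦ TangentSpace (𝓡 n) x)]

theorem deltaTwo_frame (hφ : HasSmoothComponents φ) (c : M) (w : ℝ^n) :
    letI D := fderiv ℝ (chartForm c (metricForm n M)) (chartAt (ℝ^n) c c)
    letI H := chartForm c φ (chartAt (ℝ^n) c c)
    letI b := orthoChartBasis n c
    deltaTwo φ c (frame n c c w) =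
      -(∑ i, fderiv ℝ (chartForm c φ) (chartAt (ℝ^n) c c) (b i) (b i) w
        - ∑ i, ∑ k, christoffel D (b i) (b i) (b k) * H (b k) w
        - ∑ i, ∑ k, christoffel D (b i) w (b k) * H (b i) (b k)) := by
  rw [deltaTwo, ← sum_frame_orthoChartBasis c fun v ↦ nablaForm φ c v v (frame n c c w),
    ← Finset.sum_sub_distrib, ← Finset.sum_sub_distrib]
  refine congrArg Neg.neg (Finset.sum_congr rfl fun i _ ↦ ?_)
  rw [nablaForm_frame hφ]
  simp only [chartForm_center, ← inner_leviCivita_frame_center]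
  exact congrArg₂ (· - ·) (congrArg₂ (· - ·) rfl
    (sum_inner_mul_orthoChartBasis ((φ c).flip (frame n c c w)) _).symm)
    (sum_inner_mul_orthoChartBasis (φ c (frame n c c (orthoChartBasis n c i))) _).symm

theorem mvfderiv_metricTrace_frame (hφ : HasSmoothComponents φ) (c : M) (w : ℝ^n) :
    letI b := orthoChartBasis n c
    mvfderiv (𝓡 n) (fun x ↦ metricTrace (φ x)) c (frame n c c w) =
      ∑ i, fderiv ℝ (chartForm c φ) (chartAt (ℝ^n) c c) w (b i) (b i)
      - ∑ i, ∑ j, fderiv ℝ (chartForm c (metricForm n M)) (chartAt (ℝ^n) c c) w (b i) (b j) *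
          chartForm c φ (chartAt (ℝ^n) c c) (b i) (b j) := by
  have hy := mem_chart_target (ℝ^n) c
  have hchart := mvfderiv_frame hy (k := fun x ↦ metricTrace (φ x))
    ((contMDiff_metricTrace hφ).mdifferentiable (by simp) _) w
  rw [chart_symm_self] at hchart
  have htrace : (fun x ↦ metricTrace (φ x)) ∘ (chartAt (ℝ^n) c).symm =ᶠ[𝓝 (chartAt (ℝ^n) c c)]
      fun y ↦ relTrace (orthoChartBasis n c) (chartForm c (metricForm n M) y)
        (chartForm c φ y) := by
    filter_upwards [(chartAt (ℝ^n) c).open_target.mem_nhds hy] with y hy'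
      using metricTrace_eq_relTrace hy' φ _
  rw [hchart, htrace.fderiv_eq, fderiv_relTrace
    (differentiableAt_chartForm_center hasSmoothComponents_metricForm c)
    (differentiableAt_chartForm_center hφ c) (gramMatrix_orthoChartBasis c)]

end OrthoChartBasis

section Conservation

variable {n m : ℕ} {M : Type*} [TopologicalSpace M] [ChartedSpace (ℝ^n) M]
  [RiemannianBundle (fun x : M ↦ TangentSpace (𝓡 n) x)]
  {N : Type*} [TopologicalSpace N] [ChartedSpace (ℝ^m) N]
  [RiemannianBundle (fun x : N ↦ TangentSpace (𝓡 m) x)] {f : M → N}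

theorem metricForm_symm (x : M) (v w : TangentSpace (𝓡 n) x) :
    metricForm n M x v w = metricForm n M x w v := by
  rw [metricForm_apply, metricForm_apply, real_inner_comm]

theorem pullbackMetric_symm (f : M → N) (x : M) (v w : TangentSpace (𝓡 n) x) :
    pullbackMetric n m f x v w = pullbackMetric n m f x w v := by
  rw [pullbackMetric_apply, pullbackMetric_apply, metricForm_symm]

theorem energyDensity_nonneg (f : M → N) (x : M) : 0 ≤ energyDensity n m f x := by
  rw [energyDensity, metricTrace]
  refine Finset.sum_nonneg fun i _ ↦ ?_
  rw [pullbackMetric_apply, metricForm_apply]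
  exact real_inner_self_nonneg

variable [IsManifold (𝓡 n) ∞ M] [IsManifold (𝓡 m) ∞ N]
  [IsContMDiffRiemannianBundle (𝓡 n) ∞ (ℝ^n) (fun x : M ↦ TangentSpace (𝓡 n) x)]
  [IsContMDiffRiemannianBundle (𝓡 m) ∞ (ℝ^m) (fun x : N ↦ TangentSpace (𝓡 m) x)]
  [MeasurableSpace M] [BorelSpace M] [CompactSpace M] [T2Space M]

-- This is `div (½ e(f) g - f^*ḡ) = 0`, the conservation law of the stress-energy tensor.
theorem IsHarmonicMap.deltaTwo_pullbackMetric (hf : IsHarmonicMap n m f) (c : M)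
    (w : TangentSpace (𝓡 n) c) :
    deltaTwo (pullbackMetric n m f) c w =
      -(1 / 2) * mvfderiv (𝓡 n) (energyDensity n m f) c w := by
  obtain ⟨w, rfl⟩ : ∃ a, frame n c c a = w := ⟨_, frame_coframe (mem_chart_source _ c) w⟩
  have hG := hasSmoothComponents_metricForm (n := n) (M := M)
  have hH := hasSmoothComponents_pullbackMetric hf.1
  have hHsymm : ∀ y a a', chartForm c (pullbackMetric n m f) y a a' =
      chartForm c (pullbackMetric n m f) y a' a := fun y a a' ↦ by
    rw [chartForm_apply, chartForm_apply, pullbackMetric_symm]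
  have heuler := (hf.isCriticalForDomainVariations c (orthoChartBasis n c)
    ).sum_fderiv_of_orthonormal (chartAt (ℝ^n) c).open_target
    ((hG.contDiffOn c).of_le (by simp)) (fun y hy ↦ isInnerForm_chartForm_metricForm hy)
    ((hH.contDiffOn c).of_le (by simp)) (fun y _ ↦ hHsymm y) w (mem_chart_target _ c)
    (gramMatrix_orthoChartBasis c)
  have htrace := mvfderiv_metricTrace_frame hH c w
  rw [deltaTwo_frame hH, sum_christoffel_self,
    sum_christoffel_mul_symm (fderiv_chartForm_center_symm hG metricForm_symm c) _ _
      fun i k ↦ hHsymm _ _ _]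
  simp only [hHsymm _ _ w]
  change _ = -(1 / 2) * mvfderiv (𝓡 n) (fun x ↦ metricTrace (pullbackMetric n m f x)) c _
  rw [htrace, heuler, Finset.sum_congr rfl fun i _ ↦
    fderiv_chartForm_center_symm hH (pullbackMetric_symm f) c _ _ w]
  ring

end Conservation

section BergerEbin

variable {n m : ℕ} {M : Type*} [TopologicalSpace M] [ChartedSpace (ℝ^n) M]
  [IsManifold (𝓡 n) ∞ M]

theorem isLocallyConstant_of_mvfderiv_eq_zero {k : M → ℝ}
    (hk : MDifferentiable (𝓡 n) 𝓘(ℝ, ℝ) k) (hzero : ∀ x, mvfderiv (𝓡 n) k x = 0) :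
    IsLocallyConstant k := by
  rw [IsLocallyConstant.iff_eventually_eq]
  intro x
  set e := chartAt (ℝ^n) x
  obtain ⟨r, hr, hball⟩ := Metric.isOpen_iff.1 e.open_target (e x) (mem_chart_target _ x)
  have hdiff : DifferentiableOn ℝ (k ∘ e.symm) (Metric.ball (e x) r) := fun y hy ↦
    (mdifferentiableAt_iff_differentiableAt.1 ((hk _).comp y
      (mdifferentiableAt_atlas_symm (chart_mem_atlas _ x) (hball hy)))).differentiableWithinAt
  have hfderiv : ∀ y ∈ Metric.ball (e x) r, fderiv ℝ (k ∘ e.symm) y = 0 := fun y hy ↦ by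
    ext a
    rw [← mvfderiv_frame (hball hy) (hk _), hzero]
    rfl
  filter_upwards [e.open_source.mem_nhds (mem_chart_source _ x),
    (e.continuousAt (mem_chart_source _ x)).eventually (Metric.ball_mem_nhds _ hr)] with z hz hzr
  have hconst := Metric.isOpen_ball.is_const_of_fderiv_eq_zero
    (convex_ball (e x) r).isPreconnected hdiff hfderiv hzr (Metric.mem_ball_self hr)
  simpa only [Function.comp_apply, e.left_inv hz, e.left_inv (mem_chart_source _ x)] using hconst

variable [RiemannianBundle (fun x : M ↦ TangentSpace (𝓡 n) x)]
  [IsContMDiffRiemannianBundle (𝓡 n) ∞ (ℝ^n) (fun x : M ↦ TangentSpace (𝓡 n) x)]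
  [T2Space M] [CompactSpace M] [MeasurableSpace M] [BorelSpace M]
  {N : Type*} [TopologicalSpace N] [ChartedSpace (ℝ^m) N]
  [RiemannianBundle (fun x : N ↦ TangentSpace (𝓡 m) x)]
  {f : M → N} {θ : Π x : M, TangentSpace (𝓡 n) x →L[ℝ] ℝ}

theorem energy_eq_of_energyDensity_eq (hθ : IsSmoothOneForm (𝓡 n) θ) {C : ℝ}
    (hC : ∀ x : M, energyDensity n m f x = -deltaOne θ x + C) :
    energy n m f = C / 2 * (riemannianVolume n M).real univ := by
  have := isLocallyFiniteMeasure_riemannianVolume (n := n) (M := M)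
  have hint : Integrable (fun x ↦ -deltaOne θ x) (riemannianVolume n M) :=
    (contMDiff_deltaOne hθ).continuous.neg.integrable_of_hasCompactSupport
      (HasCompactSupport.of_compactSpace _)
  simp only [energy, hC]
  rw [integral_add hint (integrable_const C), integral_neg, integral_deltaOne hθ,
    integral_const, smul_eq_mul]
  ring

variable [IsManifold (𝓡 m) ∞ N]
  [IsContMDiffRiemannianBundle (𝓡 m) ∞ (ℝ^m) (fun x : N ↦ TangentSpace (𝓡 m) x)]

theorem IsHarmonicMap.mvfderiv_energyDensity_add_deltaOne (hf : IsHarmonicMap n m f)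
    (hθ : IsSmoothOneForm (𝓡 n) θ)
    {φ₀ : Π x : M, TangentSpace (𝓡 n) x →L[ℝ] TangentSpace (𝓡 n) x →L[ℝ] ℝ}
    (hdiv : ∀ (x : M) (w : TangentSpace (𝓡 n) x), deltaTwo φ₀ x w = 0)
    (hdec : ∀ x : M, pullbackMetric n m f x = deltaStar θ x + φ₀ x)
    (hξ : IsInfinitesimalHarmonicTransformation θ) (x : M) :
    mvfderiv (𝓡 n) (energyDensity n m f + deltaOne θ) x = 0 := by
  ext w
  have hstar := hasSmoothComponents_deltaStar hθ
  have hpull := hasSmoothComponents_pullbackMetric hf.1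
  have hφ₀ : HasSmoothComponents φ₀ := fun c a a' ↦
    ((hpull c a a').sub (hstar c a a')).congr fun x _ ↦ by
      rw [hdec, add_apply, add_apply, add_sub_cancel_left]
  have hconservation := hf.deltaTwo_pullbackMetric x w
  rw [show pullbackMetric n m f = fun x ↦ deltaStar θ x + φ₀ x from funext hdec,
    deltaTwo_add hstar hφ₀, hdiv, add_zero] at hconservation
  have hsampson := hξ x w
  rw [sampsonLaplacian, hconservation] at hsampson
  rw [mvfderiv_add ((contMDiff_energyDensity hf.1).mdifferentiable (by simp) x)
    ((contMDiff_deltaOne hθ).mdifferentiable (by simp) x), add_apply, zero_apply]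
  linarith

end BergerEbin

end RiemannianGeometry

end

open RiemannianGeometry in
theorem corollary1_general {n m : ℕ}
    {M : Type*} [TopologicalSpace M] [T2Space M] [CompactSpace M] [ConnectedSpace M]
    [ChartedSpace (EuclideanSpace ℝ (Fin n)) M] [IsManifold (𝓡 n) ∞ M]
    [RiemannianBundle (fun x : M ↦ TangentSpace (𝓡 n) x)]
    [IsContMDiffRiemannianBundle (𝓡 n) ∞ (EuclideanSpace ℝ (Fin n))
      (fun x : M ↦ TangentSpace (𝓡 n) x)]
    [MeasurableSpace M] [BorelSpace M]
    {N : Type*} [TopologicalSpace N]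
    [ChartedSpace (EuclideanSpace ℝ (Fin m)) N] [IsManifold (𝓡 m) ∞ N]
    [RiemannianBundle (fun x : N ↦ TangentSpace (𝓡 m) x)]
    [IsContMDiffRiemannianBundle (𝓡 m) ∞ (EuclideanSpace ℝ (Fin m))
      (fun x : N ↦ TangentSpace (𝓡 m) x)]
    (f : M → N) (hf : IsHarmonicMap n m f)
    (θ : Π x : M, TangentSpace (𝓡 n) x →L[ℝ] ℝ) (hθ : IsSmoothOneForm (𝓡 n) θ)
    (φ₀ : Π x : M, TangentSpace (𝓡 n) x →L[ℝ] TangentSpace (𝓡 n) x →L[ℝ] ℝ)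
    (hdiv : ∀ (x : M) (w : TangentSpace (𝓡 n) x), deltaTwo φ₀ x w = 0)
    (hdec : ∀ x : M, pullbackMetric n m f x = deltaStar θ x + φ₀ x)
    (hξ : IsInfinitesimalHarmonicTransformation θ) :
    ∃ C : ℝ, 0 ≤ C ∧
      (∀ x : M, energyDensity n m f x = -deltaOne θ x + C) ∧
      energy n m f = C / 2 * (riemannianVolume n M).real univ := by
  have hdiff : MDifferentiable (𝓡 n) 𝓘(ℝ, ℝ) (energyDensity n m f + deltaOne θ) :=
    ((contMDiff_energyDensity hf.1).add (contMDiff_deltaOne hθ)).mdifferentiable (by simp)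
  obtain ⟨C, hC⟩ := (isLocallyConstant_of_mvfderiv_eq_zero hdiff
    (hf.mvfderiv_energyDensity_add_deltaOne hθ hdiv hdec hξ)).exists_eq_const
  have hdensity : ∀ x : M, energyDensity n m f x = -deltaOne θ x + C := fun x ↦ by
    have hx := congrFun hC x
    simp only [Pi.add_apply, Function.const_apply] at hx
    linarith
  have henergy := energy_eq_of_energyDensity_eq hθ hdensity
  have := isLocallyFiniteMeasure_riemannianVolume (n := n) (M := M)
  have hvolume : 0 < (riemannianVolume n M).real univ :=
    ENNReal.toReal_pos riemannianVolume_univ_pos.ne' (measure_ne_top _ _)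
  have hnonneg : 0 ≤ energy n m f :=
    mul_nonneg (by norm_num) (integral_nonneg (energyDensity_nonneg f))
  rw [henergy] at hnonneg
  exact ⟨C, by linarith [nonneg_of_mul_nonneg_left hnonneg hvolume], hdensity, henergy⟩

theorem corollary1 {n m : ℕ} (hn : 3 ≤ n) (hm : 2 ≤ m)
    -- the compact connected Riemannian manifold `(M, g)` of dimension `n`
    {M : Type*} [TopologicalSpace M] [T2Space M] [CompactSpace M] [ConnectedSpace M]
    [ChartedSpace (EuclideanSpace ℝ (Fin n)) M] [IsManifold (𝓡 n) ∞ M]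
    [RiemannianBundle (fun x : M ↦ TangentSpace (𝓡 n) x)]
    [IsContMDiffRiemannianBundle (𝓡 n) ∞ (EuclideanSpace ℝ (Fin n))
      (fun x : M ↦ TangentSpace (𝓡 n) x)]
    [MeasurableSpace M] [BorelSpace M]
    -- the complete Riemannian manifold of dimension `m`
    {N : Type*} [EMetricSpace N]
    [ChartedSpace (EuclideanSpace ℝ (Fin m)) N] [IsManifold (𝓡 m) ∞ N]
    [RiemannianBundle (fun x : N ↦ TangentSpace (𝓡 m) x)]
    [IsContMDiffRiemannianBundle (𝓡 m) ∞ (EuclideanSpace ℝ (Fin m))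
      (fun x : N ↦ TangentSpace (𝓡 m) x)]
    [IsRiemannianManifold (𝓡 m) N] [CompleteSpace N]
    -- the harmonic map `f`
    (f : M → N) (hf : RiemannianGeometry.IsHarmonicMap n m f)
    -- the Berger-Ebin decomposition of the pullback metric
    (θ : Π x : M, TangentSpace (𝓡 n) x →L[ℝ] ℝ)
    (hθ : RiemannianGeometry.IsSmoothOneForm (𝓡 n) θ)
    (φ₀ : Π x : M, TangentSpace (𝓡 n) x →L[ℝ] TangentSpace (𝓡 n) x →L[ℝ] ℝ)
    (hφ₀ : RiemannianGeometry.IsSmoothSymmTwoForm (𝓡 n) φ₀)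
    (hdiv : ∀ (x : M) (w : TangentSpace (𝓡 n) x), RiemannianGeometry.deltaTwo φ₀ x w = 0)
    (hdec : ∀ x : M, RiemannianGeometry.pullbackMetric n m f x =
      RiemannianGeometry.deltaStar θ x + φ₀ x)
    -- `θ^♯` is an infinitesimal harmonic transformation
    (hξ : RiemannianGeometry.IsInfinitesimalHarmonicTransformation θ) :
    ∃ C : ℝ, 0 ≤ C ∧
      (∀ x : M, RiemannianGeometry.energyDensity n m f x =
        -RiemannianGeometry.deltaOne θ x + C) ∧
      RiemannianGeometry.energy n m f =
        C / 2 * (RiemannianGeometry.riemannianVolume n M).real univ := by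
  exact corollary1_general f hf θ hθ φ₀ hdiv hdec hξ
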